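/- Let $R\ge 1$, and consider an $R$-D uniform sampling grid with an $M_p$-element uniform linear array in mode $p$, $p=1,\dots,R$, a single source with spatial frequencies $\mu^{(1)},\dots,\mu^{(R)}\in\mathbb R$ and an arbitrary phase reference: the steering vector is $\boldsymbol a=\boldsymbol a^{(1)}\otimes\cdots\otimes\boldsymbol a^{(R)}$ with $\boldsymbol a^{(p)}=\big(e^{j(m-\frac{M_p-1}{2}+\delta^{(p)})\mu^{(p)}}\big)_{m=0}^{M_p-1}$. The data are $\boldsymbol X=\boldsymbol a\boldsymbol s^{T}+\boldsymbol N\in\mathbb C^{M\times N}$, $M=\prod_pM_p$, with symbols $\boldsymbol s\in\mathbb C^N$, $\boldsymbol s\ne 0$, and zero-mean circularly symmetric white noise $\boldsymbol N$ with finite second moments: for $\boldsymbol n=\mathrm{vec}\,\boldsymbol N$, $\mathbb E\{\boldsymbol n\boldsymbol n^H\}=\sigma_n^2\boldsymbol I$, $\mathbb E\{\boldsymbol n\boldsymbol n^T\}=\boldsymbol 0$, $\sigma_n>0$. In mode $p$ the grid is divided into $L_p$ maximally overlapping subarrays of $M_{\mathrm{sub},p}=M_p-L_p+1$ elements, $1\le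 L_p\le M_p$. Fix a mode $r$ with $L_r<M_r$ and $|\mu^{(r)}|<\pi$. Let $\hat\mu^{(r)}$ be the estimate of $\mu^{(r)}$ obtained by $R$-D Standard ESPRIT with spatial smoothing or $R$-D Unitary ESPRIT with spatial smoothing or, if moreover the source is strictly non-circular ($\boldsymbol s=e^{j\varphi}\boldsymbol s_0$ with $\varphi\in\mathbb R$, $\boldsymbol s_0\in\mathbb R^N$), by $R$-D NC Standard ESPRIT with spatial smoothing or $R$-D NC Unitary ESPRIT with spatial smoothing, where the shift invariance equations (for subarray parts with maximum overlap) are solved by least squares. Then in each case the estimation error has a first-order expansion $$\hat\mu^{(r)}-\mu^{(r)}=\Delta\mu^{(r)}+\mathcal O\{\|\boldsymbol N\|^2\}\qquad(\|\boldsymbol N\|\to0)$$ with $\Delta\mu^{(r)}$ a real-linear function of $\boldsymbol N$, and the first-order MSE is the same for all these algorithms: $$\mathbb E\{(\Delta\mu^{(r)})^2\}=\mathrm{MSE}^{(r)}_{\mathrm{SS}}:=\begin{cases}\dfrac1{\hat\rho}\cdot\dfrac{1}{(M_r-L_r)^2L_r}\cdot\displaystyle\prod_{p\ne r}\frac{c_p}{M_{\mathrm{sub},p}^2L_p^2}&\text{if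 }L_r\le M_r/2,\\[2ex]\dfrac1{\hat\rho}\cdot\dfrac{1}{(M_r-L_r)L_r^2}\cdot\displaystyle\prod_{p\ne r}\frac{c_p}{M_{\mathrm{sub},p}^2L_p^2}&\text{if }L_r>M_r/2,\end{cases}$$ that is, $\frac1{\hat\rho}\cdot\frac{\min\{L_r,M_r-L_r\}}{(M_r-L_r)^2L_r^2}\prod_{p\ne r}\frac{c_p}{M_{\mathrm{sub},p}^2L_p^2}$, where $\hat\rho=N\hat P_s/\sigma_n^2$ is the effective SNR, $\hat P_s=\|\boldsymbol s\|_2^2/N$ and, with $k_p=\min\{L_p,M_p-L_p\}$, $$c_p=\tfrac13(k_p+1)\big(k_p(2k_p-3M_p-2)+6M_{\mathrm{sub},p}L_p\big)-M_{\mathrm{sub},p}L_p .$$ Moreover this approximation becomes exact at high SNR: if $\boldsymbol N$ is replaced by $t\boldsymbol N$ (so that $\hat\rho$ becomes $\hat\rho/t^2$), the true MSE $\mathbb E\{(\hat\mu^{(r)}-\mu^{(r)})^2\}$ is asymptotically equal to $\mathrm{MSE}^{(r)}_{\mathrm{SS}}$ (their quotient tends to $1$) as $t\to0^+$. -/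

import Mathlib

open Matrix MeasureTheory Filter Topology Asymptotics
open scoped Kronecker

namespace SmoothedESPRIT

/-! ### Index sets and exchange matrices -/

/-- The `R`-D grid of size `D 0 × ⋯ × D (R - 1)`; positions in each mode are counted from `0`. -/
abbrev Grid {R : ℕ} (D : Fin R → ℕ) : Type := ∀ p : Fin R, Fin (D p)

/-- Index sets with their order-reversing map. The rows and columns of the matrices below are
indexed by products of `Fin n`'s; reversing the (lexicographic) stacking of such a product is
reversing every coordinate. -/
class ExchangeIndex (α : Type*) where
  rev : α → α

instance instExchangeIndexFin (n : ℕ) : ExchangeIndex (Fin n) := ⟨Fin.rev⟩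

instance instExchangeIndexPi {ι : Type*} (α : ι → Type*) [∀ i, ExchangeIndex (α i)] :
    ExchangeIndex (∀ i, α i) :=
  ⟨fun x i => ExchangeIndex.rev (x i)⟩

instance instExchangeIndexProd (α β : Type*) [ExchangeIndex α] [ExchangeIndex β] :
    ExchangeIndex (α × β) :=
  ⟨fun x => (ExchangeIndex.rev x.1, ExchangeIndex.rev x.2)⟩

/-- The exchange matrix `Π`, with ones on the anti-diagonal and zeros elsewhere. -/
def exchange (α : Type*) [DecidableEq α] [ExchangeIndex α] : Matrix α α ℂ :=
  Matrix.of fun i j => if j = ExchangeIndex.rev i then 1 else 0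

/-! ### Data model -/

/-- The steering vector `a = a⁽¹⁾ ⊗ ⋯ ⊗ a⁽ᴿ⁾` of an `R`-D uniform grid, with spatial frequency
`μ p` and phase reference shifted by `δ p` from the array centroid in mode `p`:
`a⁽ᵖ⁾ = (exp(j (m - (M_p - 1) / 2 + δ_p) μ_p))`, `m = 0, …, M_p - 1`. -/
noncomputable def steering {R : ℕ} (M : Fin R → ℕ) (δ μ : Fin R → ℝ) : Grid M → ℂ :=
  fun m => ∏ p : Fin R,
    Complex.exp (Complex.I * ((((m p : ℕ) : ℝ) - ((M p : ℝ) - 1) / 2 + δ p) * μ p : ℝ))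

/-- The noise-free measurement matrix `a sᵀ` of a single source with `N` symbols `s`. -/
noncomputable def noiseFree {R N : ℕ} (M : Fin R → ℕ) (δ μ : Fin R → ℝ) (s : Fin N → ℂ) :
    Matrix (Grid M) (Fin N) ℂ :=
  Matrix.vecMulVec (steering M δ μ) s

/-- The symbols of a strictly non-circular source: real amplitudes rotated by a common phase. -/
def IsStrictlyNonCircular {N : ℕ} (s : Fin N → ℂ) : Prop :=
  ∃ (φ : ℝ) (s₀ : Fin N → ℝ), ∀ n, s n = Complex.exp (Complex.I * φ) * (s₀ n : ℂ)

/-- The random matrix `W` is zero-mean circularly symmetric white noise of variance `σ ^ 2`: its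
entries have finite second moments, zero mean, covariance `σ² I`, and vanishing
pseudo-covariance. Nothing else is asked of the distribution. -/
structure IsCircularWhiteNoise {Ω : Type*} [MeasurableSpace Ω] (P : Measure Ω) {κ ν : Type*}
    [DecidableEq κ] [DecidableEq ν] (W : Ω → Matrix κ ν ℂ) (σ : ℝ) : Prop where
  memLp : ∀ i n, MemLp (fun ω => W ω i n) 2 P
  mean : ∀ i n, ∫ ω, W ω i n ∂P = 0
  covariance : ∀ i n i' n', ∫ ω, W ω i n * star (W ω i' n') ∂P =
    if i = i' ∧ n = n' then ((σ ^ 2 : ℝ) : ℂ) else 0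
  pseudoCovariance : ∀ i n i' n', ∫ ω, W ω i n * W ω i' n' ∂P = 0

/-! ### Preprocessing: spatial smoothing, non-circular augmentation, forward-backward averaging -/

/-- Number of elements of a subarray in each mode, `M_sub,p = M_p - L_p + 1`. -/
def subSize {R : ℕ} (M L : Fin R → ℕ) : Fin R → ℕ := fun p => M p - L p + 1

/-- The selection matrix `J_ℓ = J_{ℓ_1} ⊗ ⋯ ⊗ J_{ℓ_R}` of the subarray that starts at the grid
point `ℓ` (counted from `0`): position `k` of the subarray is position `k + ℓ` of the grid. -/
def subarraySelection {R : ℕ} (M L : Fin R → ℕ) (ℓ : Grid L) :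
    Matrix (Grid (subSize M L)) (Grid M) ℂ :=
  Matrix.of fun k m => if ∀ p, (m p : ℕ) = (k p : ℕ) + (ℓ p : ℕ) then 1 else 0

/-- Spatial smoothing: the blocks `J ℓ * X`, for all `ℓ`, side by side. -/
def smooth {lam κ κ' ν : Type*} [Fintype κ] (J : lam → Matrix κ' κ ℂ) (X : Matrix κ ν ℂ) :
    Matrix κ' (lam × ν) ℂ :=
  Matrix.of fun k q => (J q.1 * X) k q.2

/-- The augmented matrix `[X; Π X^*]` (blocks on top of each other). -/
def ncAugment {κ ν : Type*} [Fintype κ] [DecidableEq κ] [ExchangeIndex κ] (X : Matrix κ ν ℂ) :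
    Matrix (Fin 2 × κ) ν ℂ :=
  Matrix.of fun i n => if i.1 = 0 then X i.2 n else (exchange κ * X.map star) i.2 n

/-- Forward-backward averaging: `[Y, Π Y^* Π]` (blocks side by side). -/
def fba {κ ν : Type*} [Fintype κ] [DecidableEq κ] [ExchangeIndex κ] [Fintype ν] [DecidableEq ν]
    [ExchangeIndex ν] (Y : Matrix κ ν ℂ) : Matrix κ (Fin 2 × ν) ℂ :=
  Matrix.of fun i q =>
    if q.1 = 0 then Y i q.2 else (exchange κ * Y.map star * exchange ν) i q.2

/-! ### ESPRIT for one source -/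

/-- Sizes of the two maximally overlapping shifted parts of a grid of size `D` in mode `r`. -/
def shiftSize {R : ℕ} (D : Fin R → ℕ) (r : Fin R) : Fin R → ℕ := Function.update D r (D r - 1)

/-- The `r`-mode selection matrices `I ⊗ J_k ⊗ I`: for `e = 0` the first and for `e = 1` the last
`D r - 1` positions in mode `r` are selected, and all positions in the other modes. -/
def shiftSelection {R : ℕ} (D : Fin R → ℕ) (r : Fin R) (e : ℕ) :
    Matrix (Grid (shiftSize D r)) (Grid D) ℂ :=
  Matrix.of fun i j => if ∀ p, (j p : ℕ) = (i p : ℕ) + (if p = r then e else 0) then 1 else 0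

/-- `u` is a unit left singular vector of `Y` for the largest singular value of `Y`: a unit
eigenvector of `Y Yᴴ` for its largest eigenvalue. -/
def IsDominantLeftSingularVector {𝕜 κ ν : Type*} [RCLike 𝕜] [Fintype κ] [Fintype ν]
    (Y : Matrix κ ν 𝕜) (u : κ → 𝕜) : Prop :=
  star u ⬝ᵥ u = 1 ∧
  ∃ σ : ℝ, (Y * Yᴴ) *ᵥ u = ((σ ^ 2 : ℝ) : 𝕜) • u ∧
    ∀ (τ : ℝ) (v : κ → 𝕜), v ≠ 0 → (Y * Yᴴ) *ᵥ v = (τ : 𝕜) • v → τ ≤ σ ^ 2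

/-- The Moore-Penrose pseudo-inverse of a column `x`: the row `xᴴ / ‖x‖²` (zero if `x = 0`). -/
noncomputable def columnPinv {𝕜 κ : Type*} [RCLike 𝕜] [Fintype κ] (x : κ → 𝕜) : κ → 𝕜 :=
  (star x ⬝ᵥ x)⁻¹ • star x

/-- The least squares solution `γ = (A u)⁺ B u` of the shift invariance equation `A u γ ≈ B u`. -/
noncomputable def lsShift {𝕜 κ κ' : Type*} [RCLike 𝕜] [Fintype κ] [Fintype κ']
    (A B : Matrix κ' κ 𝕜) (u : κ → 𝕜) : 𝕜 :=
  columnPinv (A *ᵥ u) ⬝ᵥ (B *ᵥ u)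

/-- `m` is a Standard ESPRIT estimate (one source, selection matrices `J₁`, `J₂`) from the data
`Y`: the phase of the least squares solution for a dominant left singular vector. -/
def IsStandardEspritEstimate {κ κ' ν : Type*} [Fintype κ] [Fintype κ'] [Fintype ν]
    (J₁ J₂ : Matrix κ' κ ℂ) (Y : Matrix κ ν ℂ) (m : ℝ) : Prop :=
  ∃ u : κ → ℂ, IsDominantLeftSingularVector Y u ∧ m = (lsShift J₁ J₂ u).arg

/-- `Q` is unitary and left `Π`-real, `Π Q^* = Q`. -/
def IsUnitaryLeftPiReal {κ : Type*} [Fintype κ] [DecidableEq κ] [ExchangeIndex κ]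
    (Q : Matrix κ κ ℂ) : Prop :=
  Q ∈ Matrix.unitaryGroup κ ℂ ∧ exchange κ * Q.map star = Q

/-- `m` is a Unitary ESPRIT estimate (one source, second selection matrix `J₂`) from the data `Y`:
the forward-backward averaged data are transformed into the real matrix `Qᴴ [Y, Π Y^* Π] Q₂`, a
real dominant left singular vector `e` of it is inserted into the real shift invariance equation
`K₁ e υ ≈ K₂ e` with `K₁ = 2 Re (Q₁ᴴ J₂ Q)` and `K₂ = 2 Im (Q₁ᴴ J₂ Q)`, and the least squares
solution `υ` is mapped to `2 arctan υ`. All unitary left `Π`-real `Q`, `Q₁`, `Q₂` are admitted.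
(The first selection matrix is `Π J₂ Π` and does not appear.) -/
def IsUnitaryEspritEstimate {κ κ' ν : Type*} [Fintype κ] [DecidableEq κ] [ExchangeIndex κ]
    [Fintype κ'] [DecidableEq κ'] [ExchangeIndex κ'] [Fintype ν] [DecidableEq ν]
    [ExchangeIndex ν] (J₂ : Matrix κ' κ ℂ) (Y : Matrix κ ν ℂ) (m : ℝ) : Prop :=
  ∃ (Q : Matrix κ κ ℂ) (Q₁ : Matrix κ' κ' ℂ) (Q₂ : Matrix (Fin 2 × ν) (Fin 2 × ν) ℂ)
    (e : κ → ℝ), IsUnitaryLeftPiReal Q ∧ IsUnitaryLeftPiReal Q₁ ∧ IsUnitaryLeftPiReal Q₂ ∧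
    IsDominantLeftSingularVector ((Qᴴ * fba Y * Q₂).map Complex.re) e ∧
    m = 2 * Real.arctan (lsShift ((2 : ℝ) • (Q₁ᴴ * J₂ * Q).map Complex.re)
      ((2 : ℝ) • (Q₁ᴴ * J₂ * Q).map Complex.im) e)

/-! ### The four spatially smoothed algorithms, mode `r` -/

section Algorithms

/-- `R`-D Standard ESPRIT with spatial smoothing. -/
def SmoothedStandard {R N : ℕ} (M L : Fin R → ℕ) (r : Fin R)
    (X : Matrix (Grid M) (Fin N) ℂ) (m : ℝ) : Prop :=
  IsStandardEspritEstimate (shiftSelection (subSize M L) r 0) (shiftSelection (subSize M L) r 1)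
    (smooth (subarraySelection M L) X) m

/-- `R`-D Unitary ESPRIT with spatial smoothing. -/
def SmoothedUnitary {R N : ℕ} (M L : Fin R → ℕ) (r : Fin R)
    (X : Matrix (Grid M) (Fin N) ℂ) (m : ℝ) : Prop :=
  IsUnitaryEspritEstimate (shiftSelection (subSize M L) r 1)
    (smooth (subarraySelection M L) X) m

/-- The augmented data `[X; Π X^*]`, spatially smoothed with the matrices `I₂ ⊗ J_ℓ`. -/
def ncSmooth {R N : ℕ} (M L : Fin R → ℕ) (X : Matrix (Grid M) (Fin N) ℂ) :
    Matrix (Fin 2 × Grid (subSize M L)) (Grid L × Fin N) ℂ :=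
  smooth (fun ℓ => (1 : Matrix (Fin 2) (Fin 2) ℂ) ⊗ₖ subarraySelection M L ℓ) (ncAugment X)

/-- `R`-D NC Standard ESPRIT with spatial smoothing. -/
def SmoothedNCStandard {R N : ℕ} (M L : Fin R → ℕ) (r : Fin R)
    (X : Matrix (Grid M) (Fin N) ℂ) (m : ℝ) : Prop :=
  IsStandardEspritEstimate
    ((1 : Matrix (Fin 2) (Fin 2) ℂ) ⊗ₖ shiftSelection (subSize M L) r 0)
    ((1 : Matrix (Fin 2) (Fin 2) ℂ) ⊗ₖ shiftSelection (subSize M L) r 1)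
    (ncSmooth M L X) m

/-- `R`-D NC Unitary ESPRIT with spatial smoothing. -/
def SmoothedNCUnitary {R N : ℕ} (M L : Fin R → ℕ) (r : Fin R)
    (X : Matrix (Grid M) (Fin N) ℂ) (m : ℝ) : Prop :=
  IsUnitaryEspritEstimate
    ((1 : Matrix (Fin 2) (Fin 2) ℂ) ⊗ₖ shiftSelection (subSize M L) r 1)
    (ncSmooth M L X) m

end Algorithms

/-! ### First-order error and mean square error -/

/-- The Frobenius norm. -/
noncomputable def frob {κ ν : Type*} [Fintype κ] [Fintype ν] (E : Matrix κ ν ℂ) : ℝ :=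
  Real.sqrt (∑ i, ∑ n, ‖E i n‖ ^ 2)

/-- The real-linear functional `ℓ` is the first-order term of the estimation error at the
noise-free data `X₀`: with noise `E`, estimates exist and `m - μ = ℓ E + O(‖E‖²)`. -/
def IsFirstOrderError {κ ν : Type*} [Fintype κ] [Fintype ν] (Est : Matrix κ ν ℂ → ℝ → Prop)
    (X₀ : Matrix κ ν ℂ) (μ : ℝ) (ℓ : Matrix κ ν ℂ →ₗ[ℝ] ℝ) : Prop :=
  ∃ C ε : ℝ, 0 < ε ∧ ∀ E : Matrix κ ν ℂ, frob E < ε →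
    (∃ m, Est (X₀ + E) m) ∧ ∀ m, Est (X₀ + E) m → |m - μ - ℓ E| ≤ C * frob E ^ 2

/-- The first-order mean square error of the estimator `Est` at `X₀` under the noise `W` is `v`:
the error has a first-order term, and `v` is the expectation of its square. -/
def HasFirstOrderMSE {Ω : Type*} [MeasurableSpace Ω] (P : Measure Ω) {κ ν : Type*} [Fintype κ]
    [Fintype ν] (Est : Matrix κ ν ℂ → ℝ → Prop) (X₀ : Matrix κ ν ℂ) (μ : ℝ)
    (W : Ω → Matrix κ ν ℂ) (v : ℝ) : Prop :=
  ∃ ℓ : Matrix κ ν ℂ →ₗ[ℝ] ℝ, IsFirstOrderError Est X₀ μ ℓ ∧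
    Integrable (fun ω => ℓ (W ω) ^ 2) P ∧ ∫ ω, ℓ (W ω) ^ 2 ∂P = v

/-- High SNR asymptotics: for the noise `t W`, the true mean square error of any random variable
`m t` that is an estimate from the data `X₀ + t W` is asymptotically equal to `f t` as `t → 0`. -/
def HasHighSNRMSE {Ω : Type*} [MeasurableSpace Ω] (P : Measure Ω) {κ ν : Type*}
    (Est : Matrix κ ν ℂ → ℝ → Prop) (X₀ : Matrix κ ν ℂ) (μ : ℝ)
    (W : Ω → Matrix κ ν ℂ) (f : ℝ → ℝ) : Prop :=
  ∀ m : ℝ → Ω → ℝ,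
    (∀ t, 0 < t → AEStronglyMeasurable (m t) P ∧ ∀ᵐ ω ∂P, Est (X₀ + (t : ℂ) • W ω) (m t ω)) →
    (fun t => ∫ ω, (m t ω - μ) ^ 2 ∂P) ~[𝓝[>] 0] f

/-! ### The closed form -/

/-- Empirical source power `‖s‖² / N`. -/
noncomputable def sourcePower {N : ℕ} (s : Fin N → ℂ) : ℝ := (∑ n, ‖s n‖ ^ 2) / N

/-- Effective SNR `N * (source power) / σ²`. -/
noncomputable def effectiveSNR {N : ℕ} (s : Fin N → ℂ) (σ : ℝ) : ℝ := N * sourcePower s / σ ^ 2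

/-- The factor `c_p`, for `M` sensors and `L` subarrays, with `M_sub = M - L + 1`. -/
noncomputable def cFactor (M L : ℝ) : ℝ :=
  1 / 3 * (min L (M - L) + 1) *
      (min L (M - L) * (2 * min L (M - L) - 3 * M - 2) + 6 * (M - L + 1) * L) -
    (M - L + 1) * L

/-- The closed form of the mean square error in mode `r` for the effective SNR `ρ`. -/
noncomputable def mseSS {R : ℕ} (M L : Fin R → ℕ) (r : Fin R) (ρ : ℝ) : ℝ :=
  (if (L r : ℝ) ≤ (M r : ℝ) / 2
    then 1 / ρ * (1 / (((M r : ℝ) - L r) ^ 2 * L r))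
    else 1 / ρ * (1 / (((M r : ℝ) - L r) * (L r : ℝ) ^ 2))) *
  ∏ p ∈ Finset.univ.erase r,
    cFactor (M p) (L p) / (((M p : ℝ) - L p + 1) ^ 2 * (L p : ℝ) ^ 2)

/-- The estimator `Est` has the first-order mean square error `mseSS`, which its true mean square
error approaches at high effective SNR. -/
def AttainsMSE {Ω : Type*} [MeasurableSpace Ω] (P : Measure Ω) {R N : ℕ} (M L : Fin R → ℕ)
    (r : Fin R) (δ μ : Fin R → ℝ) (s : Fin N → ℂ) (σ : ℝ) (W : Ω → Matrix (Grid M) (Fin N) ℂ)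
    (Est : Matrix (Grid M) (Fin N) ℂ → ℝ → Prop) : Prop :=
  HasFirstOrderMSE P Est (noiseFree M δ μ s) (μ r) W (mseSS M L r (effectiveSNR s σ)) ∧
  HasHighSNRMSE P Est (noiseFree M δ μ s) (μ r) W
    (fun t => mseSS M L r (effectiveSNR s (t * σ)))

end SmoothedESPRIT

/-! After smoothing (and, for the NC variants, augmentation) the data are a rank-one matrix plus a
perturbation, `b cᵀ + F`, with `b` unimodular and `F` a real-linear image of the noise. All four
estimators are expanded to first order around `b cᵀ`, and the four expansions turn out to be one and
the same functional of the noise.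

A dominant left singular vector `u` satisfies `α u = b + F c^* / ‖c‖² + O(‖F‖²)` for some scalar `α
≠ 0` (`exists_smul_dominant_sub_isBigO`). Least squares ignores `α` and is expanded in
`lsShift_sub_isBigO`. Taking the phase, or `2 arctan` in the real-valued variants, leaves
`phaseError`, the mean over shift pairs of differences of phase errors (`standard_sub_isBigO`,
`unitary_sub_isBigO`). Forward-backward averaging and NC augmentation only add conjugated, reversed
copies. Conjugation flips the sign of a phase error and reversal exchanges the two shifted parts, so
the mean does not change (`phaseError_fba`, `phaseError_ncSmooth`). This is why one
`firstOrderError` serves all algorithms.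

Collected by grid points, the functional weights the phase error at `m` by a net count of covering
subarray elements. This count is a product over the modes (`gridWeight_eq_prod`). In mode `r` it
telescopes to a difference of two indicators, with sum of squares `2 min (L, M - L)`. In every other
mode it is the convolution of two intervals, with sum of squares `cFactor`. White circular noise
turns the sum of squared weights into the variance (`IsCircularWhiteNoise.integral_im_sq`), which
gives the closed form.

For the true MSE the remainder bound holds only for small noise, while the noise may be unbounded.
The estimates are bounded by `π`, however, so on the event of large noise the scaled squared error
is at most a multiple of `‖W‖²`; dominated convergence finishes
(`hasHighSNRMSE_of_isFirstOrderError`). -/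

namespace SmoothedESPRIT

/-! ### Dominant left singular vectors: existence and the Rayleigh bound -/

section Dominant

variable {𝕜 κ ν : Type*} [RCLike 𝕜] [Fintype κ] [Fintype ν]

theorem exists_isDominantLeftSingularVector [Nonempty κ] (Y : Matrix κ ν 𝕜) :
    ∃ u, IsDominantLeftSingularVector Y u := by
  classical
  have hH : (Y * Yᴴ).IsHermitian := isHermitian_mul_conjTranspose_self Y
  obtain ⟨i, hi⟩ := Finite.exists_max hH.eigenvalues
  have hnn : 0 ≤ hH.eigenvalues i := by
    open scoped ComplexOrder in
    exact (posSemidef_self_mul_conjTranspose Y).eigenvalues_nonneg i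
  refine ⟨(hH.eigenvectorBasis i).ofLp, ?_, Real.sqrt (hH.eigenvalues i), ?_, ?_⟩
  · have h := hH.eigenvectorBasis.orthonormal.1 i
    have h2 : inner 𝕜 (hH.eigenvectorBasis i) (hH.eigenvectorBasis i) = (1 : 𝕜) := by
      rw [inner_self_eq_norm_sq_to_K, h]; simp
    rw [EuclideanSpace.inner_eq_star_dotProduct, dotProduct_comm] at h2
    exact h2
  · rw [Real.sq_sqrt hnn, hH.mulVec_eigenvectorBasis, RCLike.real_smul_eq_coe_smul (K := 𝕜)]
  · intro τ v hv hτ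
    rw [Real.sq_sqrt hnn]
    have hmem : τ ∈ spectrum ℝ (Y * Yᴴ) := by
      rw [spectrum.mem_iff, Matrix.isUnit_iff_isUnit_det, isUnit_iff_ne_zero, not_not,
        ← Matrix.exists_mulVec_eq_zero_iff]
      refine ⟨v, hv, ?_⟩
      rw [Matrix.sub_mulVec, hτ, Matrix.algebraMap_eq_diagonal]
      ext j
      simp [Matrix.mulVec_diagonal, Algebra.smul_def]
    rw [hH.spectrum_real_eq_range_eigenvalues] at hmem
    obtain ⟨j, rfl⟩ := hmem
    exact hi j

open scoped ComplexOrder in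
-- All eigenvalues of the Hermitian matrix `c • 1 - A` are nonnegative, so it is positive
-- semidefinite.
theorem rayleigh_le_of_forall_eigenvalue_le {A : Matrix κ κ 𝕜} (hA : A.IsHermitian) {c : ℝ}
    (hc : ∀ (τ : ℝ) (v : κ → 𝕜), v ≠ 0 → A *ᵥ v = (τ : 𝕜) • v → τ ≤ c) (b : κ → 𝕜) :
    RCLike.re (star b ⬝ᵥ A *ᵥ b) ≤ c * RCLike.re (star b ⬝ᵥ b) := by
  classical
  have hH : ((c : 𝕜) • (1 : Matrix κ κ 𝕜) - A).IsHermitian := by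
    refine Matrix.IsHermitian.sub ?_ hA
    rw [Matrix.IsHermitian, conjTranspose_smul, conjTranspose_one]
    simp
  have hP : ((c : 𝕜) • (1 : Matrix κ κ 𝕜) - A).PosSemidef := by
    rw [hH.posSemidef_iff_eigenvalues_nonneg]
    intro i
    have h := hH.mulVec_eigenvectorBasis i
    rw [Matrix.sub_mulVec, Matrix.smul_mulVec, Matrix.one_mulVec,
      RCLike.real_smul_eq_coe_smul (K := 𝕜)] at h
    have h2 := hc (c - hH.eigenvalues i) (hH.eigenvectorBasis i).ofLp ?_ ?_
    · show (0 : ℝ) ≤ _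
      linarith
    · intro h0
      have := hH.eigenvectorBasis.orthonormal.1 i
      have h1 : hH.eigenvectorBasis i = 0 := by
        ext j; exact congrFun h0 j
      rw [h1] at this
      simp at this
    · push_cast
      rw [sub_smul, ← h]
      simp
  have := hP.re_dotProduct_nonneg b
  rw [Matrix.sub_mulVec, Matrix.smul_mulVec, Matrix.one_mulVec, dotProduct_sub, dotProduct_smul,
    map_sub, smul_eq_mul, RCLike.re_ofReal_mul] at this
  linarith

/-- Maximality enters the perturbation argument through this comparison: testing with the signal
vector `b` bounds `‖Yᴴ u‖` from below, so no spectral gap estimate is needed. -/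
theorem rayleigh_le_of_isDominant {Y : Matrix κ ν 𝕜} {u : κ → 𝕜}
    (hu : IsDominantLeftSingularVector Y u) (b : κ → 𝕜) :
    RCLike.re (star (Yᴴ *ᵥ b) ⬝ᵥ Yᴴ *ᵥ b) ≤
      RCLike.re (star (Yᴴ *ᵥ u) ⬝ᵥ Yᴴ *ᵥ u) * RCLike.re (star b ⬝ᵥ b) := by
  obtain ⟨h1, σ, hσ, hmax⟩ := hu
  have key : ∀ v : κ → 𝕜, star (Yᴴ *ᵥ v) ⬝ᵥ Yᴴ *ᵥ v = star v ⬝ᵥ (Y * Yᴴ) *ᵥ v := by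
    intro v
    rw [star_mulVec, conjTranspose_conjTranspose, ← dotProduct_mulVec, mulVec_mulVec]
  have h := rayleigh_le_of_forall_eigenvalue_le (isHermitian_mul_conjTranspose_self Y) hmax b
  rw [key, key, hσ, dotProduct_smul, h1]
  simpa using h

end Dominant

/-! ### Entrywise Landau symbols -/

section BigO

variable {X : Type*} {l : Filter X} {κ ν : Type*} [Fintype κ]

theorem isBigO_dotProduct {p q : X → κ → ℂ} {f₁ f₂ : X → ℝ}
    (hp : ∀ i, (fun x => p x i) =O[l] f₁) (hq : ∀ i, (fun x => q x i) =O[l] f₂) :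
    (fun x => p x ⬝ᵥ q x) =O[l] fun x => f₁ x * f₂ x := by
  simp only [dotProduct]
  exact IsBigO.fun_sum fun i _ => (hp i).mul (hq i)

theorem isBigO_star {p : X → ℂ} {f : X → ℝ} (hp : p =O[l] f) : (fun x => star (p x)) =O[l] f :=
  IsBigO.of_norm_left (by simpa only [norm_star] using hp.norm_left)

theorem isBigO_dotProduct_const {p : X → κ → ℂ} (a : κ → ℂ) {f : X → ℝ}
    (hp : ∀ i, (fun x => p x i) =O[l] f) : (fun x => a ⬝ᵥ p x) =O[l] f := by
  simpa using isBigO_dotProduct (f₁ := fun _ => (1 : ℝ)) (p := fun _ => a)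
    (fun i => isBigO_const_const _ one_ne_zero _) hp

theorem isBigO_mulVec (A : Matrix ν κ ℂ) {p : X → κ → ℂ} {f : X → ℝ}
    (hp : ∀ i, (fun x => p x i) =O[l] f) (j : ν) : (fun x => (A *ᵥ p x) j) =O[l] f :=
  isBigO_dotProduct_const (A j) hp

end BigO

/-! ### First-order perturbation of the dominant left singular vector of a rank-one matrix -/

theorem star_dotProduct_self_eq {κ : Type*} [Fintype κ] (b : κ → ℂ) :
    star b ⬝ᵥ b = ((∑ i, ‖b i‖ ^ 2 : ℝ) : ℂ) := by
  simp only [dotProduct, Pi.star_apply, Complex.star_def, Complex.conj_mul']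
  push_cast
  rfl

theorem norm_apply_le_one_of_unit {κ : Type*} [Fintype κ] {u : κ → ℂ} (hu : star u ⬝ᵥ u = 1)
    (i : κ) : ‖u i‖ ≤ 1 := by
  rw [star_dotProduct_self_eq] at hu
  have h : ∑ i, ‖u i‖ ^ 2 = 1 := by exact_mod_cast hu
  have h2 : ‖u i‖ ^ 2 ≤ ∑ i, ‖u i‖ ^ 2 :=
    Finset.single_le_sum (f := fun i => ‖u i‖ ^ 2) (fun _ _ => by positivity) (Finset.mem_univ i)
  nlinarith [norm_nonneg (u i)]

theorem sum_norm_sq_pos {κ : Type*} [Fintype κ] {b : κ → ℂ} (hb : b ≠ 0) :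
    0 < ∑ i, ‖b i‖ ^ 2 := by
  obtain ⟨i, hi⟩ := Function.ne_iff.mp hb
  exact Finset.sum_pos' (fun _ _ => by positivity)
    ⟨i, Finset.mem_univ i, by have := norm_pos_iff.mpr hi; positivity⟩

section Perturbation

variable {X : Type*} {l : Filter X} {g : X → ℝ} {κ ν : Type*} [Fintype κ] [Fintype ν]

theorem isBigO_of_mul_self (hg : Tendsto g l (𝓝 0)) : (fun x => g x * g x) =O[l] g := by
  simpa using (hg.isBigO_one ℝ).mul (isBigO_refl g l)

/-- Modulus of `c ⬝ Yᴴ u` for a dominant left singular vector `u` of `Y = b cᵀ + F`. -/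
theorem eventually_le_norm_sq_dotProduct (hg : Tendsto g l (𝓝 0)) {b : κ → ℂ} {c : ν → ℂ}
    (hb : b ≠ 0) (hc : c ≠ 0) {F : X → Matrix κ ν ℂ}
    (hF : ∀ i j, (fun x => F x i j) =O[l] g) {u : X → κ → ℂ}
    (hu : ∀ᶠ x in l, IsDominantLeftSingularVector (vecMulVec b c + F x) (u x)) :
    ∃ δ > 0, ∀ᶠ x in l, δ ≤ ‖c ⬝ᵥ ((vecMulVec b c + F x)ᴴ *ᵥ u x)‖ := by
  set B : ℝ := ∑ i, ‖b i‖ ^ 2 with hB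
  set K : ℝ := ∑ i, ‖c i‖ ^ 2 with hK
  have hB0 : 0 < B := sum_norm_sq_pos hb
  have hK0 : 0 < K := sum_norm_sq_pos hc
  have hu1 : ∀ i, (fun x => u x i) =O[l] (fun _ => (1 : ℝ)) := fun i =>
    IsBigO.of_bound 1 (hu.mono fun x hx => by simpa using norm_apply_le_one_of_unit hx.1 i)
  have hFH : ∀ (p : X → κ → ℂ), (∀ i, (fun x => p x i) =O[l] (fun _ => (1 : ℝ))) →
      ∀ j, (fun x => ((F x)ᴴ *ᵥ p x) j) =O[l] g := by
    intro p hp j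
    have h := isBigO_dotProduct (p := fun x => (F x)ᴴ j) (f₁ := g)
      (fun i => isBigO_star (hF i j)) hp
    simp only [mul_one] at h
    exact h
  have expand : ∀ (x : X) (p : κ → ℂ), (vecMulVec b c + F x)ᴴ *ᵥ p =
      (star b ⬝ᵥ p) • star c + (F x)ᴴ *ᵥ p := by
    intro x p
    rw [conjTranspose_add, add_mulVec, conjTranspose_vecMulVec, vecMulVec_mulVec]
    simp
  -- `‖η c^* + φ‖² = |η|² ‖c‖² + O(g)`. It is applied to `u`, with `η = bᴴ u`, and to the test
  -- vector `b`, with `η = ‖b‖²`.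
  have gram : ∀ (η : X → ℂ) (φ : X → ν → ℂ), η =O[l] (fun _ => (1 : ℝ)) →
      (∀ j, (fun x => φ x j) =O[l] g) →
      (fun x => star (η x • star c + φ x) ⬝ᵥ (η x • star c + φ x)
        - star (η x) * η x * (K : ℂ)) =O[l] g := by
    intro η φ hη hφ
    have h1 : (fun x => star (η x) * (c ⬝ᵥ φ x)) =O[l] g := by
      simpa using (isBigO_star hη).mul (isBigO_dotProduct_const c hφ)
    have h2 : (fun x => star (φ x) ⬝ᵥ φ x) =O[l] g :=
      (isBigO_dotProduct (p := fun x => star (φ x)) (fun i => isBigO_star (hφ i)) hφ).trans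
        (isBigO_of_mul_self hg)
    refine ((h1.add (isBigO_star h1)).add h2).congr_left fun x => ?_
    have hcc : c ⬝ᵥ star c = (K : ℂ) := by rw [dotProduct_comm, star_dotProduct_self_eq]
    have h3 : star (φ x) ⬝ᵥ star c = star (c ⬝ᵥ φ x) := by
      rw [star_dotProduct_star]
    simp only [star_add, star_smul, star_star, add_dotProduct, dotProduct_add, smul_dotProduct,
      dotProduct_smul, smul_eq_mul, star_mul', hcc, h3]
    ring
  have hη : (fun x => star b ⬝ᵥ u x) =O[l] (fun _ => (1 : ℝ)) :=
    isBigO_dotProduct_const (star b) hu1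
  have hφ := hFH u hu1
  have hconst : ∀ i : κ, (fun _ : X => b i) =O[l] (fun _ => (1 : ℝ)) := fun i =>
    isBigO_const_const _ one_ne_zero _
  have g1 := gram _ _ hη hφ
  have g2 := gram (fun _ => star b ⬝ᵥ b) _ (isBigO_const_const _ one_ne_zero _)
    (hFH (fun _ => b) hconst)
  have g3 : (fun x => c ⬝ᵥ ((vecMulVec b c + F x)ᴴ *ᵥ u x) - (K : ℂ) * (star b ⬝ᵥ u x))
      =O[l] g := by
    refine (isBigO_dotProduct_const c hφ).congr_left fun x => ?_
    have hcc : c ⬝ᵥ star c = (K : ℂ) := by rw [dotProduct_comm, star_dotProduct_self_eq]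
    rw [expand, dotProduct_add, dotProduct_smul, hcc, smul_eq_mul]
    ring
  have t1 := (g1.trans_tendsto hg)
  have t2 := (g2.trans_tendsto hg)
  have t3 := (g3.trans_tendsto hg)
  -- Tolerances of one eighth in both Gram identities turn the Rayleigh bound into `|bᴴ u|² ≥ 3B/4`,
  -- relaxed to `B / 2`. Since `c ⬝ᵥ Yᴴ u` is `K (bᴴ u)` up to an error tending to zero, half of `K
  -- √(B / 2)` survives.
  refine ⟨K * Real.sqrt (B / 2) / 2, by positivity, ?_⟩
  have e1 : ∀ᶠ x in l, _ < B * K / 8 :=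
    (tendsto_zero_iff_norm_tendsto_zero.mp t1).eventually_lt_const (by positivity)
  have e2 : ∀ᶠ x in l, _ < B * B * K / 8 :=
    (tendsto_zero_iff_norm_tendsto_zero.mp t2).eventually_lt_const (by positivity)
  have e3 : ∀ᶠ x in l, _ < K * Real.sqrt (B / 2) / 2 :=
    (tendsto_zero_iff_norm_tendsto_zero.mp t3).eventually_lt_const (by positivity)
  filter_upwards [e1, e2, e3, hu] with x h1 h2 h3 hux
  have hR := rayleigh_le_of_isDominant hux b
  rw [expand, expand] at hR
  set G1 := star ((star b ⬝ᵥ u x) • star c + (F x)ᴴ *ᵥ u x) ⬝ᵥ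
    ((star b ⬝ᵥ u x) • star c + (F x)ᴴ *ᵥ u x)
  set G2 := star ((star b ⬝ᵥ b) • star c + (F x)ᴴ *ᵥ b) ⬝ᵥ
    ((star b ⬝ᵥ b) • star c + (F x)ᴴ *ᵥ b)
  have hbb : star b ⬝ᵥ b = (B : ℂ) := star_dotProduct_self_eq b
  rw [hbb] at h2 hR
  have r1 := (Complex.abs_re_le_norm _).trans h1.le
  have r2 := (Complex.abs_re_le_norm _).trans h2.le
  have n1 : star (star b ⬝ᵥ u x) * (star b ⬝ᵥ u x) * (K : ℂ) =
      ((‖star b ⬝ᵥ u x‖ ^ 2 * K : ℝ) : ℂ) := by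
    rw [Complex.star_def, Complex.conj_mul']; push_cast; ring
  have n2 : star (B : ℂ) * (B : ℂ) * (K : ℂ) = ((B * B * K : ℝ) : ℂ) := by
    rw [Complex.star_def, Complex.conj_ofReal]; push_cast; ring
  rw [n1, Complex.sub_re, Complex.ofReal_re, abs_le] at r1
  rw [n2, Complex.sub_re, Complex.ofReal_re, abs_le] at r2
  simp only [RCLike.re_eq_complex_re, Complex.ofReal_re] at hR
  have hη2 : B / 2 ≤ ‖star b ⬝ᵥ u x‖ ^ 2 := by
    have : B * (B * K * (7 / 8)) ≤ B * (‖star b ⬝ᵥ u x‖ ^ 2 * K + B * K / 8) := by nlinarith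
    have := le_of_mul_le_mul_left this hB0
    have h5 : K * (B / 2) ≤ K * ‖star b ⬝ᵥ u x‖ ^ 2 := by nlinarith [mul_pos hB0 hK0]
    exact le_of_mul_le_mul_left h5 hK0
  have hη3 : Real.sqrt (B / 2) ≤ ‖star b ⬝ᵥ u x‖ := Real.sqrt_le_iff.mpr ⟨norm_nonneg _, hη2⟩
  have h6 := norm_sub_norm_le ((K : ℂ) * (star b ⬝ᵥ u x)) (c ⬝ᵥ ((vecMulVec b c + F x)ᴴ *ᵥ u x))
  rw [norm_sub_rev] at h6
  rw [norm_mul, Complex.norm_real, Real.norm_of_nonneg hK0.le] at h6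
  have := mul_le_mul_of_nonneg_left hη3 hK0.le
  linarith

/-- One step of power iteration: with `w = Yᴴ u`, the eigenvector equation reads `σ² u = Y w`. As
`w` is parallel to `c^*` up to `O(g)`, the right side is a multiple of `b + F c^* / ‖c‖²` up to
`O(g²)`. The component of the correction along `b` need not be removed, since scaling is free. -/
theorem exists_smul_dominant_sub_isBigO (hg : Tendsto g l (𝓝 0)) {b : κ → ℂ} {c : ν → ℂ}
    (hb : b ≠ 0) (hc : c ≠ 0) {F : X → Matrix κ ν ℂ}
    (hF : ∀ i j, (fun x => F x i j) =O[l] g) {u : X → κ → ℂ}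
    (hu : ∀ᶠ x in l, IsDominantLeftSingularVector (vecMulVec b c + F x) (u x)) :
    ∃ α : X → ℂ, (∀ᶠ x in l, α x ≠ 0) ∧ ∀ i,
      (fun x => α x * u x i - (b i + (star c ⬝ᵥ c)⁻¹ * (F x *ᵥ star c) i))
        =O[l] fun x => g x ^ 2 := by
  obtain ⟨δ, hδ, hβ⟩ := eventually_le_norm_sq_dotProduct hg hb hc hF hu
  have hcc : star c ⬝ᵥ c ≠ 0 := by
    rw [star_dotProduct_self_eq]
    exact_mod_cast (sum_norm_sq_pos hc).ne'
  have hcc' : c ⬝ᵥ star c = star c ⬝ᵥ c := dotProduct_comm _ _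
  set w : X → ν → ℂ := fun x => (vecMulVec b c + F x)ᴴ *ᵥ u x with hw
  set β : X → ℂ := fun x => c ⬝ᵥ w x with hβdef
  have hu1 : ∀ i, (fun x => u x i) =O[l] (fun _ => (1 : ℝ)) := fun i =>
    IsBigO.of_bound 1 (hu.mono fun x hx => by simpa using norm_apply_le_one_of_unit hx.1 i)
  have hφ : ∀ j, (fun x => ((F x)ᴴ *ᵥ u x) j) =O[l] g := fun j => by
    have h := isBigO_dotProduct (p := fun x => (F x)ᴴ j) (f₁ := g)
      (fun i => isBigO_star (hF i j)) hu1
    simp only [mul_one] at h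
    exact h
  have hw_eq : ∀ x, w x = (star b ⬝ᵥ u x) • star c + (F x)ᴴ *ᵥ u x := by
    intro x
    simp only [hw]
    rw [conjTranspose_add, add_mulVec, conjTranspose_vecMulVec, vecMulVec_mulVec]
    simp
  have hβinv : (fun x => (β x)⁻¹) =O[l] (fun _ => (1 : ℝ)) :=
    IsBigO.of_bound δ⁻¹ (hβ.mono fun x hx => by
      rw [norm_inv, norm_one, mul_one]
      exact inv_anti₀ hδ hx)
  -- The part of `w` orthogonal to `c^*`. The signal contributes only multiples of `c^*` to `w`, so
  -- `ψ` comes from `Fᴴ u` alone.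
  set ψ : X → ν → ℂ := fun x j =>
    ((F x)ᴴ *ᵥ u x) j - (c ⬝ᵥ ((F x)ᴴ *ᵥ u x)) * ((star c ⬝ᵥ c)⁻¹ * star c j) with hψ
  have hψO : ∀ j, (fun x => ψ x j) =O[l] g := fun j => by
    have hk : (fun _ => (star c ⬝ᵥ c)⁻¹ * star c j) =O[l] (fun _ => (1 : ℝ)) :=
      isBigO_const_const _ one_ne_zero _
    have h := (isBigO_dotProduct_const c hφ).mul hk
    simp only [mul_one] at h
    exact (hφ j).sub h
  have hψw : ∀ x j, w x j = β x * ((star c ⬝ᵥ c)⁻¹ * star c j) + ψ x j := by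
    intro x j
    simp only [hβdef, hψ, hw_eq, dotProduct_add, dotProduct_smul, hcc', Pi.add_apply,
      Pi.smul_apply, smul_eq_mul, Pi.star_apply]
    field_simp
    ring
  -- The scalar is `σ² / β`, with `σ²` written as `‖w‖²` to make it a function of `x`.
  refine ⟨fun x => (star (w x) ⬝ᵥ w x) * (β x)⁻¹, ?_, fun i => ?_⟩
  · filter_upwards [hβ] with x hx h0
    have hβx : β x ≠ 0 := norm_pos_iff.mp (hδ.trans_le hx)
    rcases mul_eq_zero.mp h0 with h | h
    · have hwx : w x = 0 := by
        by_contra hne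
        have := sum_norm_sq_pos hne
        rw [star_dotProduct_self_eq] at h
        exact this.ne' (by exact_mod_cast h)
      exact hβx (by simp [hβdef, hwx])
    · exact inv_ne_zero hβx h
  · have hO : (fun x => (F x i ⬝ᵥ ψ x) * (β x)⁻¹) =O[l] fun x => g x ^ 2 := by
      have := (isBigO_dotProduct (p := fun x => F x i) (hF i) hψO).mul hβinv
      simpa [pow_two] using this
    refine hO.congr' ?_ EventuallyEq.rfl
    filter_upwards [hβ, hu] with x hx hux
    have hβx : β x ≠ 0 := norm_pos_iff.mp (hδ.trans_le hx)
    obtain ⟨h1, σ, hσ, -⟩ := hux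
    have key : star (w x) ⬝ᵥ w x = ((σ ^ 2 : ℝ) : ℂ) := by
      simp only [hw]
      rw [star_mulVec, conjTranspose_conjTranspose, ← dotProduct_mulVec, mulVec_mulVec, hσ,
        dotProduct_smul, h1]
      simp
    have hY : (vecMulVec b c + F x) *ᵥ w x = ((σ ^ 2 : ℝ) : ℂ) • u x := by
      simp only [hw]
      rw [mulVec_mulVec]; exact hσ
    have hYi := congrFun hY i
    rw [add_mulVec, vecMulVec_mulVec] at hYi
    simp only [Pi.add_apply, Pi.smul_apply, MulOpposite.smul_eq_mul_unop, MulOpposite.unop_op,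
      smul_eq_mul] at hYi
    have hFw : (F x *ᵥ w x) i = β x * ((star c ⬝ᵥ c)⁻¹ * (F x *ᵥ star c) i) + F x i ⬝ᵥ ψ x := by
      simp only [mulVec, dotProduct, Finset.mul_sum, hψw x, ← Finset.sum_add_distrib]
      refine Finset.sum_congr rfl fun j _ => ?_
      simp only [Pi.star_apply]
      ring
    rw [hFw] at hYi
    rw [key]
    have h3 : ((σ ^ 2 : ℝ) : ℂ) * (β x)⁻¹ * u x i = (β x)⁻¹ * (((σ ^ 2 : ℝ) : ℂ) * u x i) := by
      ring
    rw [h3, ← hYi]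
    change _ = (β x)⁻¹ * (b i * β x + _) - _
    field_simp
    ring

end Perturbation

/-! ### First-order expansion of the least squares solution and of its phase -/

/-- This removes the unknown scalar `α` of the singular vector expansion. -/
theorem lsShift_smul {𝕜 κ κ' : Type*} [RCLike 𝕜] [Fintype κ] [Fintype κ']
    (A B : Matrix κ' κ 𝕜) {α : 𝕜} (hα : α ≠ 0) (u : κ → 𝕜) :
    lsShift A B (α • u) = lsShift A B u := by
  have h : star α ≠ 0 := star_ne_zero.mpr hα
  simp only [lsShift, columnPinv, mulVec_smul, star_smul, smul_dotProduct, dotProduct_smul,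
    smul_eq_mul, mul_inv]
  field_simp

section Expansion

variable {X : Type*} {l : Filter X} {g : X → ℝ} {κ κ' : Type*} [Fintype κ] [Fintype κ']

theorem isBigO_sq_self (hg : Tendsto g l (𝓝 0)) : (fun x => g x ^ 2) =O[l] g := by
  simpa only [pow_two] using isBigO_of_mul_self hg

/-- `B - γ A` annihilates `b`, and `lsShift A B v = γ + (A v)ᴴ (B - γ A) v / ‖A v‖²` exactly. The
factor `(B - γ A) v` is already of first order, so the others may be replaced by their values at
`b`. -/
theorem lsShift_sub_isBigO (hg : Tendsto g l (𝓝 0)) (A B : Matrix κ' κ ℂ) {b : κ → ℂ} {γ : ℂ}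
    (hA : A *ᵥ b ≠ 0) (hB : B *ᵥ b = γ • A *ᵥ b) {v d : X → κ → ℂ}
    (hd : ∀ i, (fun x => d x i) =O[l] g)
    (hv : ∀ i, (fun x => v x i - (b i + d x i)) =O[l] fun x => g x ^ 2) :
    (fun x => lsShift A B (v x) -
      (γ + (star (A *ᵥ b) ⬝ᵥ A *ᵥ b)⁻¹ * (star (A *ᵥ b) ⬝ᵥ (B - γ • A) *ᵥ d x)))
      =O[l] fun x => g x ^ 2 := by
  have hD0 : star (A *ᵥ b) ⬝ᵥ A *ᵥ b ≠ 0 := by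
    rw [star_dotProduct_self_eq]
    exact_mod_cast (sum_norm_sq_pos hA).ne'
  set D₀ := star (A *ᵥ b) ⬝ᵥ A *ᵥ b with hD₀
  have hvb : ∀ i, (fun x => (v x - b) i) =O[l] g := fun i =>
    (((hv i).trans (isBigO_sq_self hg)).add (hd i)).congr_left fun x => by
      simp only [Pi.sub_apply]; ring
  have hvd : ∀ i, (fun x => (v x - b - d x) i) =O[l] fun x => g x ^ 2 := fun i =>
    (hv i).congr_left fun x => by simp only [Pi.sub_apply]; ring
  have hC : (B - γ • A) *ᵥ b = 0 := by
    rw [sub_mulVec, hB, smul_mulVec, sub_self]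
  have hAp := isBigO_mulVec A hvb
  have hCp := isBigO_mulVec (B - γ • A) hvb
  have hCd := isBigO_mulVec (B - γ • A) hd
  have hCvd := isBigO_mulVec (B - γ • A) hvd
  have hgg : (fun x => g x * g x) = fun x => g x ^ 2 := by ext x; ring
  have hden : (fun x => star (A *ᵥ v x) ⬝ᵥ A *ᵥ v x - D₀) =O[l] g := by
    have h1 := isBigO_dotProduct_const (star (A *ᵥ b)) hAp
    have h2 := (isBigO_dotProduct (p := fun x => star (A *ᵥ (v x - b)))
      (fun i => isBigO_star (hAp i)) hAp).trans (isBigO_of_mul_self hg)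
    refine ((h1.add (isBigO_star h1)).add h2).congr_left fun x => ?_
    rw [← star_dotProduct, hD₀]
    simp only [mulVec_sub, star_sub, sub_dotProduct, dotProduct_sub]
    ring
  have hden0 : Tendsto (fun x => star (A *ᵥ v x) ⬝ᵥ A *ᵥ v x) l (𝓝 D₀) := by
    simpa using (hden.trans_tendsto hg).add_const D₀
  have hne : ∀ᶠ x in l, star (A *ᵥ v x) ⬝ᵥ A *ᵥ v x ≠ 0 := hden0.eventually_ne hD0
  have hinv : (fun x => (star (A *ᵥ v x) ⬝ᵥ A *ᵥ v x)⁻¹) =O[l] fun _ => (1 : ℝ) :=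
    (hden0.inv₀ hD0).isBigO_one ℝ
  have hnum : (fun x => star (A *ᵥ v x) ⬝ᵥ (B - γ • A) *ᵥ v x -
      star (A *ᵥ b) ⬝ᵥ (B - γ • A) *ᵥ d x) =O[l] fun x => g x ^ 2 := by
    have h1 := isBigO_dotProduct (p := fun x => star (A *ᵥ (v x - b)))
      (fun i => isBigO_star (hAp i)) hCp
    rw [hgg] at h1
    have h2 := isBigO_dotProduct_const (star (A *ᵥ b)) hCvd
    refine (h1.add h2).congr_left fun x => ?_
    simp only [mulVec_sub, star_sub, sub_dotProduct, dotProduct_sub, hC, dotProduct_zero]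
    ring
  have hnd := isBigO_dotProduct_const (star (A *ᵥ b)) hCd
  have h1 := hinv.mul hnum
  -- The cost of replacing the denominator `D` by `D₀`: `D⁻¹ - D₀⁻¹ = -D⁻¹ (D - D₀) D₀⁻¹`.
  have h2 := (hinv.mul ((hden.mul hnd).mul
    (isBigO_const_const D₀⁻¹ (one_ne_zero (α := ℝ)) l)))
  simp only [one_mul, mul_one, hgg] at h1 h2
  refine (h1.sub h2).congr' ?_ EventuallyEq.rfl
  filter_upwards [hne] with x hx
  have e1 : B *ᵥ v x = (B - γ • A) *ᵥ v x + γ • A *ᵥ v x := by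
    rw [sub_mulVec, smul_mulVec]; simp
  have e2 : lsShift A B (v x) = γ + (star (A *ᵥ v x) ⬝ᵥ A *ᵥ v x)⁻¹ *
      (star (A *ᵥ v x) ⬝ᵥ (B - γ • A) *ᵥ v x) := by
    rw [lsShift, columnPinv, e1, smul_dotProduct, dotProduct_add, dotProduct_smul, smul_eq_mul,
      smul_eq_mul]
    field_simp
    ring
  rw [e2]
  field_simp
  ring

/-- Phase of a perturbed phasor. -/
theorem arg_sub_isBigO (hg : Tendsto g l (𝓝 0)) {μ : ℝ} (hμ : |μ| < Real.pi) {z ζ : X → ℂ}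
    (hζ : ζ =O[l] g)
    (hz : (fun x => z x - Complex.exp (Complex.I * μ) * (1 + ζ x)) =O[l] fun x => g x ^ 2) :
    (fun x => (z x).arg - μ - (ζ x).im) =O[l] fun x => g x ^ 2 := by
  set e := Complex.exp (Complex.I * μ) with he
  have he0 : e ≠ 0 := Complex.exp_ne_zero _
  have harg : e.arg = μ := by
    rw [he, mul_comm, Complex.exp_mul_I]
    exact Complex.arg_cos_add_sin_mul_I ⟨(abs_lt.mp hμ).1, (abs_lt.mp hμ).2.le⟩
  -- In terms of the relative error `w = z / e - 1`, the phase error is the imaginary part of `log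
  -- (1 + w) = w + O(w²)`.
  set w : X → ℂ := fun x => e⁻¹ * z x - 1 with hw
  have hwζ : (fun x => w x - ζ x) =O[l] fun x => g x ^ 2 := by
    have := hz.const_mul_left e⁻¹
    refine this.congr_left fun x => ?_
    simp only [hw]; field_simp; ring
  have hwO : w =O[l] g :=
    ((hwζ.trans (isBigO_sq_self hg)).add hζ).congr_left fun x => by ring
  have hw0 : Tendsto w l (𝓝 0) := hwO.trans_tendsto hg
  have hlog : (fun x => Complex.log (1 + w x) - w x) =O[l] fun x => g x ^ 2 := by
    have h1 : (fun x => Complex.log (1 + w x) - w x) =O[l] fun x => ‖w x‖ ^ 2 := by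
      refine IsBigO.of_bound 1 ?_
      have hs : ∀ᶠ x in l, ‖w x‖ < 1 / 2 :=
        (tendsto_zero_iff_norm_tendsto_zero.mp hw0).eventually_lt_const (by norm_num)
      filter_upwards [hs] with x hx
      have h := Complex.norm_log_one_add_sub_self_le (hx.trans (by norm_num))
      rw [norm_pow, norm_norm, one_mul]
      refine h.trans ?_
      have : (1 - ‖w x‖)⁻¹ ≤ 2 := by
        rw [inv_le_comm₀ (by linarith) (by norm_num)]; norm_num; linarith
      nlinarith [sq_nonneg ‖w x‖, norm_nonneg (w x)]
    exact h1.trans (hwO.norm_left.pow 2)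
  have hsum := hlog.add hwζ
  have him : (fun x => (Complex.log (1 + w x) - w x + (w x - ζ x)).im) =O[l]
      fun x => g x ^ 2 :=
    IsBigO.trans (IsBigO.of_norm_le fun x => Complex.abs_im_le_norm _) hsum.norm_left
  refine him.congr' ?_ EventuallyEq.rfl
  have ht : Tendsto (fun x => μ + (1 + w x).arg) l (𝓝 μ) := by
    have h1 : Tendsto (fun x => (1 + w x).arg) l (𝓝 (1 : ℂ).arg) :=
      (Complex.continuousAt_arg (by simp)).tendsto.comp (by simpa using hw0.const_add 1)
    simpa using h1.const_add μ
  -- The strict bound on `|μ|` prevents a jump by `2π`: for small `w` the sum of the arguments stays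
  -- in the principal interval.
  have hI : ∀ᶠ x in l, μ + (1 + w x).arg ∈ Set.Ioo (-Real.pi) Real.pi :=
    ht.eventually (Ioo_mem_nhds (abs_lt.mp hμ).1 (abs_lt.mp hμ).2)
  have hne : ∀ᶠ x in l, 1 + w x ≠ 0 := by
    have : Tendsto (fun x => 1 + w x) l (𝓝 1) := by simpa using hw0.const_add 1
    exact this.eventually_ne one_ne_zero
  filter_upwards [hI, hne] with x hx hx0
  have hzx : z x = e * (1 + w x) := by simp only [hw]; field_simp; ring
  rw [hzx, Complex.arg_mul he0 hx0 (by rw [harg]; exact ⟨hx.1, hx.2.le⟩), harg]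
  simp only [Complex.sub_im, Complex.add_im, Complex.log_im]
  ring

/-- Mean value inequality for `arctan z - z / (1 + a²)`. Its derivative is at most `|z - a|` in
modulus, because `|z + a| ≤ (1 + z²)(1 + a²)`. -/
theorem abs_arctan_sub_le (a y : ℝ) :
    |Real.arctan y - Real.arctan a - (y - a) / (1 + a ^ 2)| ≤ (y - a) ^ 2 := by
  have h := (convex_uIcc a y).norm_image_sub_le_of_norm_hasDerivWithin_le (𝕜 := ℝ)
    (f := fun z => Real.arctan z - z / (1 + a ^ 2))
    (f' := fun z => 1 / (1 + z ^ 2) - 1 / (1 + a ^ 2)) (C := |y - a|)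
    (fun z _ => ((Real.hasDerivAt_arctan z).sub
      ((hasDerivAt_id z).div_const _)).hasDerivWithinAt)
    (fun z hz => ?_) Set.left_mem_uIcc Set.right_mem_uIcc
  · rw [Real.norm_eq_abs, Real.norm_eq_abs, abs_mul_abs_self] at h
    calc _ = |Real.arctan y - y / (1 + a ^ 2) - (Real.arctan a - a / (1 + a ^ 2))| := by
          congr 1; ring
      _ ≤ _ := h.trans (by rw [pow_two])
  · have hza : |z - a| ≤ |y - a| := Set.abs_sub_left_of_mem_uIcc hz
    refine le_trans ?_ hza
    have e : 1 / (1 + z ^ 2) - 1 / (1 + a ^ 2) =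
        -(z - a) * ((z + a) / ((1 + z ^ 2) * (1 + a ^ 2))) := by
      field_simp; ring
    rw [Real.norm_eq_abs, e, abs_mul, abs_neg]
    refine mul_le_of_le_one_right (abs_nonneg _) ?_
    rw [abs_div, div_le_one (by positivity),
      abs_of_pos (a := (1 + z ^ 2) * (1 + a ^ 2)) (by positivity), abs_le]
    constructor <;> nlinarith [sq_nonneg (z - 1), sq_nonneg (a - 1), sq_nonneg (z + 1),
      sq_nonneg (a + 1), sq_nonneg (z * a)]

/-- The derivative of `2 arctan` at `tan (μ / 2)` is `2 cos² (μ / 2)`. -/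
theorem two_arctan_sub_isBigO (hg : Tendsto g l (𝓝 0)) {μ : ℝ} (hμ : |μ| < Real.pi)
    {υ ζ : X → ℝ} (hζ : ζ =O[l] g)
    (hυ : (fun x => υ x - (Real.tan (μ / 2) + ζ x)) =O[l] fun x => g x ^ 2) :
    (fun x => 2 * Real.arctan (υ x) - μ - 2 * Real.cos (μ / 2) ^ 2 * ζ x)
      =O[l] fun x => g x ^ 2 := by
  have hat : Real.arctan (Real.tan (μ / 2)) = μ / 2 :=
    Real.arctan_tan (by linarith [(abs_lt.mp hμ).1]) (by linarith [(abs_lt.mp hμ).2])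
  have hc : 0 < Real.cos (μ / 2) := Real.cos_pos_of_mem_Ioo
    ⟨by linarith [(abs_lt.mp hμ).1], by linarith [(abs_lt.mp hμ).2]⟩
  have hcos : (1 + Real.tan (μ / 2) ^ 2)⁻¹ = Real.cos (μ / 2) ^ 2 :=
    Real.inv_one_add_tan_sq hc.ne'
  have h1 : (fun x => υ x - Real.tan (μ / 2)) =O[l] g :=
    ((hυ.trans (isBigO_sq_self hg)).add hζ).congr_left fun x => by ring
  have h2 : (fun x => Real.arctan (υ x) - Real.arctan (Real.tan (μ / 2)) -
      (υ x - Real.tan (μ / 2)) / (1 + Real.tan (μ / 2) ^ 2)) =O[l] fun x => g x ^ 2 :=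
    IsBigO.trans (IsBigO.of_norm_le fun x => abs_arctan_sub_le _ _) (h1.pow 2)
  refine ((h2.const_mul_left 2).add
    (hυ.const_mul_left (2 * Real.cos (μ / 2) ^ 2))).congr_left fun x => ?_
  rw [hat, div_eq_mul_inv (υ x - Real.tan (μ / 2)), hcos]
  ring

end Expansion

/-! ### Selection and exchange matrices -/

/-- The matrix that selects the entries with positions `f i`. -/
def selection {κ κ' : Type*} [DecidableEq κ] (f : κ' → κ) : Matrix κ' κ ℂ :=
  Matrix.of fun i j => if j = f i then 1 else 0

section Selection

variable {κ κ' ν : Type*} [DecidableEq κ]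

theorem selection_mulVec [Fintype κ] (f : κ' → κ) (x : κ → ℂ) :
    selection f *ᵥ x = fun i => x (f i) := by
  ext i
  simp [selection, mulVec, dotProduct]

theorem selection_mul [Fintype κ] (f : κ' → κ) (Y : Matrix κ ν ℂ) :
    selection f * Y = Matrix.of fun i n => Y (f i) n := by
  ext i n
  simp [selection, mul_apply]

variable [ExchangeIndex κ]

theorem exchange_eq_selection : exchange κ = selection (ExchangeIndex.rev : κ → κ) := rfl

theorem mul_exchange [Fintype κ] (hκ : Function.Involutive (ExchangeIndex.rev : κ → κ))
    (Y : Matrix ν κ ℂ) :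
    Y * exchange κ = Matrix.of fun i j => Y i (ExchangeIndex.rev j) := by
  ext i j
  simp only [exchange, mul_apply, of_apply, mul_ite, mul_one, mul_zero]
  rw [Finset.sum_eq_single (ExchangeIndex.rev j)]
  · simp [hκ j]
  · intro k _ hk
    rw [if_neg]
    rintro rfl
    exact hk (hκ k).symm
  · simp

theorem exchange_mul_exchange [Fintype κ]
    (hκ : Function.Involutive (ExchangeIndex.rev : κ → κ)) :
    exchange κ * exchange κ = 1 := by
  rw [mul_exchange hκ]
  ext i j
  simp only [exchange, of_apply, one_apply]
  congr 1
  exact propext ⟨fun h => (hκ.injective h).symm, fun h => by rw [h]⟩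

theorem conjTranspose_exchange (hκ : Function.Involutive (ExchangeIndex.rev : κ → κ)) :
    (exchange κ)ᴴ = exchange κ := by
  ext i j
  simp only [exchange, conjTranspose_apply, of_apply]
  have : i = ExchangeIndex.rev j ↔ j = ExchangeIndex.rev i :=
    ⟨fun h => by rw [h, hκ j], fun h => by rw [h, hκ i]⟩
  simp only [this]
  split_ifs <;> simp

theorem map_star_exchange : (exchange κ).map star = exchange κ := by
  ext i j
  simp only [exchange, map_apply, of_apply]
  split_ifs <;> simp

/-- A unitary left `Π`-real matrix: `((1 + j) I + (1 - j) Π) / 2`. -/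
theorem exists_isUnitaryLeftPiReal [Fintype κ]
    (hκ : Function.Involutive (ExchangeIndex.rev : κ → κ)) :
    ∃ Q : Matrix κ κ ℂ, IsUnitaryLeftPiReal Q := by
  set a : ℂ := (1 + Complex.I) / 2 with ha
  have hsa : star a = (1 - Complex.I) / 2 := by
    simp [ha, Complex.ext_iff]
  have hstar : (a • (1 : Matrix κ κ ℂ) + star a • exchange κ).map star =
      star a • (1 : Matrix κ κ ℂ) + a • exchange κ := by
    rw [Matrix.map_add _ star_add, Matrix.map_smulₛₗ _ star _ (fun x => by simp [mul_comm]),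
      Matrix.map_smulₛₗ _ star _ (fun x => by simp [mul_comm]), map_star_exchange, star_star,
      Matrix.map_one _ (star_zero _) (star_one _)]
  have hI : Complex.I * Complex.I = -1 := Complex.I_mul_I
  refine ⟨a • 1 + star a • exchange κ, ?_, ?_⟩
  · rw [mem_unitaryGroup_iff, star_eq_conjTranspose, conjTranspose_add, conjTranspose_smul,
      conjTranspose_smul, conjTranspose_one, conjTranspose_exchange hκ, star_star]
    simp only [add_mul, mul_add, smul_mul_smul_comm, one_mul, mul_one, exchange_mul_exchange hκ]
    -- `|a|² = 1 / 2` gives the unit diagonal; `a² = j / 2` is purely imaginary, so the coefficient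
    -- of `Π` vanishes.
    have e1 : a * star a + star a * a = 1 := by rw [hsa, ha]; linear_combination (-1 / 2) * hI
    have e2 : a * a + star a * star a = 0 := by rw [hsa, ha]; linear_combination (1 / 2) * hI
    calc _ = (a * star a + star a * a) • (1 : Matrix κ κ ℂ)
          + (a * a + star a * star a) • exchange κ := by
          simp only [add_smul]; abel
      _ = 1 := by rw [e1, e2]; simp
  · rw [hstar, mul_add, mul_smul_comm, mul_smul_comm, mul_one, exchange_mul_exchange hκ]
    abel

end Selection

/-! ### From the real to the complex problem in Unitary ESPRIT -/

section Real

theorem ofReal_lsShift {κ κ' : Type*} [Fintype κ] [Fintype κ'] (A B : Matrix κ' κ ℝ) (u : κ → ℝ) :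
    ((lsShift A B u : ℝ) : ℂ) =
      lsShift (A.map Complex.ofReal) (B.map Complex.ofReal) (fun k => (u k : ℂ)) := by
  simp [lsShift, columnPinv, dotProduct, mulVec]

theorem lsShift_unitary {κ κ' : Type*} [Fintype κ] [Fintype κ'] [DecidableEq κ']
    (A B : Matrix κ' κ ℂ) (Q : Matrix κ κ ℂ) {Q₁ : Matrix κ' κ' ℂ}
    (hQ₁ : Q₁ ∈ Matrix.unitaryGroup κ' ℂ) (u : κ → ℂ) :
    lsShift (Q₁ᴴ * A * Q) (Q₁ᴴ * B * Q) u = lsShift A B (Q *ᵥ u) := by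
  have key : ∀ p q : κ' → ℂ, star (Q₁ᴴ *ᵥ p) ⬝ᵥ Q₁ᴴ *ᵥ q = star p ⬝ᵥ q := by
    intro p q
    rw [star_mulVec, conjTranspose_conjTranspose, ← dotProduct_mulVec, mulVec_mulVec,
      ← star_eq_conjTranspose, mem_unitaryGroup_iff.mp hQ₁, one_mulVec]
  simp only [lsShift, columnPinv, smul_dotProduct, ← mulVec_mulVec, key]

theorem lsShift_smul_right {κ κ' : Type*} [Fintype κ] [Fintype κ']
    (A B : Matrix κ' κ ℂ) (a : ℂ) (u : κ → ℂ) :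
    lsShift A (a • B) u = a * lsShift A B u := by
  simp [lsShift, smul_mulVec]

variable {κ κ' ν : Type*} [Fintype κ] [DecidableEq κ] [ExchangeIndex κ]

theorem map_star_mul {α β γ : Type*} [Fintype β] (A : Matrix α β ℂ) (B : Matrix β γ ℂ) :
    (A * B).map star = A.map star * B.map star := by
  ext i j; simp [mul_apply]

theorem IsUnitaryLeftPiReal.map_star (hκ : Function.Involutive (ExchangeIndex.rev : κ → κ))
    {Q : Matrix κ κ ℂ} (hQ : IsUnitaryLeftPiReal Q) : Q.map star = exchange κ * Q := by
  conv_rhs => rw [← hQ.2]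
  rw [← mul_assoc, exchange_mul_exchange hκ, one_mul]

theorem IsUnitaryLeftPiReal.map_star_conjTranspose
    (hκ : Function.Involutive (ExchangeIndex.rev : κ → κ))
    {Q : Matrix κ κ ℂ} (hQ : IsUnitaryLeftPiReal Q) : Qᴴ.map star = Qᴴ * exchange κ := by
  have h := congrArg conjTranspose (hQ.map_star hκ)
  rw [conjTranspose_mul, conjTranspose_exchange hκ] at h
  rw [← h]
  ext i j; simp

/-- Left `Π`-reality says `Q^* = Π Q`, so conjugating the transform puts exchange matrices around
`Z^*`. Hence a centro-Hermitian `Z` has a real transform. -/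
theorem map_star_transform [Fintype κ'] [DecidableEq κ'] [ExchangeIndex κ']
    (hκ : Function.Involutive (ExchangeIndex.rev : κ → κ))
    (hκ' : Function.Involutive (ExchangeIndex.rev : κ' → κ'))
    {Q : Matrix κ κ ℂ} (hQ : IsUnitaryLeftPiReal Q) {Q' : Matrix κ' κ' ℂ}
    (hQ' : IsUnitaryLeftPiReal Q') (Z : Matrix κ κ' ℂ) :
    (Qᴴ * Z * Q').map star = Qᴴ * (exchange κ * Z.map star * exchange κ') * Q' := by
  rw [map_star_mul, map_star_mul, hQ.map_star_conjTranspose hκ, hQ'.map_star hκ']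
  simp only [Matrix.mul_assoc]

/-- A real dominant left singular vector of the transformed matrix, transformed back. -/
theorem isDominant_of_real [Fintype κ'] [DecidableEq κ'] [ExchangeIndex κ']
    (hκ : Function.Involutive (ExchangeIndex.rev : κ → κ))
    (hκ' : Function.Involutive (ExchangeIndex.rev : κ' → κ'))
    {Q : Matrix κ κ ℂ} (hQ : IsUnitaryLeftPiReal Q) {Q' : Matrix κ' κ' ℂ}
    (hQ' : IsUnitaryLeftPiReal Q') {Z : Matrix κ κ' ℂ}
    (hZ : exchange κ * Z.map star * exchange κ' = Z) {e : κ → ℝ}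
    (he : IsDominantLeftSingularVector ((Qᴴ * Z * Q').map Complex.re) e) :
    IsDominantLeftSingularVector Z (Q *ᵥ fun k => (e k : ℂ)) := by
  set T := (Qᴴ * Z * Q').map Complex.re with hT
  have hTC : T.map Complex.ofReal = Qᴴ * Z * Q' := by
    have h := map_star_transform hκ hκ' hQ hQ' Z
    rw [hZ] at h
    ext i j
    have hij := congrFun (congrFun h i) j
    rw [map_apply] at hij
    rw [map_apply, hT, map_apply]
    exact Complex.conj_eq_iff_re.mp hij
  have hQQ : Qᴴ * Q = 1 := mem_unitaryGroup_iff'.mp hQ.1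
  have hQQ' : Q * Qᴴ = 1 := mem_unitaryGroup_iff.mp hQ.1
  have hQ2 : Q' * Q'ᴴ = 1 := mem_unitaryGroup_iff.mp hQ'.1
  -- `T Tᵀ` is unitarily similar to `Z Zᴴ`; the factor `Q'` drops out.
  have hTT : (T * Tᵀ).map Complex.ofReal = Qᴴ * (Z * Zᴴ) * Q := by
    have h1 : (T * Tᵀ).map Complex.ofReal = T.map Complex.ofReal * (T.map Complex.ofReal)ᴴ := by
      ext i j; simp [mul_apply]
    rw [h1, hTC, conjTranspose_mul, conjTranspose_mul, conjTranspose_conjTranspose]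
    calc _ = Qᴴ * Z * (Q' * Q'ᴴ) * Zᴴ * Q := by simp only [Matrix.mul_assoc]
      _ = _ := by rw [hQ2, Matrix.mul_one]; simp only [Matrix.mul_assoc]
  have hmap : ∀ v : κ → ℝ, (T * Tᵀ).map Complex.ofReal *ᵥ (fun k => (v k : ℂ)) =
      fun k => (((T * Tᵀ) *ᵥ v) k : ℂ) := by
    intro v; ext k; simp [mulVec, dotProduct]
  have hZZ : Z * Zᴴ = Q * (T * Tᵀ).map Complex.ofReal * Qᴴ := by
    rw [hTT]
    calc _ = (Q * Qᴴ) * (Z * Zᴴ) * (Q * Qᴴ) := by rw [hQQ', one_mul, mul_one]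
      _ = _ := by simp only [Matrix.mul_assoc]
  obtain ⟨h1, σ, hσ, hmax⟩ := he
  rw [conjTranspose_eq_transpose_of_trivial] at hσ hmax
  refine ⟨?_, σ, ?_, ?_⟩
  · rw [star_mulVec, ← dotProduct_mulVec, mulVec_mulVec, hQQ, one_mulVec]
    have := congrArg Complex.ofReal h1
    simpa [dotProduct] using this
  · rw [hZZ, mulVec_mulVec, mul_assoc, hQQ, mul_one, ← mulVec_mulVec, hmap, hσ, ← mulVec_smul]
    congr 1
    ext k; simp
  · intro τ v hv hτ
    have hw : (T * Tᵀ).map Complex.ofReal *ᵥ (Qᴴ *ᵥ v) = (τ : ℂ) • (Qᴴ *ᵥ v) := by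
      rw [hTT, mulVec_mulVec, mul_assoc, hQQ', mul_one, ← mulVec_mulVec]
      have hτ' : (Z * Zᴴ) *ᵥ v = (τ : ℂ) • v := hτ
      rw [hτ', mulVec_smul]
    have hw0 : Qᴴ *ᵥ v ≠ 0 := by
      intro h0
      apply hv
      have := congrArg (Q *ᵥ ·) h0
      simpa [mulVec_mulVec, hQQ'] using this
    set w := Qᴴ *ᵥ v
    -- Complex eigenvectors of the real matrix `T Tᵀ` must be covered too: for real `τ` the real and
    -- imaginary parts are eigenvectors or zero, and at least one is nonzero.
    have hre : (T * Tᵀ) *ᵥ (fun k => (w k).re) = τ • fun k => (w k).re := by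
      ext k
      have := congrArg Complex.re (congrFun hw k)
      simpa [mulVec, dotProduct] using this
    have him : (T * Tᵀ) *ᵥ (fun k => (w k).im) = τ • fun k => (w k).im := by
      ext k
      have := congrArg Complex.im (congrFun hw k)
      simpa [mulVec, dotProduct] using this
    by_cases h0 : (fun k => (w k).re) = 0
    · refine hmax τ _ (fun h0' => hw0 ?_) him
      ext k
      exact Complex.ext (congrFun h0 k) (congrFun h0' k)
    · exact hmax τ _ h0 hre

/-- The conjugate of `Q₁ᴴ J₂ Q` is `Q₁ᴴ J₁ Q`, so twice its real and imaginary parts are the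
transforms of `J₁ + J₂` and `-j (J₂ - J₁)`. Unitary factors do not affect least squares. -/
theorem ofReal_shift_unitary [Fintype κ'] [DecidableEq κ'] [ExchangeIndex κ']
    (hκ : Function.Involutive (ExchangeIndex.rev : κ → κ))
    (hκ' : Function.Involutive (ExchangeIndex.rev : κ' → κ'))
    {Q : Matrix κ κ ℂ} (hQ : IsUnitaryLeftPiReal Q) {Q₁ : Matrix κ' κ' ℂ}
    (hQ₁ : IsUnitaryLeftPiReal Q₁) {J₁ J₂ : Matrix κ' κ ℂ}
    (hJ : exchange κ' * J₂.map star * exchange κ = J₁) (e : κ → ℝ) :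
    ((lsShift ((2 : ℝ) • (Q₁ᴴ * J₂ * Q).map Complex.re)
      ((2 : ℝ) • (Q₁ᴴ * J₂ * Q).map Complex.im) e : ℝ) : ℂ) =
      -Complex.I * lsShift (J₁ + J₂) (J₂ - J₁) (Q *ᵥ fun k => (e k : ℂ)) := by
  have h := map_star_transform hκ' hκ hQ₁ hQ J₂
  rw [hJ] at h
  have h1 : ((2 : ℝ) • (Q₁ᴴ * J₂ * Q).map Complex.re).map Complex.ofReal =
      Q₁ᴴ * (J₁ + J₂) * Q := by
    rw [Matrix.mul_add, Matrix.add_mul, ← h]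
    ext i j
    simp only [map_apply, Matrix.smul_apply, Matrix.add_apply, smul_eq_mul, Complex.star_def]
    rw [add_comm, Complex.add_conj]
  have h2 : ((2 : ℝ) • (Q₁ᴴ * J₂ * Q).map Complex.im).map Complex.ofReal =
      -Complex.I • (Q₁ᴴ * (J₂ - J₁) * Q) := by
    rw [Matrix.mul_sub, Matrix.sub_mul, ← h]
    ext i j
    simp only [map_apply, Matrix.smul_apply, Matrix.sub_apply, smul_eq_mul, Complex.star_def]
    rw [Complex.sub_conj]
    push_cast
    linear_combination (2 * ((Q₁ᴴ * J₂ * Q) i j).im : ℂ) * Complex.I_mul_I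
  rw [ofReal_lsShift, h1, h2, lsShift_smul_right, lsShift_unitary _ _ _ hQ₁.1]

end Real

/-! ### First-order error of Standard and Unitary ESPRIT for one source -/

/-- The first-order error of the shift estimate for the signal vector `b`, perturbed by `d`: the
mean, over the shift pairs `(f₁ i, f₂ i)`, of the differences of the phase errors. -/
noncomputable def phaseError {κ κ' : Type*} [Fintype κ'] (f₁ f₂ : κ' → κ) (b d : κ → ℂ) : ℝ :=
  (Fintype.card κ' : ℝ)⁻¹ *
    ∑ i, ((star (b (f₂ i)) * d (f₂ i)).im - (star (b (f₁ i)) * d (f₁ i)).im)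

theorem star_mul_self_of_norm_one {z : ℂ} (hz : ‖z‖ = 1) : star z * z = 1 := by
  rw [Complex.star_def, Complex.conj_mul', hz]; simp

theorem exists_eventually_of_eventually_exists {X β : Type*} [Nonempty β] {l : Filter X}
    {p : X → β → Prop} (h : ∀ᶠ x in l, ∃ y, p x y) : ∃ f : X → β, ∀ᶠ x in l, p x (f x) := by
  classical
  exact ⟨fun x => if hx : ∃ y, p x y then hx.choose else Classical.arbitrary β,
    h.mono fun x hx => by beta_reduce; rw [dif_pos hx]; exact hx.choose_spec⟩

theorem isBigO_re {X : Type*} {l : Filter X} {f : X → ℂ} {g : X → ℝ} (h : f =O[l] g) :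
    (fun x => (f x).re) =O[l] g :=
  IsBigO.trans (IsBigO.of_norm_le fun x => Complex.abs_re_le_norm (f x)) h.norm_left

theorem isBigO_im {X : Type*} {l : Filter X} {f : X → ℂ} {g : X → ℝ} (h : f =O[l] g) :
    (fun x => (f x).im) =O[l] g :=
  IsBigO.trans (IsBigO.of_norm_le fun x => Complex.abs_im_le_norm (f x)) h.norm_left

section Functional

variable {X : Type*} {l : Filter X} {g : X → ℝ} {κ κ' ν : Type*} [Fintype κ'] [Fintype ν]

theorem eq_phaseError_im (f₁ f₂ : κ' → κ) (b d : κ → ℂ) :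
    phaseError f₁ f₂ b d = ((Fintype.card κ' : ℂ)⁻¹ *
      ∑ i, (star (b (f₂ i)) * d (f₂ i) - star (b (f₁ i)) * d (f₁ i))).im := by
  have : (Fintype.card κ' : ℂ)⁻¹ = (((Fintype.card κ' : ℝ)⁻¹ : ℝ) : ℂ) := by push_cast; rfl
  rw [this, Complex.im_ofReal_mul, Complex.im_sum]
  simp [phaseError]

theorem isBigO_phase_sum (f₁ f₂ : κ' → κ) (b : κ → ℂ) {d : X → κ → ℂ}
    (hd : ∀ i, (fun x => d x i) =O[l] g) :
    (fun x => (Fintype.card κ' : ℂ)⁻¹ *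
      ∑ i, (star (b (f₂ i)) * d x (f₂ i) - star (b (f₁ i)) * d x (f₁ i))) =O[l] g :=
  (IsBigO.fun_sum fun _ _ =>
    ((hd _).const_mul_left _).sub ((hd _).const_mul_left _)).const_mul_left _

theorem isBigO_mulVec_star {c : ν → ℂ} {F : X → Matrix κ ν ℂ}
    (hF : ∀ i j, (fun x => F x i j) =O[l] g) (a : ℂ) (i : κ) :
    (fun x => (a • F x *ᵥ star c) i) =O[l] g := by
  refine IsBigO.const_mul_left ?_ a
  have h := isBigO_dotProduct (f₂ := fun _ => (1 : ℝ)) (hF i)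
    (fun j => isBigO_const_const (star c j) one_ne_zero l)
  simp only [mul_one] at h
  exact h

end Functional

theorem rev_fin_two_involutive : Function.Involutive (ExchangeIndex.rev : Fin 2 → Fin 2) :=
  fun i => Fin.rev_rev i

theorem rev_fin_two_eq_zero_iff (i : Fin 2) : (ExchangeIndex.rev i : Fin 2) = 0 ↔ ¬ i = 0 := by
  revert i
  change ∀ i : Fin 2, Fin.rev i = 0 ↔ ¬ i = 0
  decide

theorem rev_prod_involutive {α β : Type*} [ExchangeIndex α] [ExchangeIndex β]
    (hα : Function.Involutive (ExchangeIndex.rev : α → α))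
    (hβ : Function.Involutive (ExchangeIndex.rev : β → β)) :
    Function.Involutive (ExchangeIndex.rev : α × β → α × β) :=
  fun x => Prod.ext (hα x.1) (hβ x.2)

theorem fba_apply {κ ν : Type*} [Fintype κ] [DecidableEq κ] [ExchangeIndex κ]
    [Fintype ν] [DecidableEq ν] [ExchangeIndex ν]
    (hν : Function.Involutive (ExchangeIndex.rev : ν → ν)) (Y : Matrix κ ν ℂ)
    (i : κ) (q : Fin 2 × ν) : fba Y i q =
      if q.1 = 0 then Y i q.2 else star (Y (ExchangeIndex.rev i) (ExchangeIndex.rev q.2)) := by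
  simp only [fba, of_apply]
  rw [mul_exchange hν, exchange_eq_selection, selection_mul]
  rfl

/-- The first-order error is invariant under forward-backward averaging of the perturbation. -/
theorem phaseError_fba {κ κ' : Type*} [Fintype κ'] [ExchangeIndex κ] [ExchangeIndex κ']
    (hκ : Function.Involutive (ExchangeIndex.rev : κ → κ))
    (hκ' : Function.Involutive (ExchangeIndex.rev : κ' → κ')) {f₁ f₂ : κ' → κ} {b : κ → ℂ}
    (hff : ∀ i, ExchangeIndex.rev (f₂ (ExchangeIndex.rev i)) = f₁ i)
    {ω : ℂ} (hbω : ∀ k, star (b (ExchangeIndex.rev k)) = ω * b k) (d : κ → ℂ) :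
    phaseError f₁ f₂ b (fun k => (2 : ℂ)⁻¹ * (d k + star ω * star (d (ExchangeIndex.rev k)))) =
      phaseError f₁ f₂ b d := by
  -- Averaging replaces the phase error at `k` by half its difference from the one at the reversed
  -- position. Reversal exchanges the two shifted parts, so the two halves add up to the original
  -- sum.
  have key : ∀ k, (star (b k) * (2⁻¹ * (d k + star ω * star (d (ExchangeIndex.rev k))))).im =
      2⁻¹ * ((star (b k) * d k).im -
        (star (b (ExchangeIndex.rev k)) * d (ExchangeIndex.rev k)).im) := by
    intro k
    have h1 : star (b k) * star ω = b (ExchangeIndex.rev k) := by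
      rw [mul_comm, ← star_mul', ← hbω, star_star]
    have h2 : star (b k) * (2⁻¹ * (d k + star ω * star (d (ExchangeIndex.rev k)))) =
        ((2⁻¹ : ℝ) : ℂ) * (star (b k) * d k +
          star (star (b (ExchangeIndex.rev k)) * d (ExchangeIndex.rev k))) := by
      rw [star_mul', star_star, ← h1]; push_cast; ring
    rw [h2, Complex.im_ofReal_mul, Complex.add_im, Complex.star_def, Complex.conj_im]
    ring
  have hff' : ∀ i, ExchangeIndex.rev (f₁ i) = f₂ (ExchangeIndex.rev i) := fun i => by
    rw [← hff, hκ]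
  have hff'' : ∀ i, ExchangeIndex.rev (f₂ i) = f₁ (ExchangeIndex.rev i) := fun i => by
    rw [← hff, hκ' i]
  simp only [phaseError]
  congr 1
  simp only [key]
  simp only [hff', hff'']
  have hsum : ∀ p : κ' → ℝ, ∑ i, p (ExchangeIndex.rev i) = ∑ i, p i := fun p =>
    Equiv.sum_comp hκ'.toPerm p
  have e1 := hsum fun i => (star (b (f₁ i)) * d (f₁ i)).im
  have e2 := hsum fun i => (star (b (f₂ i)) * d (f₂ i)).im
  simp only [Finset.sum_sub_distrib, ← Finset.mul_sum, e1, e2]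
  ring

section Estimators

variable {X : Type*} {l : Filter X} {g : X → ℝ} {κ κ' ν : Type*} [Fintype κ] [DecidableEq κ]
  [Fintype κ'] [Fintype ν]

/-- For unimodular `b` the denominator `‖J₁ b‖²` is the number of shift pairs. Factoring `exp (j μ)`
out of the first-order term turns `J₂ - γ J₁` into a difference of relative errors `b^* d` at paired
positions, whose imaginary part is the phase error. -/
theorem standard_sub_isBigO [Nonempty κ'] (hg : Tendsto g l (𝓝 0)) {f₁ f₂ : κ' → κ} {b : κ → ℂ}
    {c : ν → ℂ} {μ : ℝ} (hμ : |μ| < Real.pi) (hb : ∀ k, ‖b k‖ = 1) (hc : c ≠ 0)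
    (hf : ∀ i, b (f₂ i) = Complex.exp (Complex.I * μ) * b (f₁ i)) {F : X → Matrix κ ν ℂ}
    (hF : ∀ i j, (fun x => F x i j) =O[l] g) {m : X → ℝ}
    (hm : ∀ᶠ x in l, IsStandardEspritEstimate (selection f₁) (selection f₂)
      (vecMulVec b c + F x) (m x)) :
    (fun x => m x - μ - phaseError f₁ f₂ b ((star c ⬝ᵥ c)⁻¹ • F x *ᵥ star c))
      =O[l] fun x => g x ^ 2 := by
  have hne : Nonempty κ := ‹Nonempty κ'›.map f₁
  have hb0 : b ≠ 0 := by
    intro h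
    obtain ⟨k⟩ := hne
    have := hb k
    simp [h] at this
  have hm' : ∀ᶠ x in l, ∃ u : κ → ℂ, IsDominantLeftSingularVector (vecMulVec b c + F x) u ∧
    m x = (lsShift (selection f₁) (selection f₂) u).arg := hm
  obtain ⟨u, hu⟩ := exists_eventually_of_eventually_exists hm'
  obtain ⟨α, hα, hv⟩ := exists_smul_dominant_sub_isBigO hg hb0 hc hF (hu.mono fun x h => h.1)
  set e := Complex.exp (Complex.I * μ) with he
  have hee : star e * e = 1 := star_mul_self_of_norm_one (by
    rw [he, mul_comm]; exact Complex.norm_exp_ofReal_mul_I μ)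
  have hA : selection f₁ *ᵥ b ≠ 0 := by
    rw [selection_mulVec]
    intro h
    obtain ⟨i⟩ := ‹Nonempty κ'›
    have h1 := hb (f₁ i)
    rw [show b (f₁ i) = 0 from congrFun h i] at h1
    simp at h1
  have hB : selection f₂ *ᵥ b = e • selection f₁ *ᵥ b := by
    rw [selection_mulVec, selection_mulVec]
    ext i
    exact hf i
  have hexp := lsShift_sub_isBigO hg (selection f₁) (selection f₂) hA hB
    (v := fun x => α x • u x) (isBigO_mulVec_star (c := c) hF (star c ⬝ᵥ c)⁻¹) hv
  have hz : (fun x => lsShift (selection f₁) (selection f₂) (α x • u x) -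
      Complex.exp (Complex.I * μ) * (1 + (Fintype.card κ' : ℂ)⁻¹ *
        ∑ i, (star (b (f₂ i)) * ((star c ⬝ᵥ c)⁻¹ • F x *ᵥ star c) (f₂ i) -
          star (b (f₁ i)) * ((star c ⬝ᵥ c)⁻¹ • F x *ᵥ star c) (f₁ i)))) =O[l]
      fun x => g x ^ 2 := by
    refine hexp.congr_left fun x => ?_
    congr 1
    rw [mul_add, mul_one]
    congr 1
    rw [star_dotProduct_self_eq, selection_mulVec]
    simp only [hb, one_pow, Finset.sum_const, Finset.card_univ, nsmul_eq_mul, mul_one]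
    rw [mul_left_comm]
    push_cast
    congr 1
    rw [sub_mulVec, smul_mulVec, selection_mulVec, selection_mulVec, dotProduct, Finset.mul_sum]
    refine Finset.sum_congr rfl fun i _ => ?_
    simp only [Pi.star_apply, Pi.sub_apply, Pi.smul_apply, smul_eq_mul, hf, star_mul']
    linear_combination (-star (b (f₁ i)) * ((star c ⬝ᵥ c)⁻¹ * (F x *ᵥ star c) (f₂ i))) * hee
  have harg := arg_sub_isBigO hg hμ (isBigO_phase_sum f₁ f₂ b
    (isBigO_mulVec_star (c := c) hF (star c ⬝ᵥ c)⁻¹)) hz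
  refine harg.congr' ?_ EventuallyEq.rfl
  filter_upwards [hα, hu] with x hx hux
  rw [lsShift_smul _ _ hx, ← hux.2, eq_phaseError_im]

variable [ExchangeIndex κ] [DecidableEq κ'] [ExchangeIndex κ'] [DecidableEq ν] [ExchangeIndex ν]

theorem exchange_mul_map_star_mul_exchange
    (hν : Function.Involutive (ExchangeIndex.rev : ν → ν)) (Z : Matrix κ ν ℂ) :
    exchange κ * Z.map star * exchange ν =
      Matrix.of fun i j => star (Z (ExchangeIndex.rev i) (ExchangeIndex.rev j)) := by
  rw [mul_exchange hν, exchange_eq_selection, selection_mul]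
  rfl

theorem fba_centroHermitian (hκ : Function.Involutive (ExchangeIndex.rev : κ → κ))
    (hν : Function.Involutive (ExchangeIndex.rev : ν → ν)) (Y : Matrix κ ν ℂ) :
    exchange κ * (fba Y).map star * exchange (Fin 2 × ν) = fba Y := by
  rw [exchange_mul_map_star_mul_exchange (rev_prod_involutive rev_fin_two_involutive hν)]
  ext i q
  rw [of_apply, fba_apply hν, fba_apply hν]
  change star (if (ExchangeIndex.rev q.1 : Fin 2) = 0 then Y (ExchangeIndex.rev i)
    (ExchangeIndex.rev q.2) else star (Y (ExchangeIndex.rev (ExchangeIndex.rev i))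
      (ExchangeIndex.rev (ExchangeIndex.rev q.2)))) = _
  rw [hκ i, hν q.2]
  by_cases h : q.1 = 0 <;> simp [rev_fin_two_eq_zero_iff, h]

/-- The real problem is carried back to the complex one with selection matrices `J₁ + J₂` and `J₂ -
J₁`, whose noise-free solution is `j tan (μ / 2)`. The expansion is then that of the standard case
for the averaged data, and averaging does not change the phase error. -/
theorem unitary_sub_isBigO [Nonempty κ'] (hg : Tendsto g l (𝓝 0))
    (hκ : Function.Involutive (ExchangeIndex.rev : κ → κ))
    (hκ' : Function.Involutive (ExchangeIndex.rev : κ' → κ'))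
    (hν : Function.Involutive (ExchangeIndex.rev : ν → ν))
    {f₁ f₂ : κ' → κ} (hff : ∀ i, ExchangeIndex.rev (f₂ (ExchangeIndex.rev i)) = f₁ i) {b : κ → ℂ}
    {c : ν → ℂ} {μ : ℝ} (hμ : |μ| < Real.pi) (hb : ∀ k, ‖b k‖ = 1) (hc : c ≠ 0)
    {ω : ℂ} (hbω : ∀ k, star (b (ExchangeIndex.rev k)) = ω * b k)
    (hf : ∀ i, b (f₂ i) = Complex.exp (Complex.I * μ) * b (f₁ i)) {F : X → Matrix κ ν ℂ}
    (hF : ∀ i j, (fun x => F x i j) =O[l] g) {m : X → ℝ}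
    (hm : ∀ᶠ x in l, IsUnitaryEspritEstimate (selection f₂) (vecMulVec b c + F x) (m x)) :
    (fun x => m x - μ - phaseError f₁ f₂ b ((star c ⬝ᵥ c)⁻¹ • F x *ᵥ star c))
      =O[l] fun x => g x ^ 2 := by
  have hne : Nonempty κ := ‹Nonempty κ'›.map f₁
  have hb0 : b ≠ 0 := by
    intro h
    obtain ⟨k⟩ := hne
    have := hb k
    simp [h] at this
  have hωn : star ω * ω = 1 := star_mul_self_of_norm_one (by
    obtain ⟨k⟩ := hne
    have := congrArg norm (hbω k)
    rw [norm_star, norm_mul, hb, hb, mul_one] at this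
    exact this.symm)
  have hsel : exchange κ' * (selection f₂).map star * exchange κ = selection f₁ := by
    rw [exchange_mul_map_star_mul_exchange hκ]
    ext i j
    have : ExchangeIndex.rev j = f₂ (ExchangeIndex.rev i) ↔ j = f₁ i := by
      rw [← hff]
      exact ⟨fun h => by rw [← h, hκ j], fun h => by rw [h, hκ]⟩
    simp only [selection, of_apply, this]
    split_ifs <;> simp
  -- the forward-backward averaged data
  set c' : Fin 2 × ν → ℂ := fun q =>
    if q.1 = 0 then c q.2 else ω * star (c (ExchangeIndex.rev q.2)) with hc'
  -- Since `Π b^* = ω b`, averaging keeps the left factor `b` and only lengthens the right factor.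
  have hfba : ∀ x, fba (vecMulVec b c + F x) = vecMulVec b c' + fba (F x) := by
    intro x
    ext i q
    rw [Matrix.add_apply (vecMulVec b c'), fba_apply hν, fba_apply hν, vecMulVec_apply]
    simp only [Matrix.add_apply, vecMulVec_apply, hc']
    split_ifs
    · rfl
    · rw [star_add, star_mul', hbω]; ring
  have hF' : ∀ i q, (fun x => fba (F x) i q) =O[l] g := by
    intro i q
    simp only [fba_apply hν]
    split_ifs
    · exact hF _ _
    · exact isBigO_star (hF _ _)
  have hsumν : ∀ p : ν → ℂ, ∑ i, p (ExchangeIndex.rev i) = ∑ i, p i := fun p =>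
    Equiv.sum_comp hν.toPerm p
  have hcc' : star c' ⬝ᵥ c' = 2 * (star c ⬝ᵥ c) := by
    simp only [dotProduct, Fintype.sum_prod_type, Fin.sum_univ_two, Pi.star_apply, hc', if_true,
      Fin.one_eq_zero_iff, OfNat.ofNat_ne_one, if_false, star_mul', star_star]
    have : ∀ j, star ω * c (ExchangeIndex.rev j) * (ω * star (c (ExchangeIndex.rev j))) =
      star (c (ExchangeIndex.rev j)) * c (ExchangeIndex.rev j) := fun j => by
        linear_combination (c (ExchangeIndex.rev j) * star (c (ExchangeIndex.rev j))) * hωn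
    simp only [this]
    rw [hsumν fun j => star (c j) * c j]
    ring
  have hc'0 : c' ≠ 0 := by
    intro h
    apply hc
    ext j
    simpa [hc'] using congrFun h (0, j)
  have hFc' : ∀ x, (star c' ⬝ᵥ c')⁻¹ • fba (F x) *ᵥ star c' = fun k =>
      (2 : ℂ)⁻¹ * (((star c ⬝ᵥ c)⁻¹ • F x *ᵥ star c) k +
        star ω * star (((star c ⬝ᵥ c)⁻¹ • F x *ᵥ star c) (ExchangeIndex.rev k))) := by
    intro x
    ext k
    have hreal : star ((star c ⬝ᵥ c)⁻¹) = (star c ⬝ᵥ c)⁻¹ := by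
      rw [star_dotProduct_self_eq, star_inv₀, Complex.star_def, Complex.conj_ofReal]
    have h1 : (fba (F x) *ᵥ star c') k = (F x *ᵥ star c) k +
        star ω * star ((F x *ᵥ star c) (ExchangeIndex.rev k)) := by
      simp only [mulVec, dotProduct, Fintype.sum_prod_type, Fin.sum_univ_two, Pi.star_apply, hc',
        fba_apply hν, if_true, Fin.one_eq_zero_iff, OfNat.ofNat_ne_one, if_false, star_mul',
        star_star, star_sum, Finset.mul_sum]
      congr 1
      rw [← hsumν]
      refine Finset.sum_congr rfl fun j _ => ?_
      rw [hν j]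
      ring
    simp only [Pi.smul_apply, smul_eq_mul, h1, star_mul', hreal, hcc', mul_inv]
    ring
  have hm' : ∀ᶠ x in l, ∃ u : κ → ℂ,
      IsDominantLeftSingularVector (vecMulVec b c' + fba (F x)) u ∧
      ∃ υ : ℝ, m x = 2 * Real.arctan υ ∧ (υ : ℂ) = -Complex.I *
        lsShift (selection f₁ + selection f₂) (selection f₂ - selection f₁) u := by
    filter_upwards [hm] with x hx
    obtain ⟨Q, Q₁, Q₂, e, hQ, hQ₁, hQ₂, he, hmx⟩ := hx
    refine ⟨Q *ᵥ fun k => (e k : ℂ), ?_, _, hmx, ofReal_shift_unitary hκ hκ' hQ hQ₁ hsel e⟩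
    rw [← hfba]
    exact isDominant_of_real hκ (rev_prod_involutive rev_fin_two_involutive hν) hQ hQ₂
      (fba_centroHermitian hκ hν _) he
  obtain ⟨u, hu⟩ := exists_eventually_of_eventually_exists hm'
  have hυ' : ∀ᶠ x in l, ∃ υ : ℝ, m x = 2 * Real.arctan υ ∧ (υ : ℂ) = -Complex.I *
        lsShift (selection f₁ + selection f₂) (selection f₂ - selection f₁) (u x) :=
    hu.mono fun x h => h.2
  obtain ⟨υ, hυ⟩ := exists_eventually_of_eventually_exists hυ'
  obtain ⟨α, hα, hv⟩ := exists_smul_dominant_sub_isBigO hg hb0 hc'0 hF' (hu.mono fun x h => h.1)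
  set C := Real.cos (μ / 2) with hC
  set S := Real.sin (μ / 2) with hS
  have hC0 : 0 < C := Real.cos_pos_of_mem_Ioo
    ⟨by linarith [(abs_lt.mp hμ).1], by linarith [(abs_lt.mp hμ).2]⟩
  have hCc : (C : ℂ) ≠ 0 := by exact_mod_cast hC0.ne'
  have hCS : (C : ℂ) ^ 2 + (S : ℂ) ^ 2 = 1 := by
    exact_mod_cast (by rw [hC, hS]; exact Real.cos_sq_add_sin_sq (μ / 2) : C ^ 2 + S ^ 2 = 1)
  -- `h = exp (j μ / 2)` symmetrises the shift: `h² + 1 = 2 C h` and `h² - 1 = 2 j S h`, with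
  -- quotient `j tan (μ / 2)`.
  set h : ℂ := C + S * Complex.I with hh
  have hI : Complex.I ^ 2 = -1 := Complex.I_sq
  have hstarh : star h = C - S * Complex.I := by
    simp [hh, Complex.ext_iff]
  have hhh : star h * h = 1 := by
    rw [hstarh, hh]; linear_combination hCS - (S : ℂ) ^ 2 * hI
  have hexp : Complex.exp (Complex.I * μ) = h ^ 2 := by
    have : h = Complex.exp ((μ / 2 : ℝ) * Complex.I) := by
      rw [Complex.exp_mul_I, ← Complex.ofReal_cos, ← Complex.ofReal_sin]
    rw [this, ← Complex.exp_nat_mul]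
    congr 1
    push_cast; ring
  have hf' : ∀ i, b (f₂ i) = h ^ 2 * b (f₁ i) := fun i => by rw [← hexp]; exact hf i
  have hplus : h ^ 2 + 1 = 2 * C * h := by
    rw [hh]; linear_combination (S : ℂ) ^ 2 * hI - hCS
  have hminus : h ^ 2 - 1 = 2 * S * Complex.I * h := by
    rw [hh]; linear_combination -(S : ℂ) ^ 2 * hI + hCS
  set γ : ℂ := Complex.I * (S / C) with hγ
  have hAb : (selection f₁ + selection f₂) *ᵥ b = fun i => 2 * C * h * b (f₁ i) := by
    rw [add_mulVec, selection_mulVec, selection_mulVec]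
    ext i
    rw [Pi.add_apply, hf', ← hplus]; ring
  have hA : (selection f₁ + selection f₂) *ᵥ b ≠ 0 := by
    rw [hAb]
    intro h0
    obtain ⟨i⟩ := ‹Nonempty κ'›
    have h1 := congrArg norm (congrFun h0 i)
    have hn : ‖h‖ = 1 := by
      have h2 : ‖h‖ * ‖h‖ = 1 := by
        have := congrArg norm hhh
        rwa [norm_mul, norm_star, norm_one] at this
      nlinarith [norm_nonneg h]
    simp [hn, hb, hC0.ne'] at h1
  have hB : (selection f₂ - selection f₁) *ᵥ b = γ • (selection f₁ + selection f₂) *ᵥ b := by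
    rw [hAb, sub_mulVec, selection_mulVec, selection_mulVec]
    ext i
    simp only [Pi.sub_apply, Pi.smul_apply, smul_eq_mul]
    rw [hf', hγ]
    field_simp
    linear_combination (b (f₁ i)) * hminus
  set d : X → κ → ℂ := fun x => (star c' ⬝ᵥ c')⁻¹ • fba (F x) *ᵥ star c' with hd
  have hdO : ∀ i, (fun x => d x i) =O[l] g := isBigO_mulVec_star (c := c') hF' (star c' ⬝ᵥ c')⁻¹
  have hls := lsShift_sub_isBigO hg _ _ hA hB (v := fun x => α x • u x) hdO hv
  have hpe : ∀ x, phaseError f₁ f₂ b (d x) =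
      phaseError f₁ f₂ b ((star c ⬝ᵥ c)⁻¹ • F x *ᵥ star c) := by
    intro x
    rw [hd]
    simp only [hFc']
    exact phaseError_fba hκ hκ' hff hbω _
  -- The factor `(2 C²)⁻¹` will cancel against the derivative `2 cos² (μ / 2)` of `2 arctan`.
  have hζO : (fun x => (2 * C ^ 2)⁻¹ * phaseError f₁ f₂ b (d x)) =O[l] g := by
    refine IsBigO.const_mul_left ?_ _
    simp only [eq_phaseError_im]
    exact isBigO_im (isBigO_phase_sum f₁ f₂ b hdO)
  have hυO : (fun x => υ x - (Real.tan (μ / 2) + (2 * C ^ 2)⁻¹ * phaseError f₁ f₂ b (d x)))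
      =O[l] fun x => g x ^ 2 := by
    have h1 := (hls.const_mul_left (-Complex.I))
    have h2 := isBigO_re h1
    refine h2.congr' ?_ EventuallyEq.rfl
    filter_upwards [hα, hυ] with x hx hυx
    rw [lsShift_smul _ _ hx, mul_sub, ← hυx.2, Complex.sub_re, Complex.ofReal_re]
    congr 1
    have hnum :
        (star ((selection f₁ + selection f₂) *ᵥ b) ⬝ᵥ (selection f₁ + selection f₂) *ᵥ b)⁻¹ *
        (star ((selection f₁ + selection f₂) *ᵥ b) ⬝ᵥ
          (selection f₂ - selection f₁ - γ • (selection f₁ + selection f₂)) *ᵥ d x) =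
        (((2 * C ^ 2)⁻¹ : ℝ) : ℂ) * ((Fintype.card κ' : ℂ)⁻¹ *
          ∑ i, (star (b (f₂ i)) * d x (f₂ i) - star (b (f₁ i)) * d x (f₁ i))) := by
      have hcard : (Fintype.card κ' : ℂ) ≠ 0 := by exact_mod_cast Fintype.card_ne_zero
      have hden : star ((selection f₁ + selection f₂) *ᵥ b) ⬝ᵥ (selection f₁ + selection f₂) *ᵥ b =
          4 * C ^ 2 * Fintype.card κ' := by
        have hterm : ∀ i, star (2 * (C : ℂ) * h * b (f₁ i)) * (2 * C * h * b (f₁ i)) =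
            4 * C ^ 2 := by
          intro i
          have hbi := star_mul_self_of_norm_one (hb (f₁ i))
          simp only [star_mul', Complex.star_def, Complex.conj_ofReal, map_ofNat] at hbi hhh ⊢
          linear_combination (4 * (C : ℂ) ^ 2 * (starRingEnd ℂ (b (f₁ i)) * b (f₁ i))) * hhh
            + (4 * (C : ℂ) ^ 2) * hbi
        rw [hAb]
        simp only [dotProduct, Pi.star_apply, hterm, Finset.sum_const, Finset.card_univ,
          nsmul_eq_mul]
        ring
      have hn : star ((selection f₁ + selection f₂) *ᵥ b) ⬝ᵥ
          (selection f₂ - selection f₁ - γ • (selection f₁ + selection f₂)) *ᵥ d x =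
          2 * ∑ i, (star (b (f₂ i)) * d x (f₂ i) - star (b (f₁ i)) * d x (f₁ i)) := by
        rw [hAb, sub_mulVec, sub_mulVec, smul_mulVec, add_mulVec, selection_mulVec,
          selection_mulVec, dotProduct, Finset.mul_sum]
        refine Finset.sum_congr rfl fun i _ => ?_
        simp only [Pi.star_apply, Pi.sub_apply, Pi.smul_apply, Pi.add_apply, smul_eq_mul, hf',
          star_mul', star_pow, hγ]
        have e1 : star (2 : ℂ) = 2 := by simp
        have e2 : star (C : ℂ) = C := by simp
        rw [e1, e2]
        field_simp
        -- After multiplication by `C` the two coefficients `1 ∓ γ` become `star h` and `h`, which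
        -- restores the weights `star (b (f₂ i))` and `star (b (f₁ i))`.
        have e3 : (C : ℂ) - Complex.I * S = star h := by rw [hstarh]; ring
        have e4 : (C : ℂ) + Complex.I * S = h := by rw [hh]; ring
        linear_combination (star h * star (b (f₁ i)) * d x (f₂ i)) * e3
          - (star h * star (b (f₁ i)) * d x (f₁ i)) * e4 - star (b (f₁ i)) * d x (f₁ i) * hhh
      rw [hden, hn]
      push_cast
      field_simp
      ring
    rw [hnum, eq_phaseError_im]
    set Ψ := (Fintype.card κ' : ℂ)⁻¹ *
          ∑ i, (star (b (f₂ i)) * d x (f₂ i) - star (b (f₁ i)) * d x (f₁ i))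
    have e5 : -Complex.I * (γ + (((2 * C ^ 2)⁻¹ : ℝ) : ℂ) * Ψ) =
        ((S / C : ℝ) : ℂ) + (((2 * C ^ 2)⁻¹ : ℝ) : ℂ) * (-Complex.I * Ψ) := by
      rw [hγ]; push_cast
      linear_combination (-(S : ℂ) / C) * hI
    rw [e5, Complex.add_re, Complex.ofReal_re, Complex.re_ofReal_mul, Real.tan_eq_sin_div_cos,
      ← hS, ← hC]
    simp
  refine (two_arctan_sub_isBigO hg hμ hζO hυO).congr' ?_ EventuallyEq.rfl
  filter_upwards [hυ] with x hx
  rw [← hx.1, hpe]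
  have : 2 * C ^ 2 ≠ 0 := by positivity
  rw [mul_inv_cancel_left₀ this]

end Estimators

/-! ### Existence and boundedness of the estimates -/

section Estimates

variable {κ κ' ν : Type*} [Fintype κ] [Fintype κ'] [Fintype ν]

theorem exists_isStandardEspritEstimate [Nonempty κ] (J₁ J₂ : Matrix κ' κ ℂ) (Y : Matrix κ ν ℂ) :
    ∃ m, IsStandardEspritEstimate J₁ J₂ Y m :=
  let ⟨u, hu⟩ := exists_isDominantLeftSingularVector Y
  ⟨_, u, hu, rfl⟩

/-- This uniform bound controls the estimates when the noise is large, where the first-order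
expansion says nothing. -/
theorem IsStandardEspritEstimate.abs_le {J₁ J₂ : Matrix κ' κ ℂ} {Y : Matrix κ ν ℂ} {m : ℝ}
    (h : IsStandardEspritEstimate J₁ J₂ Y m) : |m| ≤ Real.pi := by
  obtain ⟨u, -, rfl⟩ := h
  exact Complex.abs_arg_le_pi _

variable [DecidableEq κ] [ExchangeIndex κ] [DecidableEq κ'] [ExchangeIndex κ']
  [DecidableEq ν] [ExchangeIndex ν]

theorem exists_isUnitaryEspritEstimate [Nonempty κ]
    (hκ : Function.Involutive (ExchangeIndex.rev : κ → κ))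
    (hκ' : Function.Involutive (ExchangeIndex.rev : κ' → κ'))
    (hν : Function.Involutive (ExchangeIndex.rev : ν → ν)) (J₂ : Matrix κ' κ ℂ)
    (Y : Matrix κ ν ℂ) : ∃ m, IsUnitaryEspritEstimate J₂ Y m := by
  obtain ⟨Q, hQ⟩ := exists_isUnitaryLeftPiReal hκ
  obtain ⟨Q₁, hQ₁⟩ := exists_isUnitaryLeftPiReal hκ'
  obtain ⟨Q₂, hQ₂⟩ := exists_isUnitaryLeftPiReal (rev_prod_involutive rev_fin_two_involutive hν)
  obtain ⟨e, he⟩ := exists_isDominantLeftSingularVector ((Qᴴ * fba Y * Q₂).map Complex.re)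
  exact ⟨_, Q, Q₁, Q₂, e, hQ, hQ₁, hQ₂, he, rfl⟩

theorem IsUnitaryEspritEstimate.abs_le {J₂ : Matrix κ' κ ℂ} {Y : Matrix κ ν ℂ} {m : ℝ}
    (h : IsUnitaryEspritEstimate J₂ Y m) : |m| ≤ Real.pi := by
  obtain ⟨Q, Q₁, Q₂, e, -, -, -, -, rfl⟩ := h
  rw [_root_.abs_le]
  constructor
  · linarith [Real.neg_pi_div_two_lt_arctan (lsShift ((2 : ℝ) • (Q₁ᴴ * J₂ * Q).map Complex.re)
      ((2 : ℝ) • (Q₁ᴴ * J₂ * Q).map Complex.im) e)]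
  · linarith [Real.arctan_lt_pi_div_two (lsShift ((2 : ℝ) • (Q₁ᴴ * J₂ * Q).map Complex.re)
      ((2 : ℝ) • (Q₁ᴴ * J₂ * Q).map Complex.im) e)]

end Estimates

/-! ### Frobenius norm, and uniform error bounds from Landau bounds along a filter -/

section Frobenius

variable {κ ν : Type*} [Fintype κ] [Fintype ν]

theorem frob_nonneg (E : Matrix κ ν ℂ) : 0 ≤ frob E := Real.sqrt_nonneg _

theorem frob_sq (E : Matrix κ ν ℂ) : frob E ^ 2 = ∑ i, ∑ n, ‖E i n‖ ^ 2 :=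
  Real.sq_sqrt (by positivity)

theorem norm_apply_le_frob (E : Matrix κ ν ℂ) (i : κ) (n : ν) : ‖E i n‖ ≤ frob E := by
  refine Real.le_sqrt_of_sq_le ?_
  calc ‖E i n‖ ^ 2 ≤ ∑ n, ‖E i n‖ ^ 2 := Finset.single_le_sum (f := fun n => ‖E i n‖ ^ 2)
        (fun _ _ => by positivity) (Finset.mem_univ n)
    _ ≤ _ := Finset.single_le_sum (f := fun i => ∑ n, ‖E i n‖ ^ 2)
        (fun _ _ => by positivity) (Finset.mem_univ i)

/-- The filter of small perturbations `E` together with an estimate from `X₀ + E`. -/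
noncomputable def estimateFilter (Est : Matrix κ ν ℂ → ℝ → Prop) (X₀ : Matrix κ ν ℂ) :
    Filter (Matrix κ ν ℂ × ℝ) :=
  comap (fun x => frob x.1) (𝓝 0) ⊓ 𝓟 {x | Est (X₀ + x.1) x.2}

theorem tendsto_frob_estimateFilter (Est : Matrix κ ν ℂ → ℝ → Prop) (X₀ : Matrix κ ν ℂ) :
    Tendsto (fun x : Matrix κ ν ℂ × ℝ => frob x.1) (estimateFilter Est X₀) (𝓝 0) :=
  tendsto_comap.mono_left inf_le_left

theorem eventually_estimateFilter (Est : Matrix κ ν ℂ → ℝ → Prop) (X₀ : Matrix κ ν ℂ) :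
    ∀ᶠ x in estimateFilter Est X₀, Est (X₀ + x.1) x.2 :=
  mem_inf_of_right (mem_principal_self _)

theorem isBigO_frob {l : Filter (Matrix κ ν ℂ × ℝ)} (i : κ) (n : ν) :
    (fun x : Matrix κ ν ℂ × ℝ => x.1 i n) =O[l] fun x => frob x.1 :=
  IsBigO.of_norm_le fun _ => norm_apply_le_frob _ _ _

/-- The filter ranges over pairs of a perturbation and an admissible estimate, so one Landau bound
is uniform over all choices of singular vectors and transforms. -/
theorem isFirstOrderError_of_isBigO {Est : Matrix κ ν ℂ → ℝ → Prop} {X₀ : Matrix κ ν ℂ} {μ : ℝ}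
    {ℓ : Matrix κ ν ℂ →ₗ[ℝ] ℝ} (hex : ∀ Y, ∃ m, Est Y m)
    (h : (fun x : Matrix κ ν ℂ × ℝ => x.2 - μ - ℓ x.1) =O[estimateFilter Est X₀]
      fun x => frob x.1 ^ 2) : IsFirstOrderError Est X₀ μ ℓ := by
  obtain ⟨C, hC⟩ := h.bound
  rw [estimateFilter, eventually_inf_principal, eventually_comap] at hC
  obtain ⟨ε, hε, hb⟩ := Metric.eventually_nhds_iff.mp hC
  refine ⟨C, ε, hε, fun E hE => ⟨hex _, fun m hm => ?_⟩⟩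
  have hd : dist (frob E) 0 < ε := by
    rw [Real.dist_eq, sub_zero, abs_of_nonneg (frob_nonneg E)]; exact hE
  have := hb hd (E, m) rfl hm
  rwa [Real.norm_eq_abs, norm_pow, Real.norm_of_nonneg (frob_nonneg E)] at this

end Frobenius

/-! ### Plane waves on grids -/

theorem rev_fin_involutive (n : ℕ) : Function.Involutive (ExchangeIndex.rev : Fin n → Fin n) :=
  fun i => Fin.rev_rev i

theorem rev_grid_involutive {R : ℕ} (D : Fin R → ℕ) :
    Function.Involutive (ExchangeIndex.rev : Grid D → Grid D) :=
  fun x => funext fun p => Fin.rev_rev (x p)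

theorem rev_grid_val {R : ℕ} {D : Fin R → ℕ} (m : Grid D) (p : Fin R) :
    ((ExchangeIndex.rev m : Grid D) p : ℕ) = D p - (m p + 1) :=
  Fin.val_rev (m p)

/-- The plane wave with phase `(m p + θ p) * μ p` in mode `p`. -/
noncomputable def planeWave {R : ℕ} {D : Fin R → ℕ} (θ μ : Fin R → ℝ) (m : Grid D) : ℂ :=
  ∏ p, Complex.exp (Complex.I * (((m p : ℕ) + θ p) * μ p : ℝ))

section Grids

variable {R N : ℕ} {M L : Fin R → ℕ}

theorem steering_eq_planeWave (M : Fin R → ℕ) (δ μ : Fin R → ℝ) :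
    steering M δ μ = planeWave (fun p => -((M p : ℝ) - 1) / 2 + δ p) μ := by
  ext m
  simp only [steering, planeWave]
  refine Finset.prod_congr rfl fun p _ => ?_
  congr 3
  ring

theorem norm_planeWave {D : Fin R → ℕ} (θ μ : Fin R → ℝ) (m : Grid D) : ‖planeWave θ μ m‖ = 1 := by
  rw [planeWave, norm_prod]
  exact Finset.prod_eq_one fun p _ => by rw [mul_comm]; exact Complex.norm_exp_ofReal_mul_I _

theorem star_exp_I_mul (x : ℝ) :
    star (Complex.exp (Complex.I * x)) = Complex.exp (Complex.I * (-x : ℝ)) := by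
  rw [Complex.star_def, ← Complex.exp_conj]
  simp

/-- Reversal negates each position up to a constant and conjugation negates the phase again. The
phase reference enters only through the constant `ω`. -/
theorem exists_star_planeWave_rev (D : Fin R → ℕ) (θ μ : Fin R → ℝ) :
    ∃ ω : ℂ, ∀ m : Grid D, star (planeWave θ μ (ExchangeIndex.rev m : Grid D)) =
      ω * planeWave θ μ m := by
  refine ⟨∏ p, Complex.exp (Complex.I * (-((D p - 1 + 2 * θ p) * μ p) : ℝ)), fun m => ?_⟩
  rw [planeWave, planeWave, star_prod, ← Finset.prod_mul_distrib]
  refine Finset.prod_congr rfl fun p _ => ?_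
  rw [star_exp_I_mul, ← Complex.exp_add, ← mul_add, ← Complex.ofReal_add, rev_grid_val,
    Nat.cast_sub (m p).2]
  congr 3
  push_cast
  ring

/-- Position `k` of the subarray that starts at `ℓ`. -/
def subarrayPos (hL : ∀ p, 1 ≤ L p ∧ L p ≤ M p) (k : Grid (subSize M L)) (ℓ : Grid L) : Grid M :=
  fun p => ⟨k p + ℓ p, by
    have h1 := (k p).2
    have h2 := (ℓ p).2
    have h3 := hL p
    simp only [subSize] at h1
    omega⟩

theorem rev_subarrayPos (hL : ∀ p, 1 ≤ L p ∧ L p ≤ M p) (k : Grid (subSize M L)) (ℓ : Grid L) :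
    (ExchangeIndex.rev (subarrayPos hL k ℓ) : Grid M) =
      subarrayPos hL (ExchangeIndex.rev k : Grid (subSize M L)) (ExchangeIndex.rev ℓ : Grid L) := by
  ext p
  rw [rev_grid_val]
  simp only [subarrayPos]
  rw [rev_grid_val, rev_grid_val]
  have h1 := (k p).2
  have h2 := (ℓ p).2
  have h3 := hL p
  simp only [subSize] at h1 ⊢
  omega

/-- The offset `θ` goes entirely to the factor in `k`; thus all subarrays share one left vector and
the smoothed signal has rank one. -/
theorem planeWave_subarrayPos (hL : ∀ p, 1 ≤ L p ∧ L p ≤ M p) (θ μ : Fin R → ℝ)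
    (k : Grid (subSize M L)) (ℓ : Grid L) :
    planeWave θ μ (subarrayPos hL k ℓ) = planeWave θ μ k * planeWave 0 μ ℓ := by
  simp only [planeWave, subarrayPos]
  rw [← Finset.prod_mul_distrib]
  refine Finset.prod_congr rfl fun p _ => ?_
  rw [← Complex.exp_add]
  congr 1
  push_cast
  simp only [Pi.zero_apply]
  push_cast
  ring

theorem subarraySelection_eq (hL : ∀ p, 1 ≤ L p ∧ L p ≤ M p) (ℓ : Grid L) :
    subarraySelection M L ℓ = selection fun k => subarrayPos hL k ℓ := by
  ext k m
  simp only [subarraySelection, selection, of_apply, funext_iff, subarrayPos, Fin.ext_iff]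

/-- Position `i` of the part of a grid that is shifted by `e` in mode `r`. -/
def shiftPos (D : Fin R → ℕ) (r : Fin R) (e : Fin 2) (i : Grid (shiftSize D r)) : Grid D :=
  fun p => ⟨i p + if p = r then (e : ℕ) else 0, by
    have h := (i p).2
    have he := e.2
    by_cases hp : p = r
    · subst hp
      simp only [shiftSize, Function.update_self] at h
      simp only [if_true]
      omega
    · simp only [shiftSize, Function.update_of_ne hp] at h
      simpa [hp] using h⟩

theorem rev_shiftPos_rev (D : Fin R → ℕ) (r : Fin R) (i : Grid (shiftSize D r)) :
    (ExchangeIndex.rev (shiftPos D r 1 (ExchangeIndex.rev i : Grid (shiftSize D r))) : Grid D) =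
      shiftPos D r 0 i := by
  ext p
  rw [rev_grid_val]
  simp only [shiftPos]
  rw [rev_grid_val]
  have h := (i p).2
  by_cases hp : p = r
  · subst hp
    simp only [shiftSize, Function.update_self, if_true] at h ⊢
    simp
    omega
  · simp only [shiftSize, Function.update_of_ne hp, if_neg hp] at h ⊢
    omega

theorem shiftSelection_eq (D : Fin R → ℕ) (r : Fin R) (e : Fin 2) :
    shiftSelection D r e = selection (shiftPos D r e) := by
  ext k m
  simp only [shiftSelection, selection, of_apply, funext_iff, shiftPos, Fin.ext_iff]

theorem shiftSelection_zero (D : Fin R → ℕ) (r : Fin R) :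
    shiftSelection D r 0 = selection (shiftPos D r 0) := shiftSelection_eq D r 0

theorem shiftSelection_one (D : Fin R → ℕ) (r : Fin R) :
    shiftSelection D r 1 = selection (shiftPos D r 1) := shiftSelection_eq D r 1

theorem planeWave_shiftPos (D : Fin R → ℕ) (r : Fin R) (θ μ : Fin R → ℝ)
    (i : Grid (shiftSize D r)) : planeWave θ μ (shiftPos D r 1 i) =
      Complex.exp (Complex.I * μ r) * planeWave θ μ (shiftPos D r 0 i) := by
  have h : Complex.exp (Complex.I * μ r) =
      ∏ p, Complex.exp (if p = r then Complex.I * μ p else 0) := by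
    rw [← Complex.exp_sum, Finset.sum_ite_eq' Finset.univ r]
    simp
  rw [h, planeWave, planeWave, ← Finset.prod_mul_distrib]
  refine Finset.prod_congr rfl fun p _ => ?_
  rw [← Complex.exp_add]
  congr 1
  simp only [shiftPos]
  split_ifs
  · push_cast
    simp
    ring
  · simp

theorem smooth_apply {lam κ κ' ν : Type*} [Fintype κ] [DecidableEq κ] (f : lam → κ' → κ)
    (X : Matrix κ ν ℂ) (k : κ') (q : lam × ν) :
    smooth (fun ℓ => selection (f ℓ)) X k q = X (f q.1 k) q.2 := by
  simp only [smooth, of_apply, selection_mul]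

theorem one_kronecker_selection {κ κ' : Type*} [DecidableEq κ] (f : κ' → κ) :
    (1 : Matrix (Fin 2) (Fin 2) ℂ) ⊗ₖ selection f = selection (Prod.map id f) := by
  ext i j
  simp only [kroneckerMap_apply, selection, of_apply, one_apply, Prod.ext_iff, Prod.map_fst,
    Prod.map_snd, id, eq_comm (a := i.1)]
  by_cases h1 : j.1 = i.1 <;> by_cases h2 : j.2 = f i.2 <;> simp [h1, h2]

theorem ncAugment_apply {κ ν : Type*} [Fintype κ] [DecidableEq κ] [ExchangeIndex κ]
    (X : Matrix κ ν ℂ) (i : Fin 2 × κ) (n : ν) :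
    ncAugment X i n = if i.1 = 0 then X i.2 n else star (X (ExchangeIndex.rev i.2) n) := by
  simp only [ncAugment, of_apply]
  rw [exchange_eq_selection, selection_mul]
  rfl

end Grids

/-! ### The common first-order error of the four algorithms -/

section FirstOrder

variable {R N : ℕ} {M L : Fin R → ℕ}

/-- Phase error of the noise `E` at the grid point `m`, for the signal `a sᵀ`. -/
noncomputable def pointError (a : Grid M → ℂ) (s : Fin N → ℂ) (m : Grid M) :
    Matrix (Grid M) (Fin N) ℂ →ₗ[ℝ] ℝ where
  toFun E := ∑ n, (star (a m * s n) * E m n).im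
  map_add' E E' := by
    simp only [Matrix.add_apply, mul_add, Complex.add_im, Finset.sum_add_distrib]
  map_smul' t E := by
    simp only [Matrix.smul_apply, RingHom.id_apply, smul_eq_mul, Finset.mul_sum]
    refine Finset.sum_congr rfl fun n _ => ?_
    rw [Complex.real_smul, mul_left_comm, Complex.im_ofReal_mul]

/-- The first-order estimation error in mode `r`. -/
noncomputable def firstOrderError (hL : ∀ p, 1 ≤ L p ∧ L p ≤ M p) (r : Fin R) (a : Grid M → ℂ)
    (s : Fin N → ℂ) : Matrix (Grid M) (Fin N) ℂ →ₗ[ℝ] ℝ :=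
  ((Fintype.card (Grid (shiftSize (subSize M L) r)) : ℝ) *
      (Fintype.card (Grid L) * ∑ n, ‖s n‖ ^ 2))⁻¹ •
    ∑ i, ∑ ℓ : Grid L, (pointError a s (subarrayPos hL (shiftPos (subSize M L) r 1 i) ℓ) -
      pointError a s (subarrayPos hL (shiftPos (subSize M L) r 0 i) ℓ))

/-- The right factor of the smoothed noise-free data. -/
noncomputable def smoothedSymbols (L : Fin R → ℕ) (μ : Fin R → ℝ) (s : Fin N → ℂ) :
    Grid L × Fin N → ℂ :=
  fun q => planeWave 0 μ q.1 * s q.2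

theorem smoothedSymbols_ne_zero (hL : ∀ p, 1 ≤ L p ∧ L p ≤ M p) (μ : Fin R → ℝ)
    {s : Fin N → ℂ} (hs : s ≠ 0) : smoothedSymbols L μ s ≠ 0 := by
  intro h
  apply hs
  ext n
  have h1 := congrFun h (fun p => ⟨0, (hL p).1⟩, n)
  simp only [smoothedSymbols, Pi.zero_apply, mul_eq_zero] at h1
  rcases h1 with h1 | h1
  · have := norm_planeWave 0 μ (fun p => (⟨0, (hL p).1⟩ : Fin (L p)))
    rw [h1] at this
    simp at this
  · exact h1

variable {r : Fin R} {θ μ : Fin R → ℝ} {s : Fin N → ℂ}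

theorem star_smoothedSymbols_dotProduct :
    star (smoothedSymbols L μ s) ⬝ᵥ smoothedSymbols L μ s =
      ((Fintype.card (Grid L) * ∑ n, ‖s n‖ ^ 2 : ℝ) : ℂ) := by
  rw [star_dotProduct_self_eq]
  congr 1
  rw [Fintype.sum_prod_type]
  simp only [smoothedSymbols, norm_mul, norm_planeWave, one_mul, Finset.sum_const,
    Finset.card_univ, nsmul_eq_mul]

theorem smooth_subarraySelection (hL : ∀ p, 1 ≤ L p ∧ L p ≤ M p) (E : Matrix (Grid M) (Fin N) ℂ)
    (k : Grid (subSize M L)) (q : Grid L × Fin N) :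
    smooth (subarraySelection M L) E k q = E (subarrayPos hL k q.1) q.2 := by
  have hsel : subarraySelection M L = fun ℓ => selection fun k => subarrayPos hL k ℓ :=
    funext (subarraySelection_eq hL)
  rw [hsel, smooth_apply]

theorem smooth_noiseFree_add (hL : ∀ p, 1 ≤ L p ∧ L p ≤ M p)
    (δ : Fin R → ℝ) (E : Matrix (Grid M) (Fin N) ℂ) :
    smooth (subarraySelection M L) (noiseFree M δ μ s + E) =
      vecMulVec (planeWave (fun p => -((M p : ℝ) - 1) / 2 + δ p) μ) (smoothedSymbols L μ s) +
        smooth (subarraySelection M L) E := by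
  ext k q
  rw [Matrix.add_apply, smooth_subarraySelection hL, smooth_subarraySelection hL, Matrix.add_apply,
    noiseFree, vecMulVec_apply, vecMulVec_apply, steering_eq_planeWave, planeWave_subarrayPos, smoothedSymbols, mul_assoc]

/-- Phase error of the smoothed perturbation. -/
theorem im_star_mul_smooth (hL : ∀ p, 1 ≤ L p ∧ L p ≤ M p)
    (E : Matrix (Grid M) (Fin N) ℂ) (k : Grid (subSize M L)) :
    (star (planeWave θ μ k) *
      ((star (smoothedSymbols L μ s) ⬝ᵥ smoothedSymbols L μ s)⁻¹ •
        smooth (subarraySelection M L) E *ᵥ star (smoothedSymbols L μ s)) k).im =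
      (Fintype.card (Grid L) * ∑ n, ‖s n‖ ^ 2 : ℝ)⁻¹ *
        ∑ ℓ, pointError (planeWave θ μ) s (subarrayPos hL k ℓ) E := by
  rw [star_smoothedSymbols_dotProduct, Pi.smul_apply, smul_eq_mul, mul_left_comm,
    ← Complex.ofReal_inv, Complex.im_ofReal_mul]
  congr 1
  rw [mulVec, dotProduct, Finset.mul_sum, Complex.im_sum, Fintype.sum_prod_type]
  refine Finset.sum_congr rfl fun ℓ _ => ?_
  refine Finset.sum_congr rfl fun n _ => ?_
  rw [smooth_subarraySelection hL, planeWave_subarrayPos, Pi.star_apply, smoothedSymbols]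
  congr 1
  simp only [star_mul']
  ring

theorem phaseError_smooth (hL : ∀ p, 1 ≤ L p ∧ L p ≤ M p)
    (E : Matrix (Grid M) (Fin N) ℂ) :
    phaseError (shiftPos (subSize M L) r 0) (shiftPos (subSize M L) r 1) (planeWave θ μ)
      ((star (smoothedSymbols L μ s) ⬝ᵥ smoothedSymbols L μ s)⁻¹ •
        smooth (subarraySelection M L) E *ᵥ star (smoothedSymbols L μ s)) =
      firstOrderError hL r (planeWave θ μ) s E := by
  simp only [phaseError, im_star_mul_smooth hL, firstOrderError, LinearMap.smul_apply,
    LinearMap.sum_apply, LinearMap.sub_apply, smul_eq_mul, Finset.sum_sub_distrib,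
    ← Finset.mul_sum, ← mul_sub, mul_inv, mul_assoc]

theorem isBigO_smooth (hL : ∀ p, 1 ≤ L p ∧ L p ≤ M p)
    {l : Filter (Matrix (Grid M) (Fin N) ℂ × ℝ)} (k : Grid (subSize M L))
    (q : Grid L × Fin N) :
    (fun x : Matrix (Grid M) (Fin N) ℂ × ℝ => smooth (subarraySelection M L) x.1 k q) =O[l]
      fun x => frob x.1 := by
  simp only [smooth_subarraySelection hL]
  exact isBigO_frob _ _

theorem nonempty_grid_shiftSize (hr : L r < M r) :
    Nonempty (Grid (shiftSize (subSize M L) r)) := by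
  refine ⟨fun p => ⟨0, ?_⟩⟩
  by_cases hp : p = r
  · subst hp
    simp only [shiftSize, Function.update_self, subSize]
    omega
  · simp only [shiftSize, Function.update_of_ne hp, subSize]
    omega

theorem rev_smoothed_involutive :
    Function.Involutive (ExchangeIndex.rev : Grid L × Fin N → Grid L × Fin N) :=
  rev_prod_involutive (rev_grid_involutive L) (rev_fin_involutive N)

theorem isFirstOrderError_smoothedStandard (hL : ∀ p, 1 ≤ L p ∧ L p ≤ M p)
    (hr : L r < M r) (δ : Fin R → ℝ)
    (hμ : |μ r| < Real.pi) (hs : s ≠ 0) :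
    IsFirstOrderError (SmoothedStandard M L r) (noiseFree M δ μ s) (μ r)
      (firstOrderError hL r (steering M δ μ) s) := by
  have hne := nonempty_grid_shiftSize hr
  have hne' : Nonempty (Grid (subSize M L)) := hne.map (shiftPos _ r 0)
  refine isFirstOrderError_of_isBigO (fun Y => exists_isStandardEspritEstimate _ _ _) ?_
  have hm := eventually_estimateFilter (SmoothedStandard M L r) (noiseFree M δ μ s)
  simp only [SmoothedStandard] at hm
  simp only [smooth_noiseFree_add hL, shiftSelection_zero, shiftSelection_one] at hm
  have h := standard_sub_isBigO (tendsto_frob_estimateFilter _ _) hμ (norm_planeWave _ μ)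
    (smoothedSymbols_ne_zero hL μ hs) (planeWave_shiftPos (subSize M L) r _ μ)
    (isBigO_smooth hL) hm
  simp only [phaseError_smooth hL] at h
  rw [steering_eq_planeWave]
  exact h

theorem isFirstOrderError_smoothedUnitary (hL : ∀ p, 1 ≤ L p ∧ L p ≤ M p)
    (hr : L r < M r) (δ : Fin R → ℝ)
    (hμ : |μ r| < Real.pi) (hs : s ≠ 0) :
    IsFirstOrderError (SmoothedUnitary M L r) (noiseFree M δ μ s) (μ r)
      (firstOrderError hL r (steering M δ μ) s) := by
  have hne := nonempty_grid_shiftSize hr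
  have hne' : Nonempty (Grid (subSize M L)) := hne.map (shiftPos _ r 0)
  refine isFirstOrderError_of_isBigO (fun Y => exists_isUnitaryEspritEstimate
    (rev_grid_involutive _) (rev_grid_involutive _) rev_smoothed_involutive _ _) ?_
  have hm := eventually_estimateFilter (SmoothedUnitary M L r) (noiseFree M δ μ s)
  simp only [SmoothedUnitary] at hm
  simp only [smooth_noiseFree_add hL, shiftSelection_one] at hm
  obtain ⟨ω, hω⟩ := exists_star_planeWave_rev (subSize M L)
    (fun p => -((M p : ℝ) - 1) / 2 + δ p) μ
  have h := unitary_sub_isBigO (tendsto_frob_estimateFilter _ _) (rev_grid_involutive _)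
    (rev_grid_involutive _) rev_smoothed_involutive (rev_shiftPos_rev (subSize M L) r) hμ
    (norm_planeWave _ μ) (smoothedSymbols_ne_zero hL μ hs) hω
    (planeWave_shiftPos (subSize M L) r _ μ) (isBigO_smooth hL) hm
  simp only [phaseError_smooth hL] at h
  rw [steering_eq_planeWave]
  exact h

end FirstOrder

/-! ### The algorithms for strictly non-circular sources -/

section NonCircular

variable {R N : ℕ} {M L : Fin R → ℕ} {r : Fin R} {θ μ : Fin R → ℝ} {s : Fin N → ℂ}

theorem ncSmooth_apply (hL : ∀ p, 1 ≤ L p ∧ L p ≤ M p) (X : Matrix (Grid M) (Fin N) ℂ)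
    (i : Fin 2 × Grid (subSize M L)) (q : Grid L × Fin N) :
    ncSmooth M L X i q = if i.1 = 0 then X (subarrayPos hL i.2 q.1) q.2 else
      star (X (ExchangeIndex.rev (subarrayPos hL i.2 q.1) : Grid M) q.2) := by
  have hsel : (fun ℓ => (1 : Matrix (Fin 2) (Fin 2) ℂ) ⊗ₖ subarraySelection M L ℓ) =
      fun ℓ => selection (Prod.map id fun k => subarrayPos hL k ℓ) := by
    funext ℓ
    rw [subarraySelection_eq hL, one_kronecker_selection]
  rw [ncSmooth, hsel, smooth_apply, ncAugment_apply]
  rfl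

/-- The constant is `exp (-2 j φ)`. It makes the conjugated data a multiple of the same row vector,
so augmentation keeps rank one. -/
theorem IsStrictlyNonCircular.exists_star_eq (h : IsStrictlyNonCircular s) :
    ∃ η : ℂ, ‖η‖ = 1 ∧ ∀ n, star (s n) = η * s n := by
  obtain ⟨φ, s₀, hs⟩ := h
  have hn : ‖Complex.exp (Complex.I * φ)‖ = 1 := by
    rw [mul_comm]; exact Complex.norm_exp_ofReal_mul_I φ
  refine ⟨star (Complex.exp (Complex.I * φ)) * star (Complex.exp (Complex.I * φ)), ?_, fun n => ?_⟩
  · rw [norm_mul, norm_star, hn, one_mul]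
  · have h1 := star_mul_self_of_norm_one hn
    have h2 : star (s₀ n : ℂ) = s₀ n := by simp
    rw [hs n, star_mul', h2]
    linear_combination (-star (Complex.exp (Complex.I * φ)) * s₀ n) * h1

/-- The left factor of the augmented noise-free data. -/
noncomputable def augmentedWave (D : Fin R → ℕ) (θ μ : Fin R → ℝ) (ξ : ℂ) (i : Fin 2 × Grid D) :
    ℂ :=
  if i.1 = 0 then planeWave θ μ i.2 else ξ * planeWave θ μ i.2

theorem norm_augmentedWave {D : Fin R → ℕ} {ξ : ℂ} (hξ : ‖ξ‖ = 1) (i : Fin 2 × Grid D) :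
    ‖augmentedWave D θ μ ξ i‖ = 1 := by
  unfold augmentedWave
  split_ifs <;> simp [norm_planeWave, hξ]

theorem exists_star_augmentedWave_rev {D : Fin R → ℕ} {ξ : ℂ} (hξ : ‖ξ‖ = 1) :
    ∃ ω : ℂ, ∀ i : Fin 2 × Grid D,
      star (augmentedWave D θ μ ξ (ExchangeIndex.rev i : Fin 2 × Grid D)) =
        ω * augmentedWave D θ μ ξ i := by
  obtain ⟨ω, hω⟩ := exists_star_planeWave_rev D θ μ
  refine ⟨star ξ * ω, fun i => ?_⟩
  have h1 : star (augmentedWave D θ μ ξ (ExchangeIndex.rev i : Fin 2 × Grid D)) =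
      star (if (ExchangeIndex.rev i.1 : Fin 2) = 0 then
        planeWave θ μ (ExchangeIndex.rev i.2 : Grid D) else
        ξ * planeWave θ μ (ExchangeIndex.rev i.2 : Grid D)) := rfl
  have hξ' := star_mul_self_of_norm_one hξ
  rw [h1]
  by_cases h : i.1 = 0
  · simp only [augmentedWave, rev_fin_two_eq_zero_iff, h, not_true, if_false, if_true, star_mul',
      hω]
    ring
  · simp only [augmentedWave, rev_fin_two_eq_zero_iff, h, not_false_iff, if_false, if_true, hω]
    linear_combination (-ω * planeWave θ μ i.2) * hξ'

theorem augmentedWave_shiftPos (D : Fin R → ℕ) (r : Fin R) (ξ : ℂ)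
    (i : Fin 2 × Grid (shiftSize D r)) :
    augmentedWave D θ μ ξ (Prod.map id (shiftPos D r 1) i) =
      Complex.exp (Complex.I * μ r) * augmentedWave D θ μ ξ (Prod.map id (shiftPos D r 0) i) := by
  simp only [augmentedWave, Prod.map_fst, Prod.map_snd, id, planeWave_shiftPos]
  split_ifs
  · rfl
  · ring

theorem ncSmooth_noiseFree_add (hL : ∀ p, 1 ≤ L p ∧ L p ≤ M p) {ω η : ℂ}
    (hω : ∀ m : Grid M, star (planeWave θ μ (ExchangeIndex.rev m : Grid M)) = ω * planeWave θ μ m)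
    (hη : ∀ n, star (s n) = η * s n) (E : Matrix (Grid M) (Fin N) ℂ) :
    ncSmooth M L (vecMulVec (planeWave θ μ) s + E) =
      vecMulVec (augmentedWave (subSize M L) θ μ (ω * η)) (smoothedSymbols L μ s) +
        ncSmooth M L E := by
  ext i q
  rw [Matrix.add_apply, ncSmooth_apply hL, ncSmooth_apply hL, Matrix.add_apply, Matrix.add_apply,
    vecMulVec_apply, vecMulVec_apply, vecMulVec_apply, augmentedWave, smoothedSymbols]
  split_ifs
  · rw [planeWave_subarrayPos]
    ring
  · rw [star_add, star_mul', hω, hη, planeWave_subarrayPos]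
    ring

theorem im_star_mul_ncSmooth (hL : ∀ p, 1 ≤ L p ∧ L p ≤ M p) {ω η : ℂ}
    (hω : ∀ m : Grid M, star (planeWave θ μ (ExchangeIndex.rev m : Grid M)) = ω * planeWave θ μ m)
    (hη : ∀ n, star (s n) = η * s n) (E : Matrix (Grid M) (Fin N) ℂ)
    (i : Fin 2 × Grid (subSize M L)) :
    (star (augmentedWave (subSize M L) θ μ (ω * η) i) *
      ((star (smoothedSymbols L μ s) ⬝ᵥ smoothedSymbols L μ s)⁻¹ •
        ncSmooth M L E *ᵥ star (smoothedSymbols L μ s)) i).im =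
      (Fintype.card (Grid L) * ∑ n, ‖s n‖ ^ 2 : ℝ)⁻¹ *
        if i.1 = 0 then ∑ ℓ, pointError (planeWave θ μ) s (subarrayPos hL i.2 ℓ) E
        else -∑ ℓ, pointError (planeWave θ μ) s
          (subarrayPos hL (ExchangeIndex.rev i.2 : Grid (subSize M L)) ℓ) E := by
  rw [star_smoothedSymbols_dotProduct, Pi.smul_apply, smul_eq_mul, mul_left_comm,
    ← Complex.ofReal_inv, Complex.im_ofReal_mul]
  congr 1
  rw [mulVec, dotProduct, Finset.mul_sum, Complex.im_sum, Fintype.sum_prod_type]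
  simp only [ncSmooth_apply hL, augmentedWave]
  split_ifs
  · refine Finset.sum_congr rfl fun ℓ _ => ?_
    refine Finset.sum_congr rfl fun n _ => ?_
    rw [planeWave_subarrayPos, Pi.star_apply, smoothedSymbols]
    congr 1
    simp only [star_mul']
    ring
  -- In the lower block the noise is reversed on the whole array. Reversing `ℓ` as well turns this
  -- into a reversal inside the subarray, and the conjugation gives the minus sign.
  · have hsum : ∑ ℓ, pointError (planeWave θ μ) s
          (subarrayPos hL (ExchangeIndex.rev i.2 : Grid (subSize M L)) ℓ) E =
        ∑ ℓ, pointError (planeWave θ μ) s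
          (ExchangeIndex.rev (subarrayPos hL i.2 ℓ) : Grid M) E := by
      rw [← Equiv.sum_comp (rev_grid_involutive L).toPerm]
      refine Finset.sum_congr rfl fun ℓ _ => ?_
      rw [rev_subarrayPos]
      rfl
    rw [hsum, ← Finset.sum_neg_distrib]
    refine Finset.sum_congr rfl fun ℓ _ => ?_
    simp only [pointError, LinearMap.coe_mk, AddHom.coe_mk]
    rw [← Finset.sum_neg_distrib]
    refine Finset.sum_congr rfl fun n _ => ?_
    rw [← Complex.conj_im, ← Complex.star_def, Pi.star_apply, smoothedSymbols]
    congr 1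
    rw [star_mul' (planeWave θ μ (ExchangeIndex.rev (subarrayPos hL i.2 ℓ) : Grid M)), hω, hη,
      planeWave_subarrayPos]
    simp only [star_mul']
    ring

/-- Under reversal the two shifted parts change places, which compensates the sign in the lower
block. Both blocks contribute the same sum, and the number of shift pairs doubles. -/
theorem phaseError_ncSmooth (hL : ∀ p, 1 ≤ L p ∧ L p ≤ M p) {ω η : ℂ}
    (hω : ∀ m : Grid M, star (planeWave θ μ (ExchangeIndex.rev m : Grid M)) = ω * planeWave θ μ m)
    (hη : ∀ n, star (s n) = η * s n) (E : Matrix (Grid M) (Fin N) ℂ) :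
    phaseError (Prod.map id (shiftPos (subSize M L) r 0)) (Prod.map id (shiftPos (subSize M L) r 1))
      (augmentedWave (subSize M L) θ μ (ω * η))
      ((star (smoothedSymbols L μ s) ⬝ᵥ smoothedSymbols L μ s)⁻¹ •
        ncSmooth M L E *ᵥ star (smoothedSymbols L μ s)) =
      firstOrderError hL r (planeWave θ μ) s E := by
  have hinv := rev_grid_involutive (shiftSize (subSize M L) r)
  have hsum : ∀ p : Grid (shiftSize (subSize M L) r) → ℝ,
      ∑ i, p (ExchangeIndex.rev i : Grid (shiftSize (subSize M L) r)) = ∑ i, p i := fun p =>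
    Equiv.sum_comp hinv.toPerm p
  have h1 : ∀ i : Grid (shiftSize (subSize M L) r),
      (ExchangeIndex.rev (shiftPos (subSize M L) r 1 i) : Grid (subSize M L)) =
        shiftPos (subSize M L) r 0 (ExchangeIndex.rev i : Grid (shiftSize (subSize M L) r)) :=
    fun i => by rw [← rev_shiftPos_rev, hinv i]
  have h0 : ∀ i : Grid (shiftSize (subSize M L) r),
      (ExchangeIndex.rev (shiftPos (subSize M L) r 0 i) : Grid (subSize M L)) =
        shiftPos (subSize M L) r 1 (ExchangeIndex.rev i : Grid (shiftSize (subSize M L) r)) :=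
    fun i => by rw [← rev_shiftPos_rev, rev_grid_involutive (subSize M L)]
  simp only [phaseError, im_star_mul_ncSmooth hL hω hη, firstOrderError, LinearMap.smul_apply,
    LinearMap.sum_apply, LinearMap.sub_apply, smul_eq_mul, Fintype.sum_prod_type,
    Fin.sum_univ_two, Prod.map_fst, Prod.map_snd, id, if_true, Fin.one_eq_zero_iff,
    OfNat.ofNat_ne_one, if_false, h1, h0, Fintype.card_prod, Fintype.card_fin]
  have e1 := hsum fun i => ∑ ℓ, pointError (planeWave θ μ) s
    (subarrayPos hL (shiftPos (subSize M L) r 1 i) ℓ) E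
  have e0 := hsum fun i => ∑ ℓ, pointError (planeWave θ μ) s
    (subarrayPos hL (shiftPos (subSize M L) r 0 i) ℓ) E
  simp only [Finset.sum_sub_distrib, ← Finset.mul_sum, Finset.sum_neg_distrib, e0, e1]
  push_cast
  rw [mul_inv, mul_inv]
  ring

theorem isBigO_ncSmooth (hL : ∀ p, 1 ≤ L p ∧ L p ≤ M p)
    {l : Filter (Matrix (Grid M) (Fin N) ℂ × ℝ)} (i : Fin 2 × Grid (subSize M L))
    (q : Grid L × Fin N) :
    (fun x : Matrix (Grid M) (Fin N) ℂ × ℝ => ncSmooth M L x.1 i q) =O[l] fun x => frob x.1 := by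
  simp only [ncSmooth_apply hL]
  split_ifs
  · exact isBigO_frob _ _
  · exact isBigO_star (isBigO_frob _ _)

theorem norm_eq_one_of_star_rev (hM : ∀ p, 1 ≤ M p) {ω : ℂ}
    (hω : ∀ m : Grid M, star (planeWave θ μ (ExchangeIndex.rev m : Grid M)) = ω * planeWave θ μ m) :
    ‖ω‖ = 1 := by
  have h := congrArg norm (hω fun p => ⟨0, hM p⟩)
  rwa [norm_star, norm_mul, norm_planeWave, norm_planeWave, mul_one, eq_comm] at h

theorem isFirstOrderError_smoothedNCStandard (hL : ∀ p, 1 ≤ L p ∧ L p ≤ M p) (hr : L r < M r)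
    (δ : Fin R → ℝ) (hμ : |μ r| < Real.pi) (hs : s ≠ 0) (hnc : IsStrictlyNonCircular s) :
    IsFirstOrderError (SmoothedNCStandard M L r) (noiseFree M δ μ s) (μ r)
      (firstOrderError hL r (steering M δ μ) s) := by
  have hne := nonempty_grid_shiftSize hr
  have hne' : Nonempty (Grid (subSize M L)) := hne.map (shiftPos _ r 0)
  obtain ⟨η, hη1, hη⟩ := hnc.exists_star_eq
  obtain ⟨ω, hω⟩ := exists_star_planeWave_rev M (fun p => -((M p : ℝ) - 1) / 2 + δ p) μ
  have hξ : ‖ω * η‖ = 1 := by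
    rw [norm_mul, hη1, norm_eq_one_of_star_rev (fun p => (hL p).1.trans (hL p).2) hω, one_mul]
  refine isFirstOrderError_of_isBigO (fun Y => exists_isStandardEspritEstimate _ _ _) ?_
  have hm := eventually_estimateFilter (SmoothedNCStandard M L r) (noiseFree M δ μ s)
  simp only [SmoothedNCStandard] at hm
  simp only [noiseFree, steering_eq_planeWave, ncSmooth_noiseFree_add hL hω hη,
    shiftSelection_zero, shiftSelection_one, one_kronecker_selection] at hm
  have h := standard_sub_isBigO (tendsto_frob_estimateFilter _ _) hμ (norm_augmentedWave hξ)
    (smoothedSymbols_ne_zero hL μ hs) (augmentedWave_shiftPos (subSize M L) r _)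
    (isBigO_ncSmooth hL) hm
  simp only [phaseError_ncSmooth hL hω hη] at h
  rw [noiseFree, steering_eq_planeWave]
  exact h

theorem isFirstOrderError_smoothedNCUnitary (hL : ∀ p, 1 ≤ L p ∧ L p ≤ M p) (hr : L r < M r)
    (δ : Fin R → ℝ) (hμ : |μ r| < Real.pi) (hs : s ≠ 0) (hnc : IsStrictlyNonCircular s) :
    IsFirstOrderError (SmoothedNCUnitary M L r) (noiseFree M δ μ s) (μ r)
      (firstOrderError hL r (steering M δ μ) s) := by
  have hne := nonempty_grid_shiftSize hr
  have hne' : Nonempty (Grid (subSize M L)) := hne.map (shiftPos _ r 0)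
  obtain ⟨η, hη1, hη⟩ := hnc.exists_star_eq
  obtain ⟨ω, hω⟩ := exists_star_planeWave_rev M (fun p => -((M p : ℝ) - 1) / 2 + δ p) μ
  have hξ : ‖ω * η‖ = 1 := by
    rw [norm_mul, hη1, norm_eq_one_of_star_rev (fun p => (hL p).1.trans (hL p).2) hω, one_mul]
  have hκ := rev_prod_involutive rev_fin_two_involutive (rev_grid_involutive (subSize M L))
  have hκ' := rev_prod_involutive rev_fin_two_involutive
    (rev_grid_involutive (shiftSize (subSize M L) r))
  refine isFirstOrderError_of_isBigO (fun Y => exists_isUnitaryEspritEstimate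
    hκ hκ' rev_smoothed_involutive _ _) ?_
  have hm := eventually_estimateFilter (SmoothedNCUnitary M L r) (noiseFree M δ μ s)
  simp only [SmoothedNCUnitary] at hm
  simp only [noiseFree, steering_eq_planeWave, ncSmooth_noiseFree_add hL hω hη,
    shiftSelection_one, one_kronecker_selection] at hm
  obtain ⟨ω', hω'⟩ := exists_star_augmentedWave_rev (D := subSize M L)
    (θ := fun p => -((M p : ℝ) - 1) / 2 + δ p) (μ := μ) hξ
  have hff : ∀ i : Fin 2 × Grid (shiftSize (subSize M L) r),
      (ExchangeIndex.rev (Prod.map id (shiftPos (subSize M L) r 1) (ExchangeIndex.rev i)) :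
        Fin 2 × Grid (subSize M L)) = Prod.map id (shiftPos (subSize M L) r 0) i := fun i =>
    Prod.ext (rev_fin_two_involutive i.1) (rev_shiftPos_rev (subSize M L) r i.2)
  have h := unitary_sub_isBigO (tendsto_frob_estimateFilter _ _) hκ hκ' rev_smoothed_involutive
    hff hμ (norm_augmentedWave hξ) (smoothedSymbols_ne_zero hL μ hs) hω'
    (augmentedWave_shiftPos (subSize M L) r _) (isBigO_ncSmooth hL) hm
  simp only [phaseError_ncSmooth hL hω hη] at h
  rw [noiseFree, steering_eq_planeWave]
  exact h

end NonCircular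

/-! ### Counting the subarray elements that cover a grid point -/

/-- The number of `(i, ℓ)` with `i < A`, `ℓ < B` and `i + e + ℓ = x`. -/
noncomputable def coverCount (A B e x : ℕ) : ℝ :=
  ∑ i ∈ Finset.range A, ∑ ℓ ∈ Finset.range B, if i + e + ℓ = x then 1 else 0

theorem sum_range_ite_add_eq (a B x : ℕ) :
    (∑ ℓ ∈ Finset.range B, if a + ℓ = x then (1 : ℝ) else 0) =
      if a ≤ x ∧ x < a + B then 1 else 0 := by
  by_cases h : a ≤ x
  · have h' : ∀ ℓ, a + ℓ = x ↔ ℓ = x - a := fun ℓ => by omega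
    simp only [h', Finset.sum_ite_eq', Finset.mem_range]
    congr 1
    exact propext (by omega)
  · rw [if_neg (by omega)]
    exact Finset.sum_eq_zero fun ℓ _ => if_neg (by omega)

/-- For fixed `ℓ` the sum over `i` telescopes to its boundary terms at `K` and `0`. The bound on `x`
makes the upper end of the first indicator automatic. -/
theorem coverCount_sub (K B : ℕ) {x : ℕ} (hx : x < K + B) :
    coverCount K B 1 x - coverCount K B 0 x =
      (if K ≤ x then 1 else 0) - if x < B then 1 else 0 := by
  have h : ∀ ℓ, ∑ i ∈ Finset.range K, ((if i + 1 + ℓ = x then (1 : ℝ) else 0) -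
      if i + ℓ = x then 1 else 0) = (if K + ℓ = x then 1 else 0) - if 0 + ℓ = x then 1 else 0 :=
    fun ℓ => Finset.sum_range_sub (fun i => if i + ℓ = x then (1 : ℝ) else 0) K
  rw [coverCount, coverCount, Finset.sum_comm, Finset.sum_comm (s := Finset.range K),
    ← Finset.sum_sub_distrib]
  simp only [← Finset.sum_sub_distrib, add_zero, h]
  rw [Finset.sum_sub_distrib, sum_range_ite_add_eq, sum_range_ite_add_eq]
  simp [hx]

/-- Each indicator is one at `B` positions, and the two cancel on `[K, B)`, so `2 B - 2 max (B - K,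
0)` remains. -/
theorem sum_coverCount_sub_sq (K B : ℕ) :
    ∑ x ∈ Finset.range (K + B), (coverCount K B 1 x - coverCount K B 0 x) ^ 2 =
      2 * min (B : ℝ) K := by
  have h : ∀ x ∈ Finset.range (K + B), (coverCount K B 1 x - coverCount K B 0 x) ^ 2 =
      (if K ≤ x then (1 : ℝ) else 0) + (if x < B then 1 else 0) -
        2 * if K ≤ x ∧ x < B then 1 else 0 := by
    intro x hx
    rw [coverCount_sub K B (Finset.mem_range.mp hx)]
    by_cases h1 : K ≤ x <;> by_cases h2 : x < B <;> (simp [h1, h2]; try norm_num)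
  rw [Finset.sum_congr rfl h, Finset.sum_sub_distrib, Finset.sum_add_distrib, ← Finset.mul_sum,
    Finset.sum_boole, Finset.sum_boole, Finset.sum_boole]
  have e1 : (Finset.range (K + B)).filter (K ≤ ·) = Finset.Ico K (K + B) := by
    ext x; simp; omega
  have e2 : (Finset.range (K + B)).filter (· < B) = Finset.range B := by
    ext x; simp; omega
  have e3 : (Finset.range (K + B)).filter (fun x => K ≤ x ∧ x < B) = Finset.Ico K B := by
    ext x; simp; omega
  rw [e1, e2, e3, Nat.card_Ico, Nat.card_Ico, Finset.card_range, Nat.add_sub_cancel_left]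
  rcases le_total B K with h | h
  · rw [Nat.sub_eq_zero_of_le h, min_eq_left (by exact_mod_cast h)]
    push_cast; ring
  · rw [Nat.cast_sub h, min_eq_right (by exact_mod_cast h)]
    ring

theorem coverCount_comm (A B x : ℕ) : coverCount A B 0 x = coverCount B A 0 x := by
  rw [coverCount, coverCount, Finset.sum_comm]
  simp only [add_zero, add_comm]

/-- The summand is the overlap `A - |a - b|` of two intervals of length `A` starting at `a` and `b`;
the sum of `|a - b|` is `B (B² - 1) / 3`. Because `B ≤ A`, the subtraction is never truncated. -/
theorem sum_sum_overlap (A B : ℕ) (h : B ≤ A) :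
    ∑ a ∈ Finset.range B, ∑ b ∈ Finset.range B, ((min a b + A - max a b : ℕ) : ℝ) =
      A * B ^ 2 - B * ((B : ℝ) ^ 2 - 1) / 3 := by
  induction B with
  | zero => simp
  | succ B ih =>
    have hg : ∑ a ∈ Finset.range B, ((a + A - B : ℕ) : ℝ) = B * (B - 1) / 2 + B * (A - B) := by
      have h1 : ∀ a ∈ Finset.range B, ((a + A - B : ℕ) : ℝ) = a + (A - B) := fun a _ => by
        rw [Nat.cast_sub (by omega)]; push_cast; ring
      rw [Finset.sum_congr rfl h1, Finset.sum_add_distrib, Finset.sum_const, Finset.card_range,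
        nsmul_eq_mul]
      have h2 : ∀ n : ℕ, ∑ a ∈ Finset.range n, (a : ℝ) = n * (n - 1) / 2 := by
        intro n
        induction n with
        | zero => simp
        | succ n ihn => rw [Finset.sum_range_succ, ihn]; push_cast; ring
      rw [h2]
    have h3 : ∑ a ∈ Finset.range B, ((min a B + A - max a B : ℕ) : ℝ) =
        ∑ a ∈ Finset.range B, ((a + A - B : ℕ) : ℝ) := Finset.sum_congr rfl fun a ha => by
      have := Finset.mem_range.mp ha
      rw [min_eq_left this.le, max_eq_right this.le]
    have h4 : ∑ b ∈ Finset.range B, ((min B b + A - max B b : ℕ) : ℝ) =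
        ∑ a ∈ Finset.range B, ((a + A - B : ℕ) : ℝ) := by
      simp only [min_comm B, max_comm B]
      exact h3
    rw [Finset.sum_range_succ]
    simp only [Finset.sum_range_succ (n := B)]
    rw [Finset.sum_add_distrib, ih (by omega), h3, h4, hg]
    simp only [min_self, max_self, Nat.add_sub_cancel_left]
    push_cast
    ring

/-- The count is a sum of indicators of the `B` intervals `[a, a + A)`, so the sum of its squares is
the sum of all pairwise overlaps. -/
theorem sum_coverCount_sq_of_le {A B : ℕ} (h : B ≤ A) :
    ∑ x ∈ Finset.range (A + B - 1), coverCount A B 0 x ^ 2 =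
      A * B ^ 2 - B * ((B : ℝ) ^ 2 - 1) / 3 := by
  rw [← sum_sum_overlap A B h]
  have h1 : ∀ x, coverCount A B 0 x =
      ∑ a ∈ Finset.range B, if a ≤ x ∧ x < a + A then 1 else 0 := fun x => by
    rw [coverCount_comm, coverCount]
    simp only [add_zero, sum_range_ite_add_eq]
  simp only [h1, pow_two, Finset.sum_mul_sum]
  rw [Finset.sum_comm]
  refine Finset.sum_congr rfl fun a ha => ?_
  rw [Finset.sum_comm]
  refine Finset.sum_congr rfl fun b hb => ?_
  have h2 : ∀ x, ((if a ≤ x ∧ x < a + A then (1 : ℝ) else 0) *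
      if b ≤ x ∧ x < b + A then 1 else 0) =
      if max a b ≤ x ∧ x < min a b + A then 1 else 0 := fun x => by
    rw [ite_zero_mul_ite_zero, one_mul]
    congr 1
    exact propext (by omega)
  simp only [h2]
  rw [Finset.sum_boole]
  congr 1
  have h3 : (Finset.range (A + B - 1)).filter (fun x => max a b ≤ x ∧ x < min a b + A) =
      Finset.Ico (max a b) (min a b + A) := by
    have := Finset.mem_range.mp ha
    have := Finset.mem_range.mp hb
    ext x; simp only [Finset.mem_filter, Finset.mem_range, Finset.mem_Ico]; omega
  rw [h3, Nat.card_Ico]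

theorem sum_coverCount_sq {M L : ℕ} (hL : 1 ≤ L ∧ L ≤ M) :
    ∑ x ∈ Finset.range M, coverCount (M - L + 1) L 0 x ^ 2 = cFactor M L := by
  obtain ⟨K, rfl⟩ := Nat.exists_eq_add_of_le hL.2
  rw [Nat.add_sub_cancel_left]
  rcases le_or_gt L K with h | h
  · have := sum_coverCount_sq_of_le (h.trans (Nat.le_succ K))
    rw [show K + 1 + L - 1 = L + K by omega] at this
    rw [this, cFactor, min_eq_left (by push_cast; have : (L : ℝ) ≤ K := by exact_mod_cast h
                                       linarith)]
    push_cast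
    ring
  -- Here the subarray length `K + 1` is the smaller length, whereas the minimum in `cFactor` is
  -- `K`; both cases give the same polynomial in `K` and `L`.
  · have := sum_coverCount_sq_of_le (A := L) (B := K + 1) h
    rw [show L + (K + 1) - 1 = L + K by omega] at this
    simp only [coverCount_comm (K + 1)]
    rw [this, cFactor, min_eq_right (by push_cast; have : (K : ℝ) < L := by exact_mod_cast h
                                        linarith)]
    push_cast
    ring

section Weight

variable {R : ℕ} {M L : Fin R → ℕ}

/-- The net number of subarray elements of the shifted minus the unshifted part at `m`. -/
noncomputable def gridWeight (hL : ∀ p, 1 ≤ L p ∧ L p ≤ M p) (r : Fin R) (m : Grid M) : ℝ :=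
  ∑ i, ∑ ℓ : Grid L, ((if subarrayPos hL (shiftPos (subSize M L) r 1 i) ℓ = m then 1 else 0) -
    if subarrayPos hL (shiftPos (subSize M L) r 0 i) ℓ = m then 1 else 0)

theorem sum_gridWeight_mul (hL : ∀ p, 1 ≤ L p ∧ L p ≤ M p) (r : Fin R) (q : Grid M → ℝ) :
    ∑ m, gridWeight hL r m * q m =
      ∑ i, ∑ ℓ : Grid L, (q (subarrayPos hL (shiftPos (subSize M L) r 1 i) ℓ) -
        q (subarrayPos hL (shiftPos (subSize M L) r 0 i) ℓ)) := by
  simp only [gridWeight, Finset.sum_mul]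
  rw [Finset.sum_comm]
  refine Finset.sum_congr rfl fun i _ => ?_
  rw [Finset.sum_comm]
  refine Finset.sum_congr rfl fun ℓ _ => ?_
  simp [sub_mul, Finset.sum_sub_distrib]

theorem sum_ite_subarrayPos_shiftPos (hL : ∀ p, 1 ≤ L p ∧ L p ≤ M p) (r : Fin R) (e : Fin 2)
    (m : Grid M) :
    (∑ i, ∑ ℓ : Grid L,
      if subarrayPos hL (shiftPos (subSize M L) r e i) ℓ = m then (1 : ℝ) else 0) =
      ∏ p, coverCount (shiftSize (subSize M L) r p) (L p) (if p = r then e else 0) (m p) := by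
  have h : ∀ p, coverCount (shiftSize (subSize M L) r p) (L p) (if p = r then e else 0) (m p) =
      ∑ i : Fin (shiftSize (subSize M L) r p), ∑ ℓ : Fin (L p),
        if (i : ℕ) + (if p = r then (e : ℕ) else 0) + ℓ = m p then (1 : ℝ) else 0 := fun p => by
    rw [coverCount, ← Fin.sum_univ_eq_sum_range (fun i => ∑ ℓ ∈ Finset.range (L p),
      if i + (if p = r then (e : ℕ) else 0) + ℓ = m p then (1 : ℝ) else 0)]
    refine Finset.sum_congr rfl fun i _ => ?_
    rw [← Fin.sum_univ_eq_sum_range (fun ℓ =>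
      if (i : ℕ) + (if p = r then (e : ℕ) else 0) + ℓ = m p then (1 : ℝ) else 0)]
  simp only [h]
  rw [Fintype.prod_sum]
  refine Finset.sum_congr rfl fun i _ => ?_
  rw [Fintype.prod_sum]
  refine Finset.sum_congr rfl fun ℓ _ => ?_
  rw [Finset.prod_ite_zero]
  simp only [Finset.prod_const_one, Finset.mem_univ, true_imp_iff, funext_iff, subarrayPos,
    shiftPos, Fin.ext_iff]

/-- The covering indicator factorises over the modes, and the two parts differ only in mode `r`,
where they have `M r - L r` positions. -/
theorem gridWeight_eq_prod (hL : ∀ p, 1 ≤ L p ∧ L p ≤ M p) (r : Fin R) (m : Grid M) :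
    gridWeight hL r m = ∏ p, if p = r then coverCount (M p - L p) (L p) 1 (m p) -
      coverCount (M p - L p) (L p) 0 (m p) else coverCount (M p - L p + 1) (L p) 0 (m p) := by
  simp only [gridWeight, Finset.sum_sub_distrib]
  rw [sum_ite_subarrayPos_shiftPos, sum_ite_subarrayPos_shiftPos,
    ← Finset.mul_prod_erase _ _ (Finset.mem_univ r),
    ← Finset.mul_prod_erase _ _ (Finset.mem_univ r),
    ← Finset.mul_prod_erase _ _ (Finset.mem_univ r)]
  have h : ∀ e : Fin 2, ∏ p ∈ Finset.univ.erase r,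
      coverCount (shiftSize (subSize M L) r p) (L p) (if p = r then (e : ℕ) else 0) (m p) =
      ∏ p ∈ Finset.univ.erase r, if p = r then coverCount (M p - L p) (L p) 1 (m p) -
        coverCount (M p - L p) (L p) 0 (m p) else coverCount (M p - L p + 1) (L p) 0 (m p) :=
    fun e => Finset.prod_congr rfl fun p hp => by
      have := Finset.ne_of_mem_erase hp
      rw [if_neg this, if_neg this, shiftSize, Function.update_of_ne this, subSize]
  rw [h, h, ← sub_mul, if_pos rfl, if_pos rfl, if_pos rfl, shiftSize, Function.update_self, subSize]
  rfl

theorem sum_gridWeight_sq (hL : ∀ p, 1 ≤ L p ∧ L p ≤ M p) (r : Fin R) :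
    ∑ m, gridWeight hL r m ^ 2 = 2 * min (L r : ℝ) (M r - L r) *
      ∏ p ∈ Finset.univ.erase r, cFactor (M p) (L p) := by
  simp only [gridWeight_eq_prod, ← Finset.prod_pow]
  rw [← Fintype.prod_sum (fun p (x : Fin (M p)) =>
    (if p = r then coverCount (M p - L p) (L p) 1 x -
      coverCount (M p - L p) (L p) 0 x else coverCount (M p - L p + 1) (L p) 0 x) ^ 2),
    ← Finset.mul_prod_erase _ _ (Finset.mem_univ r)]
  congr 1
  · simp only [if_true]
    rw [Fin.sum_univ_eq_sum_range (fun x => (coverCount (M r - L r) (L r) 1 x -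
      coverCount (M r - L r) (L r) 0 x) ^ 2)]
    have := sum_coverCount_sub_sq (M r - L r) (L r)
    rw [Nat.sub_add_cancel (hL r).2] at this
    rw [this, Nat.cast_sub (hL r).2]
  · refine Finset.prod_congr rfl fun p hp => ?_
    simp only [if_neg (Finset.ne_of_mem_erase hp)]
    rw [Fin.sum_univ_eq_sum_range (fun x => coverCount (M p - L p + 1) (L p) 0 x ^ 2),
      sum_coverCount_sq (hL p)]

/-- A sum of squares whose term at the corner `x = 0` is one. Positivity is needed for the quotient
of MSEs to make sense. -/
theorem cFactor_pos {M L : ℕ} (hL : 1 ≤ L ∧ L ≤ M) : 0 < cFactor M L := by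
  rw [← sum_coverCount_sq hL]
  have h0 : coverCount (M - L + 1) L 0 0 = 1 := by
    rw [coverCount]
    simp only [add_zero, sum_range_ite_add_eq]
    rw [Finset.sum_eq_single 0]
    · rw [if_pos (by omega)]
    · intro i _ hi
      rw [if_neg (by omega)]
    · simp
  refine Finset.sum_pos' (fun _ _ => by positivity) ⟨0, Finset.mem_range.mpr (by omega), ?_⟩
  rw [h0]; norm_num

end Weight

/-! ### Second moments of linear functionals of circular white noise -/

section Moments

variable {Ω : Type*} [MeasurableSpace Ω] {P : Measure Ω} {κ ν : Type*} [Fintype κ] [DecidableEq κ]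
  [Fintype ν] [DecidableEq ν] {W : Ω → Matrix κ ν ℂ} {σ : ℝ}

theorem sq_im_eq (z : ℂ) : z.im ^ 2 = (z * star z - z * z).re / 2 := by
  simp only [Complex.sub_re, Complex.mul_re, Complex.star_def, Complex.conj_re, Complex.conj_im]
  ring

/-- `(Im z)² = (|z|² - Re z²) / 2`: the covariance leaves only the diagonal of the first double sum,
and the vanishing pseudo-covariance kills the second. -/
theorem IsCircularWhiteNoise.integral_im_sq (hW : IsCircularWhiteNoise P W σ) (G : κ × ν → ℂ) :
    Integrable (fun ω => (∑ q, G q * W ω q.1 q.2).im ^ 2) P ∧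
      ∫ ω, (∑ q, G q * W ω q.1 q.2).im ^ 2 ∂P = σ ^ 2 / 2 * ∑ q, ‖G q‖ ^ 2 := by
  have hmem : ∀ q : κ × ν, MemLp (fun ω => W ω q.1 q.2) 2 P := fun q => hW.memLp q.1 q.2
  have hmems : ∀ q : κ × ν, MemLp (fun ω => star (W ω q.1 q.2)) 2 P := fun q => (hmem q).star
  have hi1 : ∀ q q' : κ × ν, Integrable (fun ω => G q * star (G q') *
      (W ω q.1 q.2 * star (W ω q'.1 q'.2))) P := fun q q' =>
    ((hmem q).integrable_mul (hmems q')).const_mul _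
  have hi2 : ∀ q q' : κ × ν, Integrable (fun ω => G q * G q' *
      (W ω q.1 q.2 * W ω q'.1 q'.2)) P := fun q q' =>
    ((hmem q).integrable_mul (hmem q')).const_mul _
  have hS1 : Integrable (fun ω => ∑ q, ∑ q', G q * star (G q') *
      (W ω q.1 q.2 * star (W ω q'.1 q'.2))) P :=
    integrable_finsetSum _ fun q _ => integrable_finsetSum _ fun q' _ => hi1 q q'
  have hS2 : Integrable (fun ω => ∑ q, ∑ q', G q * G q' *
      (W ω q.1 q.2 * W ω q'.1 q'.2)) P :=
    integrable_finsetSum _ fun q _ => integrable_finsetSum _ fun q' _ => hi2 q q'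
  have hpt : ∀ ω, (∑ q, G q * W ω q.1 q.2).im ^ 2 =
      RCLike.re ((∑ q, ∑ q', G q * star (G q') * (W ω q.1 q.2 * star (W ω q'.1 q'.2))) -
        ∑ q, ∑ q', G q * G q' * (W ω q.1 q.2 * W ω q'.1 q'.2)) / 2 := by
    intro ω
    rw [sq_im_eq, RCLike.re_eq_complex_re]
    congr 3
    · rw [star_sum, Finset.sum_mul_sum]
      refine Finset.sum_congr rfl fun q _ => Finset.sum_congr rfl fun q' _ => ?_
      rw [star_mul']; ring
    · rw [Finset.sum_mul_sum]
      refine Finset.sum_congr rfl fun q _ => Finset.sum_congr rfl fun q' _ => ?_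
      ring
  simp only [hpt]
  refine ⟨(hS1.sub hS2).re.div_const 2, ?_⟩
  have hre := integral_re (hS1.sub hS2)
  simp only [Pi.sub_apply] at hre
  rw [integral_div, hre, integral_sub hS1 hS2,
    integral_finsetSum _ fun q _ => integrable_finsetSum _ fun q' _ => hi1 q q',
    integral_finsetSum _ fun q _ => integrable_finsetSum _ fun q' _ => hi2 q q']
  have e1 : ∀ q, ∫ ω, ∑ q', G q * star (G q') * (W ω q.1 q.2 * star (W ω q'.1 q'.2)) ∂P =
      ((‖G q‖ ^ 2 * σ ^ 2 : ℝ) : ℂ) := fun q => by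
    rw [integral_finsetSum _ fun q' _ => hi1 q q']
    simp only [integral_const_mul, hW.covariance, ← Prod.ext_iff, mul_ite, mul_zero]
    rw [Finset.sum_ite_eq, if_pos (Finset.mem_univ q), Complex.star_def, Complex.mul_conj']
    push_cast
    rfl
  have e2 : ∀ q, ∫ ω, ∑ q', G q * G q' * (W ω q.1 q.2 * W ω q'.1 q'.2) ∂P = 0 := fun q => by
    rw [integral_finsetSum _ fun q' _ => hi2 q q']
    simp only [integral_const_mul, hW.pseudoCovariance, mul_zero, Finset.sum_const_zero]
  simp only [e1, e2, Finset.sum_const_zero, sub_zero, ← Complex.ofReal_sum,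
    RCLike.re_eq_complex_re, Complex.ofReal_re, ← Finset.sum_mul]
  ring

theorem IsCircularWhiteNoise.integrable_frob_sq (hW : IsCircularWhiteNoise P W σ) :
    Integrable (fun ω => frob (W ω) ^ 2) P := by
  simp only [frob_sq]
  exact integrable_finsetSum _ fun i _ => integrable_finsetSum _ fun n _ =>
    (hW.memLp i n).integrable_norm_pow (by norm_num)

end Moments

/-! ### High SNR -/

section HighSNR

variable {κ ν : Type*} [Fintype κ] [Fintype ν]

theorem frob_smul {t : ℝ} (ht : 0 ≤ t) (E : Matrix κ ν ℂ) : frob ((t : ℂ) • E) = t * frob E := by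
  rw [frob, frob, ← Real.sqrt_sq ht, ← Real.sqrt_mul (by positivity), Finset.mul_sum,
    Real.sqrt_sq ht]
  congr 1
  refine Finset.sum_congr rfl fun i _ => ?_
  rw [Finset.mul_sum]
  refine Finset.sum_congr rfl fun n _ => ?_
  rw [Matrix.smul_apply, smul_eq_mul, norm_mul, Complex.norm_real, Real.norm_of_nonneg ht, mul_pow]

/-- For `t F < ε` the difference of squares factors into an error of order `(t F)²` and a sum of
order `t F`. Otherwise `1 / t² ≤ F² / ε²`, and boundedness of `a` suffices. The form `F² min (t F,
ε)` covers both regimes and tends to zero under an integrable majorant. -/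
theorem abs_sq_div_sub_sq_le {C ε K B a b t F : ℝ} (hC : 0 ≤ C) (hε : 0 < ε) (hK : 0 ≤ K)
    (ht : 0 < t) (hF : 0 ≤ F) (hb : |b| ≤ K * F) (ha : |a| ≤ B)
    (hnear : t * F < ε → |a - t * b| ≤ C * (t * F) ^ 2) :
    |a ^ 2 / t ^ 2 - b ^ 2| ≤
      (C * (2 * K + C * ε) + (B ^ 2 / ε ^ 2 + K ^ 2) / ε) * (F ^ 2 * min (t * F) ε) := by
  have hB : 0 ≤ B := (abs_nonneg a).trans ha
  have htF : 0 ≤ t * F := by positivity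
  have e : a ^ 2 / t ^ 2 - b ^ 2 = (a - t * b) * (a + t * b) / t ^ 2 := by
    field_simp
    ring
  rcases lt_or_ge (t * F) ε with h | h
  · rw [min_eq_left h.le, e, abs_div, abs_mul, abs_of_pos (pow_pos ht 2),
      div_le_iff₀ (by positivity)]
    have h1 := hnear h
    have h2 : |a + t * b| ≤ (2 * K + C * ε) * (t * F) := by
      have : a + t * b = (a - t * b) + 2 * t * b := by ring
      rw [this]
      refine (abs_add_le _ _).trans ?_
      rw [abs_mul, abs_of_pos (by positivity : 0 < 2 * t)]
      have h3 : C * (t * F) ^ 2 ≤ C * ε * (t * F) := by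
        have := mul_le_mul_of_nonneg_left h.le (mul_nonneg hC htF)
        nlinarith
      have h4 := mul_le_mul_of_nonneg_left hb (by positivity : 0 ≤ 2 * t)
      nlinarith
    have h5 := mul_le_mul h1 h2 (abs_nonneg _) (by positivity)
    refine h5.trans ?_
    have h6 : 0 ≤ (B ^ 2 / ε ^ 2 + K ^ 2) / ε * (F ^ 2 * (t * F)) * t ^ 2 := by positivity
    calc C * (t * F) ^ 2 * ((2 * K + C * ε) * (t * F))
        = C * (2 * K + C * ε) * (F ^ 2 * (t * F)) * t ^ 2 := by ring
      _ ≤ _ := by linarith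
  · rw [min_eq_right h]
    have h1 : a ^ 2 / t ^ 2 ≤ B ^ 2 / ε ^ 2 * F ^ 2 := by
      rw [div_le_iff₀ (by positivity)]
      have h2 : a ^ 2 ≤ B ^ 2 := sq_le_sq' (abs_le.mp ha).1 (abs_le.mp ha).2
      have h3 : ε ^ 2 ≤ (t * F) ^ 2 := pow_le_pow_left₀ hε.le h 2
      calc a ^ 2 ≤ B ^ 2 := h2
        _ = B ^ 2 / ε ^ 2 * ε ^ 2 := by field_simp
        _ ≤ B ^ 2 / ε ^ 2 * (t * F) ^ 2 := by gcongr
        _ = _ := by ring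
    have h4 : b ^ 2 ≤ K ^ 2 * F ^ 2 := by
      rw [← mul_pow]
      exact sq_le_sq' (by linarith [(abs_le.mp hb).1]) (abs_le.mp hb).2
    have h5 : |a ^ 2 / t ^ 2 - b ^ 2| ≤ a ^ 2 / t ^ 2 + b ^ 2 := by
      rw [abs_le]
      have := div_nonneg (sq_nonneg a) (sq_nonneg t)
      constructor <;> linarith [sq_nonneg b]
    have h6 : 0 ≤ C * (2 * K + C * ε) * (F ^ 2 * ε) := by positivity
    calc _ ≤ B ^ 2 / ε ^ 2 * F ^ 2 + K ^ 2 * F ^ 2 := by linarith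
      _ = (B ^ 2 / ε ^ 2 + K ^ 2) / ε * (F ^ 2 * ε) := by field_simp
      _ ≤ _ := by linarith

theorem hasHighSNRMSE_of_isFirstOrderError {Ω : Type*} [MeasurableSpace Ω] {P : Measure Ω}
    [IsProbabilityMeasure P] {Est : Matrix κ ν ℂ → ℝ → Prop} {X₀ : Matrix κ ν ℂ} {μ : ℝ}
    {ℓ : Matrix κ ν ℂ →ₗ[ℝ] ℝ} {W : Ω → Matrix κ ν ℂ} {f : ℝ → ℝ} {v K B : ℝ}
    (hℓ : IsFirstOrderError Est X₀ μ ℓ) (hB : ∀ Y m, Est Y m → |m| ≤ B) (hK : 0 ≤ K)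
    (hℓK : ∀ E, |ℓ E| ≤ K * frob E) (hWi : Integrable (fun ω => frob (W ω) ^ 2) P)
    (hi : Integrable (fun ω => ℓ (W ω) ^ 2) P) (hv : ∫ ω, ℓ (W ω) ^ 2 ∂P = v) (hv0 : v ≠ 0)
    (hf : ∀ t, 0 < t → f t = t ^ 2 * v) : HasHighSNRMSE P Est X₀ μ W f := by
  intro m hm
  obtain ⟨C, ε, hε, hC⟩ := hℓ
  -- The sign of `C` is not known, hence the absolute value; `B + |μ|` bounds the estimation error.
  set D := |C| * (2 * K + |C| * ε) + ((B + |μ|) ^ 2 / ε ^ 2 + K ^ 2) / ε with hD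
  have hbound : ∀ t, 0 < t → ∀ᵐ ω ∂P, |(m t ω - μ) ^ 2 / t ^ 2 - ℓ (W ω) ^ 2| ≤
      D * (frob (W ω) ^ 2 * min (t * frob (W ω)) ε) := by
    intro t ht
    filter_upwards [(hm t ht).2] with ω hω
    refine abs_sq_div_sub_sq_le (abs_nonneg C) hε hK ht (frob_nonneg _) (hℓK _) ?_ fun hlt => ?_
    · exact (abs_sub _ _).trans (add_le_add_left (hB _ _ hω) _)
    · have h := (hC ((t : ℂ) • W ω) (by rwa [frob_smul ht.le])).2 _ hω
      have hs : ℓ ((t : ℂ) • W ω) = t * ℓ (W ω) := by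
        rw [← smul_eq_mul, ← map_smul]
        rfl
      rw [hs, frob_smul ht.le] at h
      exact h.trans (mul_le_mul_of_nonneg_right (le_abs_self C) (by positivity))
  have hFm : AEStronglyMeasurable (fun ω => frob (W ω)) P := by
    have h := Real.continuous_sqrt.comp_aestronglyMeasurable hWi.aestronglyMeasurable
    refine h.congr (Eventually.of_forall fun ω => Real.sqrt_sq (frob_nonneg _))
  have hGm : ∀ t : ℝ, AEStronglyMeasurable
      (fun ω => D * (frob (W ω) ^ 2 * min (t * frob (W ω)) ε)) P := fun t =>
    (hWi.aestronglyMeasurable.mul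
      ((hFm.const_mul t).inf aestronglyMeasurable_const)).const_mul D
  have hGb : ∀ t : ℝ, 0 < t → ∀ ω, ‖D * (frob (W ω) ^ 2 * min (t * frob (W ω)) ε)‖ ≤
      |D| * (frob (W ω) ^ 2 * ε) := fun t ht ω => by
    have hmin : 0 ≤ min (t * frob (W ω)) ε := le_min (mul_nonneg ht.le (frob_nonneg _)) hε.le
    rw [norm_mul, Real.norm_eq_abs, Real.norm_of_nonneg (by positivity)]
    gcongr
    exact min_le_right _ _
  have hbi : Integrable (fun ω => |D| * (frob (W ω) ^ 2 * ε)) P := (hWi.mul_const ε).const_mul |D|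
  have hGi : ∀ t : ℝ, 0 < t →
      Integrable (fun ω => D * (frob (W ω) ^ 2 * min (t * frob (W ω)) ε)) P := fun t ht =>
    hbi.mono' (hGm t) (Eventually.of_forall (hGb t ht))
  have hG0 : Tendsto (fun t : ℝ => ∫ ω, D * (frob (W ω) ^ 2 * min (t * frob (W ω)) ε) ∂P)
      (𝓝[>] 0) (𝓝 0) := by
    have h := tendsto_integral_filter_of_dominated_convergence (μ := P) (l := 𝓝[>] (0 : ℝ))
      (F := fun t ω => D * (frob (W ω) ^ 2 * min (t * frob (W ω)) ε)) (f := fun _ => (0 : ℝ))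
      (fun ω => |D| * (frob (W ω) ^ 2 * ε)) (Eventually.of_forall hGm)
      (eventually_mem_nhdsWithin.mono fun t ht => Eventually.of_forall (hGb t ht)) hbi
      (Eventually.of_forall fun ω => ?_)
    · simpa using h
    · have hc : Continuous fun t : ℝ => D * (frob (W ω) ^ 2 * min (t * frob (W ω)) ε) := by
        fun_prop
      have h0 := hc.tendsto 0
      simp only [zero_mul, min_eq_left hε.le, mul_zero] at h0
      exact h0.mono_left nhdsWithin_le_nhds
  have hmi : ∀ t, 0 < t → Integrable (fun ω => (m t ω - μ) ^ 2 / t ^ 2) P := by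
    intro t ht
    have hmeas : AEStronglyMeasurable (fun ω => (m t ω - μ) ^ 2 / t ^ 2) P :=
      (by fun_prop : Continuous fun x : ℝ => (x - μ) ^ 2 / t ^ 2).comp_aestronglyMeasurable
        (hm t ht).1
    refine Integrable.of_bound hmeas ((B + |μ|) ^ 2 / t ^ 2) ?_
    filter_upwards [(hm t ht).2] with ω hω
    rw [Real.norm_of_nonneg (by positivity)]
    have h1 : |m t ω - μ| ≤ B + |μ| := (abs_sub _ _).trans (add_le_add_left (hB _ _ hω) _)
    have h2 := sq_le_sq' (abs_le.mp h1).1 (abs_le.mp h1).2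
    gcongr
  have hlim : Tendsto (fun t : ℝ => ∫ ω, (m t ω - μ) ^ 2 / t ^ 2 ∂P) (𝓝[>] 0) (𝓝 v) := by
    rw [tendsto_iff_norm_sub_tendsto_zero]
    refine squeeze_zero' (Eventually.of_forall fun t => norm_nonneg _) ?_ hG0
    filter_upwards [eventually_mem_nhdsWithin] with t ht
    rw [← hv, ← integral_sub (hmi t ht) hi]
    exact norm_integral_le_of_norm_le (hGi t ht) (hbound t ht)
  have hfne : ∀ᶠ t in 𝓝[>] (0 : ℝ), f t ≠ 0 := by
    filter_upwards [eventually_mem_nhdsWithin] with t ht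
    rw [hf t ht]
    exact mul_ne_zero (pow_ne_zero 2 (ne_of_gt ht)) hv0
  rw [isEquivalent_iff_tendsto_one hfne]
  have h1 := hlim.div_const v
  rw [div_self hv0] at h1
  refine h1.congr' ?_
  filter_upwards [eventually_mem_nhdsWithin] with t ht
  rw [Pi.div_apply, hf t ht, integral_div, div_div]

end HighSNR

/-! ### The mean square error -/

section MeanSquareError

variable {R N : ℕ} {M L : Fin R → ℕ}

/-- Regrouping by grid points merges the repeated use of one noise sample by overlapping subarrays,
so that whiteness can be applied. -/
theorem firstOrderError_eq_im (hL : ∀ p, 1 ≤ L p ∧ L p ≤ M p) (r : Fin R) (a : Grid M → ℂ)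
    (s : Fin N → ℂ) (E : Matrix (Grid M) (Fin N) ℂ) :
    firstOrderError hL r a s E = (∑ q : Grid M × Fin N,
      ((((Fintype.card (Grid (shiftSize (subSize M L) r)) : ℝ) *
        (Fintype.card (Grid L) * ∑ n, ‖s n‖ ^ 2))⁻¹ * gridWeight hL r q.1 : ℝ) *
          star (a q.1 * s q.2)) * E q.1 q.2).im := by
  simp only [firstOrderError, LinearMap.smul_apply, LinearMap.sum_apply, LinearMap.sub_apply,
    smul_eq_mul]
  rw [← sum_gridWeight_mul hL r fun m => pointError a s m E, Complex.im_sum, Finset.mul_sum,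
    Fintype.sum_prod_type]
  refine Finset.sum_congr rfl fun m _ => ?_
  simp only [pointError, LinearMap.coe_mk, AddHom.coe_mk, mul_assoc, Complex.ofReal_mul,
    Complex.im_ofReal_mul, Finset.mul_sum]

theorem exists_abs_firstOrderError_le (hL : ∀ p, 1 ≤ L p ∧ L p ≤ M p) (r : Fin R)
    (a : Grid M → ℂ) (s : Fin N → ℂ) :
    ∃ K, 0 ≤ K ∧ ∀ E, |firstOrderError hL r a s E| ≤ K * frob E := by
  set G : Grid M × Fin N → ℂ := fun q =>
    ((((Fintype.card (Grid (shiftSize (subSize M L) r)) : ℝ) *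
        (Fintype.card (Grid L) * ∑ n, ‖s n‖ ^ 2))⁻¹ * gridWeight hL r q.1 : ℝ) *
          star (a q.1 * s q.2)) with hG
  refine ⟨∑ q, ‖G q‖, by positivity, fun E => ?_⟩
  rw [firstOrderError_eq_im, Finset.sum_mul]
  refine (Complex.abs_im_le_norm _).trans ((norm_sum_le _ _).trans ?_)
  refine Finset.sum_le_sum fun q _ => ?_
  rw [norm_mul]
  exact mul_le_mul_of_nonneg_left (norm_apply_le_frob E q.1 q.2) (norm_nonneg _)

theorem card_grid (D : Fin R → ℕ) : Fintype.card (Grid D) = ∏ p, D p := by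
  simp [Grid, Fintype.card_pi]

theorem card_grid_shiftSize (hL : ∀ p, 1 ≤ L p ∧ L p ≤ M p) (r : Fin R) :
    (Fintype.card (Grid (shiftSize (subSize M L) r)) : ℝ) =
      (M r - L r) * ∏ p ∈ Finset.univ.erase r, ((M p : ℝ) - L p + 1) := by
  rw [card_grid, Nat.cast_prod, ← Finset.mul_prod_erase _ _ (Finset.mem_univ r)]
  congr 1
  · rw [shiftSize, Function.update_self, subSize, Nat.add_sub_cancel, Nat.cast_sub (hL r).2]
  · refine Finset.prod_congr rfl fun p hp => ?_
    rw [shiftSize, Function.update_of_ne (Finset.ne_of_mem_erase hp), subSize, Nat.cast_add,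
      Nat.cast_sub (hL p).2, Nat.cast_one]

theorem effectiveSNR_eq {s : Fin N → ℂ} (hs : s ≠ 0) (σ : ℝ) :
    effectiveSNR s σ = (∑ n, ‖s n‖ ^ 2) / σ ^ 2 := by
  have hN : (N : ℝ) ≠ 0 := by
    rintro h
    rw [Nat.cast_eq_zero] at h
    subst h
    exact hs (Subsingleton.elim _ _)
  rw [effectiveSNR, sourcePower, mul_div_cancel₀ _ hN]

theorem mseSS_eq (hL : ∀ p, 1 ≤ L p ∧ L p ≤ M p) (r : Fin R) (hr : L r < M r) (ρ : ℝ) :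
    mseSS M L r ρ = 1 / ρ * (min (L r : ℝ) (M r - L r) / (((M r : ℝ) - L r) ^ 2 * (L r : ℝ) ^ 2)) *
      ∏ p ∈ Finset.univ.erase r,
        cFactor (M p) (L p) / (((M p : ℝ) - L p + 1) ^ 2 * (L p : ℝ) ^ 2) := by
  have hl : (0 : ℝ) < L r := by exact_mod_cast (hL r).1
  have hm : (0 : ℝ) < M r - L r := by
    have : (L r : ℝ) < M r := by exact_mod_cast hr
    linarith
  rw [mseSS]
  congr 1
  split_ifs with h
  · rw [min_eq_left (by linarith)]
    field_simp
  · rw [min_eq_right (by linarith)]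
    field_simp

theorem mseSS_pos (hL : ∀ p, 1 ≤ L p ∧ L p ≤ M p) (r : Fin R) (hr : L r < M r) {ρ : ℝ}
    (hρ : 0 < ρ) : 0 < mseSS M L r ρ := by
  rw [mseSS_eq hL r hr]
  have hl : ∀ p, (0 : ℝ) < L p := fun p => by exact_mod_cast (hL p).1
  have hm : (0 : ℝ) < M r - L r := by
    have : (L r : ℝ) < M r := by exact_mod_cast hr
    linarith
  have hmin := lt_min (hl r) hm
  have hlr := hl r
  refine mul_pos (by positivity) (Finset.prod_pos fun p _ => ?_)
  have h1 : (0 : ℝ) < (M p : ℝ) - L p + 1 := by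
    have : (L p : ℝ) ≤ M p := by exact_mod_cast (hL p).2
    linarith
  have h2 := hl p
  have h3 := cFactor_pos (hL p)
  positivity

variable {Ω : Type*} [MeasurableSpace Ω] {P : Measure Ω} {s : Fin N → ℂ} {σ : ℝ}
  {W : Ω → Matrix (Grid M) (Fin N) ℂ}

/-- The steering vector is unimodular, so only the weights and `‖s‖²` enter. The factor `2` from the
squared weights cancels the `1 / 2` from the imaginary part, and one power of `‖s‖²` cancels against
the normalisation. -/
theorem integral_firstOrderError_sq (hL : ∀ p, 1 ≤ L p ∧ L p ≤ M p) (r : Fin R) (hr : L r < M r)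
    (δ μ : Fin R → ℝ) (hs : s ≠ 0) (hσ : 0 < σ) (hW : IsCircularWhiteNoise P W σ) :
    Integrable (fun ω => firstOrderError hL r (steering M δ μ) s (W ω) ^ 2) P ∧
      ∫ ω, firstOrderError hL r (steering M δ μ) s (W ω) ^ 2 ∂P =
        mseSS M L r (effectiveSNR s σ) := by
  simp only [firstOrderError_eq_im]
  obtain ⟨h1, h2⟩ := hW.integral_im_sq fun q : Grid M × Fin N =>
    ((((Fintype.card (Grid (shiftSize (subSize M L) r)) : ℝ) *
      (Fintype.card (Grid L) * ∑ n, ‖s n‖ ^ 2))⁻¹ * gridWeight hL r q.1 : ℝ) *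
        star (steering M δ μ q.1 * s q.2))
  refine ⟨h1, h2.trans ?_⟩
  have hS : 0 < ∑ n, ‖s n‖ ^ 2 := sum_norm_sq_pos hs
  have hn : ∀ q : Grid M × Fin N,
      ‖((((Fintype.card (Grid (shiftSize (subSize M L) r)) : ℝ) *
      (Fintype.card (Grid L) * ∑ n, ‖s n‖ ^ 2))⁻¹ * gridWeight hL r q.1 : ℝ) *
        star (steering M δ μ q.1 * s q.2) : ℂ)‖ ^ 2 =
      (((Fintype.card (Grid (shiftSize (subSize M L) r)) : ℝ) *
      (Fintype.card (Grid L) * ∑ n, ‖s n‖ ^ 2)) ^ 2)⁻¹ * (gridWeight hL r q.1 ^ 2 * ‖s q.2‖ ^ 2) :=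
    fun q => by
      rw [norm_mul, norm_star, norm_mul, steering_eq_planeWave, norm_planeWave, one_mul,
        Complex.norm_real, mul_pow, Real.norm_eq_abs, sq_abs, mul_pow, inv_pow, mul_assoc]
  simp only [hn]
  rw [← Finset.mul_sum, Fintype.sum_prod_type]
  simp only [← Finset.mul_sum]
  rw [← Finset.sum_mul, sum_gridWeight_sq, card_grid_shiftSize hL, card_grid, Nat.cast_prod,
    ← Finset.mul_prod_erase _ _ (Finset.mem_univ r), mseSS_eq hL r hr, effectiveSNR_eq hs,
    Finset.prod_div_distrib, Finset.prod_mul_distrib, Finset.prod_pow, Finset.prod_pow]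
  have hl : (0 : ℝ) < L r := by exact_mod_cast (hL r).1
  have hm : (0 : ℝ) < M r - L r := by
    have : (L r : ℝ) < M r := by exact_mod_cast hr
    linarith
  have hA : 0 < ∏ p ∈ Finset.univ.erase r, ((M p : ℝ) - L p + 1) :=
    Finset.prod_pos fun p _ => by
      have : (L p : ℝ) ≤ M p := by exact_mod_cast (hL p).2
      linarith
  have hB : 0 < ∏ p ∈ Finset.univ.erase r, (L p : ℝ) :=
    Finset.prod_pos fun p _ => by exact_mod_cast (hL p).1
  set S := ∑ n, ‖s n‖ ^ 2
  set A := ∏ p ∈ Finset.univ.erase r, ((M p : ℝ) - L p + 1)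
  set B := ∏ p ∈ Finset.univ.erase r, (L p : ℝ)
  field_simp

theorem mseSS_effectiveSNR_mul (hL : ∀ p, 1 ≤ L p ∧ L p ≤ M p) (r : Fin R) (hr : L r < M r)
    (hs : s ≠ 0) (σ t : ℝ) :
    mseSS M L r (effectiveSNR s (t * σ)) = t ^ 2 * mseSS M L r (effectiveSNR s σ) := by
  rw [mseSS_eq hL r hr, mseSS_eq hL r hr, effectiveSNR_eq hs, effectiveSNR_eq hs, one_div_div,
    one_div_div]
  ring

theorem attainsMSE_of_isFirstOrderError [IsProbabilityMeasure P]
    (hL : ∀ p, 1 ≤ L p ∧ L p ≤ M p) (r : Fin R) (hr : L r < M r)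
    (δ μ : Fin R → ℝ) (hs : s ≠ 0) (hσ : 0 < σ) (hW : IsCircularWhiteNoise P W σ)
    {Est : Matrix (Grid M) (Fin N) ℂ → ℝ → Prop} (hB : ∀ Y m, Est Y m → |m| ≤ Real.pi)
    (hEst : IsFirstOrderError Est (noiseFree M δ μ s) (μ r)
      (firstOrderError hL r (steering M δ μ) s)) :
    AttainsMSE P M L r δ μ s σ W Est := by
  obtain ⟨hi, hv⟩ := integral_firstOrderError_sq hL r hr δ μ hs hσ hW
  obtain ⟨K, hK, hℓK⟩ := exists_abs_firstOrderError_le hL r (steering M δ μ) s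
  have hρ : 0 < effectiveSNR s σ := by
    rw [effectiveSNR_eq hs]
    have := sum_norm_sq_pos hs
    positivity
  exact ⟨⟨_, hEst, hi, hv⟩, hasHighSNRMSE_of_isFirstOrderError hEst hB hK hℓK
    hW.integrable_frob_sq hi hv (mseSS_pos hL r hr hρ).ne'
    fun t _ => mseSS_effectiveSNR_mul hL r hr hs σ t⟩

end MeanSquareError

end SmoothedESPRIT

theorem theorem3 {Ω : Type*} [MeasurableSpace Ω] (P : Measure Ω) [IsProbabilityMeasure P]
    {R N : ℕ} (M L : Fin R → ℕ) (hL : ∀ p, 1 ≤ L p ∧ L p ≤ M p)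
    (r : Fin R) (hr : L r < M r)
    (δ μ : Fin R → ℝ) (hμ : |μ r| < Real.pi)
    (s : Fin N → ℂ) (hs : s ≠ 0)
    (σ : ℝ) (hσ : 0 < σ) (W : Ω → Matrix (SmoothedESPRIT.Grid M) (Fin N) ℂ)
    (hW : SmoothedESPRIT.IsCircularWhiteNoise P W σ) :
    SmoothedESPRIT.AttainsMSE P M L r δ μ s σ W (SmoothedESPRIT.SmoothedStandard M L r) ∧
    SmoothedESPRIT.AttainsMSE P M L r δ μ s σ W (SmoothedESPRIT.SmoothedUnitary M L r) ∧
    (SmoothedESPRIT.IsStrictlyNonCircular s →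
      SmoothedESPRIT.AttainsMSE P M L r δ μ s σ W (SmoothedESPRIT.SmoothedNCStandard M L r) ∧
      SmoothedESPRIT.AttainsMSE P M L r δ μ s σ W (SmoothedESPRIT.SmoothedNCUnitary M L r)) :=
  ⟨SmoothedESPRIT.attainsMSE_of_isFirstOrderError hL r hr δ μ hs hσ hW
      (fun _ _ h => SmoothedESPRIT.IsStandardEspritEstimate.abs_le h)
      (SmoothedESPRIT.isFirstOrderError_smoothedStandard hL hr δ hμ hs),
    SmoothedESPRIT.attainsMSE_of_isFirstOrderError hL r hr δ μ hs hσ hW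
      (fun _ _ h => SmoothedESPRIT.IsUnitaryEspritEstimate.abs_le h)
      (SmoothedESPRIT.isFirstOrderError_smoothedUnitary hL hr δ hμ hs),
    fun hnc => ⟨SmoothedESPRIT.attainsMSE_of_isFirstOrderError hL r hr δ μ hs hσ hW
      (fun _ _ h => SmoothedESPRIT.IsStandardEspritEstimate.abs_le h)
      (SmoothedESPRIT.isFirstOrderError_smoothedNCStandard hL hr δ hμ hs hnc),
    SmoothedESPRIT.attainsMSE_of_isFirstOrderError hL r hr δ μ hs hσ hW
      (fun _ _ h => SmoothedESPRIT.IsUnitaryEspritEstimate.abs_le h)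
      (SmoothedESPRIT.isFirstOrderError_smoothedNCUnitary hL hr δ hμ hs hnc)⟩⟩
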